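/- Let $d\in\mathbb N$, $1\le p,q\le\infty$, and let $g\in\mathcal S(\mathbb R^d)$, $g\neq0$, be a fixed window. For a tempered distribution $f\in\mathcal S'(\mathbb R^d)$ put $$V_gf(x,\xi)=\int_{\mathbb R^d}e^{-2\pi i\xi\cdot y}f(y)g(y-x)\,dy$$ (understood as the bilinear pairing of $f$ with the Schwartz function $y\mapsto e^{-2\pi i\xi\cdot y}g(y-x)$) and $$\|f\|_{M^{p,q}}=\big\|\,\|V_gf(\cdot,\xi)\|_{L^p(\mathbb R^d)}\big\|_{L^q_\xi(\mathbb R^d)}\in[0,\infty],\qquad M^{p,q}(\mathbb R^d)=\{f\in\mathcal S'(\mathbb R^d):\|f\|_{M^{p,q}}<\infty\}.$$ For $A\in GL(d,\mathbb R)$ let $f_A=f(A\,\cdot)$, i.e. $\langle f_A,\varphi\rangle=|\det A|^{-1}\langle f,\varphi(A^{-1}\cdot)\rangle$ for $\varphi\in\mathcal S(\mathbb R^d)$. With $1/p'=1-1/p$ and $1/\infty=0$, let $$\mu_1(p,q)=\begin{cases}-1/p&\text{if }1/q\le\min(1/p,1/p'),\\ 1/q-1&\text{if }1/p'\le\min(1/q,1/2),\\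 -2/p+1/q&\text{if }1/p\le\min(1/q,1/2),\end{cases} \qquad \mu_2(p,q)=\begin{cases}-1/p&\text{if }\max(1/p,1/p')\le1/q,\\ 1/q-1&\text{if }\max(1/q,1/2)\le1/p',\\ -2/p+1/q&\text{if }\max(1/q,1/2)\le1/p\end{cases}$$ (in each definition the cases cover all $p,q$ and agree where they overlap). (a) There exists a constant $C>0$ (depending only on $d,p,q,g$) such that for every symmetric matrix $A\in GL(d,\mathbb R)$ with eigenvalues $\lambda_1,\dots,\lambda_d$ (counted with multiplicity) and every $f\in M^{p,q}(\mathbb R^d)$, $$\|f_A\|_{M^{p,q}}\le C\prod_{j=1}^d(\max\{1,|\lambda_j|\})^{\mu_1(p,q)}(\min\{1,|\lambda_j|\})^{\mu_2(p,q)}\,\|f\|_{M^{p,q}}.$$ (b) Conversely, let $\alpha_1,\dots,\alpha_d,\beta_1,\dots,\beta_d\in\mathbb R$ and suppose that there is a constant $C>0$ such that for all non-zero real $\lambda_1,\dots,\lambda_d$, with $A=\mathrm{diag}[\lambda_1,\dots,\lambda_d]$, and all $f\in M^{p,q}(\mathbb R^d)$, $$\|f_A\|_{M^{p,q}}\le C\prod_{j=1}^d(\max\{1,|\lambda_j|\})^{\alpha_j}(\min\{1,|\lambda_j|\})^{\beta_j}\,\|f\|_{M^{p,q}}.$$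 Then $\alpha_j\ge\mu_1(p,q)$ and $\beta_j\le\mu_2(p,q)$ for every $j=1,\dots,d$. -/

import Mathlib

open MeasureTheory
open scoped SchwartzMap ENNReal

noncomputable section

namespace ModulationDilation

variable {d : ℕ}

/-! ### Time-frequency shifts and the short-time Fourier transform -/

/-- The character `y ↦ e^{-2πi ξ·y}` on `ℝᵈ`. -/
def conjChar (ξ y : EuclideanSpace ℝ (Fin d)) : ℂ :=
  Complex.exp (((-2 * Real.pi * inner ℝ ξ y : ℝ) : ℂ) * Complex.I)

theorem iteratedDeriv_exp_I (n : ℕ) :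
    iteratedDeriv n (fun t : ℝ => Complex.exp ((t : ℂ) * Complex.I)) =
      fun t : ℝ => Complex.I ^ n * Complex.exp ((t : ℂ) * Complex.I) := by
  induction n with
  | zero => simp
  | succ n ih =>
    rw [iteratedDeriv_succ, ih]
    funext t
    have h : HasDerivAt (fun t : ℝ => Complex.exp ((t : ℂ) * Complex.I))
        (Complex.exp ((t : ℂ) * Complex.I) * Complex.I) t := by
      have h1 : HasDerivAt (fun t : ℝ => (t : ℂ) * Complex.I) (1 * Complex.I) t :=
        (Complex.ofRealCLM.hasDerivAt (x := t)).mul_const Complex.I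
      simpa using h1.cexp
    rw [(h.const_mul (Complex.I ^ n)).deriv]
    ring

theorem exp_I_hasTemperateGrowth :
    (fun t : ℝ => Complex.exp ((t : ℂ) * Complex.I)).HasTemperateGrowth := by
  refine ⟨?_, fun n => ⟨0, 1, fun x => ?_⟩⟩
  · exact (Complex.ofRealCLM.contDiff.mul contDiff_const).cexp
  · rw [norm_iteratedFDeriv_eq_norm_iteratedDeriv, iteratedDeriv_exp_I]
    simp [Complex.norm_exp_ofReal_mul_I]

theorem conjChar_hasTemperateGrowth (ξ : EuclideanSpace ℝ (Fin d)) :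
    (conjChar ξ).HasTemperateGrowth := by
  have h : (fun y : EuclideanSpace ℝ (Fin d) =>
      (-2 * Real.pi * inner ℝ ξ y : ℝ)).HasTemperateGrowth := by
    have := Function.hasTemperateGrowth_inner_right ξ
    fun_prop
  exact exp_I_hasTemperateGrowth.comp h

/-- The time-frequency shifted window `M_{-ξ} T_x g`, that is
`y ↦ e^{-2πi ξ·y} g(y - x)`, as a Schwartz function. -/
def shiftedWindow (g : 𝓢(EuclideanSpace ℝ (Fin d), ℂ)) (x ξ : EuclideanSpace ℝ (Fin d)) :
    𝓢(EuclideanSpace ℝ (Fin d), ℂ) :=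
  SchwartzMap.smulLeftCLM ℂ (conjChar ξ) (g.compSubConstCLM ℂ x)

theorem shiftedWindow_apply (g : 𝓢(EuclideanSpace ℝ (Fin d), ℂ))
    (x ξ y : EuclideanSpace ℝ (Fin d)) :
    shiftedWindow g x ξ y = conjChar ξ y * g (y - x) := by
  simp [shiftedWindow, SchwartzMap.smulLeftCLM_apply_apply (conjChar_hasTemperateGrowth ξ)]

/-- The short-time Fourier transform of a tempered distribution `f` with window `g`:
`V_g f(x, ξ) = ∫ e^{-2πi ξ·y} f(y) g(y - x) dy`, the integral being the (bilinear) pairing of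
`f` with the Schwartz function `y ↦ e^{-2πi ξ·y} g(y - x)`. -/
def stft (g : 𝓢(EuclideanSpace ℝ (Fin d), ℂ)) (f : 𝓢'(EuclideanSpace ℝ (Fin d), ℂ))
    (x ξ : EuclideanSpace ℝ (Fin d)) : ℂ :=
  f (shiftedWindow g x ξ)

/-! ### Modulation spaces -/

/-- The modulation space norm `‖ ‖V_g f(·, ξ)‖_{L^p} ‖_{L^q_ξ}`, with values in `[0, ∞]`. -/
def modNorm (g : 𝓢(EuclideanSpace ℝ (Fin d), ℂ)) (p q : ℝ≥0∞)
    (f : 𝓢'(EuclideanSpace ℝ (Fin d), ℂ)) : ℝ≥0∞ :=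
  eLpNorm (fun ξ => eLpNorm (fun x => stft g f x ξ) p volume) q volume

/-- The modulation space `M^{p,q}(ℝᵈ)`: the tempered distributions of finite norm, the norm being
computed with the window `g`. -/
def modSpace (g : 𝓢(EuclideanSpace ℝ (Fin d), ℂ)) (p q : ℝ≥0∞) :
    Set 𝓢'(EuclideanSpace ℝ (Fin d), ℂ) :=
  {f | modNorm g p q f < ∞}

/-! ### Dilations -/

/-- The linear automorphism `x ↦ A x` of `ℝᵈ` given by an invertible matrix. -/
def matrixEquiv (A : GL (Fin d) ℝ) :
    EuclideanSpace ℝ (Fin d) ≃L[ℝ] EuclideanSpace ℝ (Fin d) :=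
  ContinuousLinearEquiv.unitsEquiv ℝ (EuclideanSpace ℝ (Fin d))
    (Units.map (Matrix.toEuclideanCLM (n := Fin d) (𝕜 := ℝ) :
      Matrix (Fin d) (Fin d) ℝ →* _) A)

theorem matrixEquiv_apply (A : GL (Fin d) ℝ) (x : EuclideanSpace ℝ (Fin d)) :
    matrixEquiv A x =
      WithLp.toLp 2 (Matrix.mulVec (A : Matrix (Fin d) (Fin d) ℝ) (WithLp.ofLp x)) := rfl

/-- The dilation `f_A = f(A ·)` of a tempered distribution:
`⟨f_A, φ⟩ = |det A|⁻¹ ⟨f, φ(A⁻¹ ·)⟩`. -/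
def dilation (A : GL (Fin d) ℝ) (f : 𝓢'(EuclideanSpace ℝ (Fin d), ℂ)) :
    𝓢'(EuclideanSpace ℝ (Fin d), ℂ) :=
  ((|(A : Matrix (Fin d) (Fin d) ℝ).det|⁻¹ : ℝ) : ℂ) •
    PointwiseConvergenceCLM.precomp ℂ
      (SchwartzMap.compCLMOfContinuousLinearEquiv ℂ (matrixEquiv A).symm) f

theorem dilation_apply (A : GL (Fin d) ℝ) (f : 𝓢'(EuclideanSpace ℝ (Fin d), ℂ))
    (φ : 𝓢(EuclideanSpace ℝ (Fin d), ℂ)) :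
    dilation A f φ = ((|(A : Matrix (Fin d) (Fin d) ℝ).det|⁻¹ : ℝ) : ℂ) *
      f (SchwartzMap.compCLMOfContinuousLinearEquiv ℂ (matrixEquiv A).symm φ) := rfl

/-- On functions, `dilation A` is composition with `x ↦ A x`. -/
theorem dilation_schwartz (A : GL (Fin d) ℝ) (f : 𝓢(EuclideanSpace ℝ (Fin d), ℂ)) :
    dilation A (SchwartzMap.toTemperedDistributionCLM (EuclideanSpace ℝ (Fin d)) ℂ volume f) =
      SchwartzMap.toTemperedDistributionCLM (EuclideanSpace ℝ (Fin d)) ℂ volume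
        (SchwartzMap.compCLMOfContinuousLinearEquiv ℂ (matrixEquiv A) f) := by
  ext φ
  rw [dilation_apply]
  simp only [SchwartzMap.toTemperedDistributionCLM_apply_apply,
    SchwartzMap.compCLMOfContinuousLinearEquiv_apply, Function.comp_apply, smul_eq_mul]
  have hdet : LinearMap.det
      ((matrixEquiv A : EuclideanSpace ℝ (Fin d) ≃L[ℝ] EuclideanSpace ℝ (Fin d)) :
        EuclideanSpace ℝ (Fin d) →ₗ[ℝ] EuclideanSpace ℝ (Fin d)) =
      (A : Matrix (Fin d) (Fin d) ℝ).det := by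
    have : ((matrixEquiv A : EuclideanSpace ℝ (Fin d) ≃L[ℝ] EuclideanSpace ℝ (Fin d)) :
        EuclideanSpace ℝ (Fin d) →ₗ[ℝ] EuclideanSpace ℝ (Fin d)) =
        Matrix.toEuclideanLin (A : Matrix (Fin d) (Fin d) ℝ) := rfl
    rw [this, Matrix.toEuclideanLin_eq_toLin_orthonormal, LinearMap.det_toLin]
  have h := (matrixEquiv A).toHomeomorph.measurableEmbedding.integral_map (μ := volume)
    (fun x => φ ((matrixEquiv A).symm x) * f x)
  have hm := Measure.map_linearMap_addHaar_eq_smul_addHaar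
    (volume : Measure (EuclideanSpace ℝ (Fin d)))
    (f := ((matrixEquiv A : EuclideanSpace ℝ (Fin d) ≃L[ℝ] EuclideanSpace ℝ (Fin d)) :
        EuclideanSpace ℝ (Fin d) →ₗ[ℝ] EuclideanSpace ℝ (Fin d)))
    (by rw [hdet]; exact (Matrix.GeneralLinearGroup.det A).ne_zero)
  rw [hdet] at hm
  have hm' : Measure.map (matrixEquiv A).toHomeomorph
      (volume : Measure (EuclideanSpace ℝ (Fin d))) = _ := hm
  rw [hm', integral_smul_measure, ENNReal.toReal_ofReal (abs_nonneg _)] at h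
  rw [abs_inv] at h
  rw [← Complex.real_smul, h]
  refine integral_congr_ae (Filter.Eventually.of_forall fun x => ?_)
  change φ ((matrixEquiv A).symm (matrixEquiv A x)) * f (matrixEquiv A x) = _
  rw [ContinuousLinearEquiv.symm_apply_apply]

/-! ### The indices -/

/-- `1/p` as a real number, with `1/∞ = 0`. -/
def recip (p : ℝ≥0∞) : ℝ := (p⁻¹).toReal

/-- The index `μ₁(p,q)`, for `1 ≤ p, q ≤ ∞`, writing `1/p' = 1 - 1/p`. It is `-1/p` if
`min(1/p, 1/p') ≥ 1/q`, `1/q - 1` if `min(1/q, 1/2) ≥ 1/p'`, and `-2/p + 1/q` if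
`min(1/q, 1/2) ≥ 1/p`. The three regions cover all exponents, and the values agree where they
overlap. -/
def mu1 (p q : ℝ≥0∞) : ℝ :=
  if recip q ≤ min (recip p) (1 - recip p) then -recip p
  else if 1 - recip p ≤ min (recip q) (1 / 2) then recip q - 1
  else -2 * recip p + recip q

/-- The index `μ₂(p,q)`, for `1 ≤ p, q ≤ ∞`, writing `1/p' = 1 - 1/p`. It is `-1/p` if
`max(1/p, 1/p') ≤ 1/q`, `1/q - 1` if `max(1/q, 1/2) ≤ 1/p'`, and `-2/p + 1/q` if
`max(1/q, 1/2) ≤ 1/p`. The three regions cover all exponents, and the values agree where they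
overlap. -/
def mu2 (p q : ℝ≥0∞) : ℝ :=
  if max (recip p) (1 - recip p) ≤ recip q then -recip p
  else if max (recip q) (1 / 2) ≤ 1 - recip p then recip q - 1
  else -2 * recip p + recip q

theorem mu1_cases (p q : ℝ≥0∞) :
    (recip q ≤ min (recip p) (1 - recip p) → mu1 p q = -recip p) ∧
    (1 - recip p ≤ min (recip q) (1 / 2) → mu1 p q = recip q - 1) ∧
    (recip p ≤ min (recip q) (1 / 2) → mu1 p q = -2 * recip p + recip q) ∧
    (recip q ≤ min (recip p) (1 - recip p) ∨ 1 - recip p ≤ min (recip q) (1 / 2) ∨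
      recip p ≤ min (recip q) (1 / 2)) := by
  unfold mu1
  simp only [le_min_iff]
  refine ⟨?_, ?_, ?_, ?_⟩
  · grind
  · rintro ⟨h1, h2⟩
    split_ifs <;> first | linarith | exact absurd (And.intro h1 h2) (by assumption)
  · rintro ⟨h1, h2⟩
    split_ifs <;> linarith
  · by_contra! h
    grind

theorem mu2_cases (p q : ℝ≥0∞) :
    (max (recip p) (1 - recip p) ≤ recip q → mu2 p q = -recip p) ∧
    (max (recip q) (1 / 2) ≤ 1 - recip p → mu2 p q = recip q - 1) ∧
    (max (recip q) (1 / 2) ≤ recip p → mu2 p q = -2 * recip p + recip q) ∧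
    (max (recip p) (1 - recip p) ≤ recip q ∨ max (recip q) (1 / 2) ≤ 1 - recip p ∨
      max (recip q) (1 / 2) ≤ recip p) := by
  unfold mu2
  simp only [max_le_iff]
  refine ⟨?_, ?_, ?_, ?_⟩
  · grind
  · rintro ⟨h1, h2⟩
    split_ifs <;> first | linarith | exact absurd (And.intro h1 h2) (by assumption)
  · rintro ⟨h1, h2⟩
    split_ifs <;> linarith
  · by_contra! h
    grind

theorem isHermitian_of_isSymm {A : Matrix (Fin d) (Fin d) ℝ} (hA : A.IsSymm) :
    A.IsHermitian := by
  rw [Matrix.IsHermitian, Matrix.conjTranspose_eq_transpose_of_trivial]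
  exact hA

end ModulationDilation

end

/-! # Dilations on modulation spaces

The short-time Fourier transform of `f_A` with window `g` is, up to `|det A|⁻¹` and linear changes
of both variables, the one of `f` with the dilated window `g ∘ A⁻¹` (`stft_dilation`). Hence
`‖f_A‖_{M^{p,q}} = |det A|^{-1 - 1/p + 1/q} ‖f‖`, the norm on the right being computed with the
window `g ∘ A⁻¹` (`modNorm_dilation`), and part (a) is a statement about dilated windows. Any two
fixed non-zero windows give comparable norms (`exists_modNorm_le_modNorm`), so `g` may be replaced
by a band-limited window `ψ`.

* If `A` is expanding, the Fourier transforms of the windows `ψ ∘ A⁻¹` have a common compact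
  support, so `V_{ψ ∘ A⁻¹} f(x, ξ)` is, for every frequency `η` near `ξ`, the Fourier transform at
  `ξ - η` of `(ψ ∘ A⁻¹)(· - x) V_χ f(·, η)`, with a fixed window `χ`. The inequalities of Minkowski,
  Hausdorff–Young and Young bound the norm by `‖ψ ∘ A⁻¹‖_{1/ρ}`, that is by `|det A|^ρ`, where
  `ρ = max (1/p, 1/p', 1/q')` (`exists_modNorm_le_of_bandlimited`).
* If `A` is contracting, the Fourier transform of a piece `ψ(· - x) V_{ψ ∘ A⁻¹} f(·, ξ)` is
  supported in a set of measure `≲ |det A|⁻¹` and controlled by `V_ψ f`. The same three inequalities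
  and Fourier inversion bound the norm by `|det A|^ρ` with `ρ = min (1/p, 1/p', 1/q')`
  (`exists_modNorm_le_of_disjoint_bands`).

In both cases `ρ - 1 - 1/p + 1/q` is the asserted exponent (`mu1_eq`, `mu2_eq`). A symmetric matrix
is an orthogonal conjugate of the product of an expanding and a contracting diagonal matrix
(`exists_decomposition`). As orthogonal maps are both expanding and contracting, part (a) follows by
composing four dilations, and no interpolation between modulation spaces is needed.

The modulation norms of the complex Gaussians `e^{-π Σ (a_j + i b_j) x_j²}`, computed with a
Gaussian window, are explicit and factor over the coordinates (`modNorm_gaussian`), which reduces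
part (b) to one variable (`exists_gaussNorm_le`). There the dilation by `e^t` is tested on three
pairs of Gaussians, with parameters `1 ↦ e^{2t}`, `e^{-2t} ↦ 1` and
`e^{-4t} + i e^{-2t} ↦ e^{-2t} + i`. The norms grow at the rates `1/q - 1`, `-1/p` and `1/q - 2/p`,
so that `α_j` is at least and `β_j` at most each of these numbers (`mu_bounds`).

Analytically, everything rests on the fact that a tempered distribution commutes with integrals of
Schwartz functions (`apply_eq_integral`).
-/

noncomputable section

open MeasureTheory
open scoped SchwartzMap ENNReal FourierTransform Topology

namespace ModulationDilation

variable {d : ℕ}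

local notation "𝔼" => EuclideanSpace ℝ (Fin d)

/-! ### Distributions and integrals of Schwartz functions -/

section Pettis

variable {E : Type*} [NormedAddCommGroup E] [NormedSpace ℝ E]

/-- The space of `l`-linear forms in which the `l`-th derivative of a complex function on `E` takes
its values. It is a definition of its own so that all instances on spaces of functions with values
in it come from the same normed group structure. -/
def DerivSpace (E : Type*) [NormedAddCommGroup E] [NormedSpace ℝ E] (l : ℕ) : Type _ :=
  E [×l]→L[ℝ] ℂ

instance (l : ℕ) : NormedAddCommGroup (DerivSpace E l) :=
  inferInstanceAs (NormedAddCommGroup (E [×l]→L[ℝ] ℂ))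

instance (l : ℕ) : NormedSpace ℝ (DerivSpace E l) :=
  inferInstanceAs (NormedSpace ℝ (E [×l]→L[ℝ] ℂ))

instance (l : ℕ) : NormedSpace ℂ (DerivSpace E l) :=
  inferInstanceAs (NormedSpace ℂ (E [×l]→L[ℝ] ℂ))

instance (l : ℕ) : CompleteSpace (DerivSpace E l) :=
  inferInstanceAs (CompleteSpace (E [×l]→L[ℝ] ℂ))

instance (l : ℕ) : SMulCommClass ℝ ℂ (DerivSpace E l) :=
  inferInstanceAs (SMulCommClass ℝ ℂ (E [×l]→L[ℝ] ℂ))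

/-- The `l`-th derivative of a Schwartz function. -/
def iterDeriv (l : ℕ) (φ : 𝓢(E, ℂ)) (x : E) : DerivSpace E l :=
  iteratedFDeriv ℝ l φ x

theorem continuous_iterDeriv (l : ℕ) (φ : 𝓢(E, ℂ)) : Continuous (iterDeriv l φ) :=
  (φ.smooth ⊤).continuous_iteratedFDeriv (by exact_mod_cast le_top)

theorem norm_iterDeriv_le (k l : ℕ) (φ : 𝓢(E, ℂ)) (x : E) :
    ‖(‖x‖ ^ k : ℝ) • iterDeriv l φ x‖ ≤ SchwartzMap.seminorm ℂ k l φ := by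
  rw [norm_smul, norm_pow, norm_norm]
  exact SchwartzMap.le_seminorm ℂ k l φ x

/-- The weighted derivative `x ↦ ‖x‖ ^ k • D^l φ x` of a Schwartz function, as a bounded continuous
function; its sup norm is the Schwartz seminorm of index `(k, l)`. -/
def weightedDeriv (k l : ℕ) : 𝓢(E, ℂ) →ₗ[ℂ] (BoundedContinuousFunction E (DerivSpace E l)) where
  toFun φ := BoundedContinuousFunction.ofNormedAddCommGroup
    (fun x => (‖x‖ ^ k : ℝ) • iterDeriv l φ x)
    ((continuous_norm.pow k).smul (continuous_iterDeriv l φ))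
    (SchwartzMap.seminorm ℂ k l φ) (norm_iterDeriv_le k l φ)
  map_add' φ ψ := by
    ext1 x
    change (‖x‖ ^ k : ℝ) • iteratedFDeriv ℝ l (⇑φ + ⇑ψ) x = (‖x‖ ^ k : ℝ) • iteratedFDeriv ℝ l φ x
      + (‖x‖ ^ k : ℝ) • iteratedFDeriv ℝ l ψ x
    rw [iteratedFDeriv_add_apply (φ.smooth l).contDiffAt (ψ.smooth l).contDiffAt, smul_add]
  map_smul' c φ := by
    ext1 x
    change (‖x‖ ^ k : ℝ) • iteratedFDeriv ℝ l (c • ⇑φ) x =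
      c • ((‖x‖ ^ k : ℝ) • iteratedFDeriv ℝ l φ x)
    rw [iteratedFDeriv_const_smul_apply (φ.smooth l).contDiffAt, smul_comm]

theorem weightedDeriv_apply (k l : ℕ) (φ : 𝓢(E, ℂ)) (x : E) :
    weightedDeriv k l φ x = (‖x‖ ^ k : ℝ) • iterDeriv l φ x := rfl

theorem norm_weightedDeriv_le (k l : ℕ) (φ : 𝓢(E, ℂ)) :
    ‖weightedDeriv k l φ‖ ≤ SchwartzMap.seminorm ℂ k l φ :=
  BoundedContinuousFunction.norm_ofNormedAddCommGroup_le _ (apply_nonneg _ _)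
    (norm_iterDeriv_le k l φ)

theorem seminorm_le_norm_weightedDeriv (k l : ℕ) (φ : 𝓢(E, ℂ)) :
    SchwartzMap.seminorm ℂ k l φ ≤ ‖weightedDeriv k l φ‖ := by
  refine SchwartzMap.seminorm_le_bound ℂ k l φ (norm_nonneg (weightedDeriv k l φ)) fun x => ?_
  have := (weightedDeriv k l φ).norm_coe_le_norm x
  rwa [weightedDeriv_apply, norm_smul, norm_pow, norm_norm] at this

theorem continuous_weightedDeriv (k l : ℕ) :
    Continuous (weightedDeriv k l : 𝓢(E, ℂ) → BoundedContinuousFunction E (DerivSpace E l)) :=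
  (schwartz_withSeminorms ℂ E ℂ).continuous_normedSpace_rng _ (weightedDeriv k l)
    ⟨{(k, l)}, 1, Seminorm.le_def.2 fun φ => by
      rw [Finset.sup_singleton, one_smul]
      exact norm_weightedDeriv_le k l φ⟩

/-- A tempered distribution is bounded by finitely many Schwartz seminorms. -/
theorem exists_seminorm_bound (f : 𝓢'(E, ℂ)) :
    ∃ (s : Finset (ℕ × ℕ)) (C : ℝ), 0 ≤ C ∧
      ∀ φ, ‖f φ‖ ≤ C * ∑ i ∈ s, SchwartzMap.seminorm ℂ i.1 i.2 φ := by
  obtain ⟨s, C, -, h⟩ := Seminorm.bound_of_continuous (schwartz_withSeminorms ℂ E ℂ)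
    ((normSeminorm ℂ ℂ).comp (f : 𝓢(E, ℂ) →ₗ[ℂ] ℂ))
    (continuous_norm.comp f.continuous)
  refine ⟨s, C, C.2, fun φ => (h φ).trans ?_⟩
  rw [smul_apply]
  refine mul_le_mul_of_nonneg_left ?_ C.2
  refine (Seminorm.le_def.1 (Seminorm.finset_sup_le_sum _ s) φ).trans_eq ?_
  rw [sum_apply]
  rfl

/-- By Hahn–Banach, a tempered distribution factors through finitely many of the Banach-space
valued maps `weightedDeriv k l`. -/
theorem exists_factor_weightedDeriv (f : 𝓢'(E, ℂ)) :
    ∃ (s : Finset (ℕ × ℕ))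
      (F : (Π i : s, BoundedContinuousFunction E (DerivSpace E i.1.2)) →L[ℂ] ℂ),
      ∀ φ, f φ = F (fun i => weightedDeriv i.1.1 i.1.2 φ) := by
  obtain ⟨s, C, hC, hf⟩ := exists_seminorm_bound f
  let J : 𝓢(E, ℂ) →ₗ[ℂ] (Π i : s, BoundedContinuousFunction E (DerivSpace E i.1.2)) :=
    LinearMap.pi fun i => weightedDeriv i.1.1 i.1.2
  have hb : ∀ φ, ‖f φ‖ ≤ C * s.card * ‖J φ‖ := fun φ => by
    refine (hf φ).trans ?_
    rw [mul_assoc, ← nsmul_eq_mul]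
    refine mul_le_mul_of_nonneg_left (Finset.sum_le_card_nsmul _ _ _ fun i hi => ?_) hC
    exact (seminorm_le_norm_weightedDeriv _ _ φ).trans (norm_le_pi_norm (J φ) ⟨i, hi⟩)
  have hker : LinearMap.ker J ≤ LinearMap.ker (f : 𝓢(E, ℂ) →ₗ[ℂ] ℂ) := fun φ hφ => by
    have := hb φ
    rw [LinearMap.mem_ker.1 hφ] at this
    exact norm_le_zero_iff.1 (this.trans_eq (by rw [norm_zero, mul_zero]))
  let g : LinearMap.range J →ₗ[ℂ] ℂ :=
    (LinearMap.ker J).liftQ (f : 𝓢(E, ℂ) →ₗ[ℂ] ℂ) hker ∘ₗ J.quotKerEquivRange.symm.toLinearMap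
  have hg : ∀ φ, g ⟨J φ, φ, rfl⟩ = f φ := fun φ => by
    have : J.quotKerEquivRange.symm ⟨J φ, φ, rfl⟩ = (LinearMap.ker J).mkQ φ :=
      J.quotKerEquivRange_symm_apply_image φ ⟨φ, rfl⟩
    simp only [g, LinearMap.comp_apply, LinearEquiv.coe_coe, this]
    rfl
  obtain ⟨F, hF, -⟩ := exists_extension_norm_eq (LinearMap.range J)
    (g.mkContinuous (C * s.card) (by
      rintro ⟨_, φ, rfl⟩
      rw [hg]
      exact hb φ))
  refine ⟨s, F, fun φ => ?_⟩
  rw [← hg φ]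
  exact (hF ⟨J φ, φ, rfl⟩).symm

variable {Y : Type*} [TopologicalSpace Y] [MeasurableSpace Y] [OpensMeasurableSpace Y]
  [SecondCountableTopology Y] {μ : Measure Y}

theorem aestronglyMeasurable_iterDeriv {Φ : Y → 𝓢(E, ℂ)} (hΦ : Continuous Φ) (l : ℕ)
    (x : E) : AEStronglyMeasurable (fun y => iterDeriv l (Φ y) x) μ := by
  have h : (fun y => iterDeriv l (Φ y) x) = fun y => weightedDeriv 0 l (Φ y) x := by
    ext1 y
    rw [weightedDeriv_apply, pow_zero, one_smul]
  rw [h]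
  exact (((ContinuousEvalConst.continuous_eval_const x).comp
    (continuous_weightedDeriv 0 l)).comp hΦ).aestronglyMeasurable

/-- Differentiation under the integral sign for a parametrized Schwartz function. -/
theorem iterDeriv_eq_integral {Φ : Y → 𝓢(E, ℂ)} (hΦ : Continuous Φ)
    (hint : ∀ k l, Integrable (fun y => SchwartzMap.seminorm ℂ k l (Φ y)) μ) {Ψ : 𝓢(E, ℂ)}
    (hΨ : ∀ x, Ψ x = ∫ y, Φ y x ∂μ) (l : ℕ) (x : E) :
    iterDeriv l Ψ x = ∫ y, iterDeriv l (Φ y) x ∂μ := by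
  have hi : ∀ l x, Integrable (fun y => iterDeriv l (Φ y) x) μ := fun l x =>
    (hint 0 l).mono' (aestronglyMeasurable_iterDeriv hΦ l x)
      (.of_forall fun y => SchwartzMap.norm_iteratedFDeriv_le_seminorm ℂ (Φ y) l x)
  induction l generalizing x with
  | zero =>
    let L : ℂ ≃ₗᵢ[ℝ] DerivSpace E 0 := (continuousMultilinearCurryFin0 ℝ E ℂ).symm
    have h0 : ∀ φ : 𝓢(E, ℂ), iterDeriv 0 φ x = L (φ x) := fun φ =>
      congrFun iteratedFDeriv_zero_eq_comp x
    simp_rw [h0, hΨ]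
    exact (L.toContinuousLinearEquiv.integral_comp_comm _).symm
  | succ l ih =>
    let L : (E →L[ℝ] DerivSpace E l) ≃ₗᵢ[ℝ] DerivSpace E (l + 1) :=
      (continuousMultilinearCurryLeftEquiv ℝ (fun _ => E) ℂ).symm
    have h1 : ∀ (φ : 𝓢(E, ℂ)) x, iterDeriv (l + 1) φ x = L (fderiv ℝ (iterDeriv l φ) x) :=
      fun φ x => congrFun iteratedFDeriv_succ_eq_comp_left x
    have h2 : ∀ (φ : 𝓢(E, ℂ)) x, fderiv ℝ (iterDeriv l φ) x = L.symm (iterDeriv (l + 1) φ x) :=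
      fun φ x => by rw [h1, L.symm_apply_apply]
    have hd : HasFDerivAt (iterDeriv l Ψ) (∫ y, fderiv ℝ (iterDeriv l (Φ y)) x ∂μ) x := by
      have he : iterDeriv l Ψ = fun x => ∫ y, iterDeriv l (Φ y) x ∂μ := funext ih
      rw [he]
      refine hasFDerivAt_integral_of_dominated_of_fderiv_le (s := Set.univ)
        (F' := fun x y => fderiv ℝ (iterDeriv l (Φ y)) x) Filter.univ_mem
        (.of_forall fun x => aestronglyMeasurable_iterDeriv hΦ l x) (hi l x) ?_
        (.of_forall fun y x _ => ?_) (hint 0 (l + 1)) (.of_forall fun y x _ => ?_)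
      · simp_rw [h2]
        exact L.symm.continuous.comp_aestronglyMeasurable
          (aestronglyMeasurable_iterDeriv hΦ (l + 1) x)
      · rw [h2, L.symm.norm_map]
        exact SchwartzMap.norm_iteratedFDeriv_le_seminorm ℂ (Φ y) (l + 1) x
      · exact (((Φ y).smooth ⊤).differentiable_iteratedFDeriv
          (by exact_mod_cast WithTop.coe_lt_top l) x).hasFDerivAt
    simp_rw [h1, hd.fderiv]
    exact (L.toContinuousLinearEquiv.integral_comp_comm _).symm

/-- Tempered distributions commute with integrals of Schwartz functions: if `Ψ` is the pointwise
integral of a continuous family `Φ` of Schwartz functions all of whose seminorms are integrable,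
then `f Ψ = ∫ f (Φ y) dy`. -/
theorem apply_eq_integral (f : 𝓢'(E, ℂ)) {Φ : Y → 𝓢(E, ℂ)} (hΦ : Continuous Φ)
    (hint : ∀ k l, Integrable (fun y => SchwartzMap.seminorm ℂ k l (Φ y)) μ) {Ψ : 𝓢(E, ℂ)}
    (hΨ : ∀ x, Ψ x = ∫ y, Φ y x ∂μ) :
    f Ψ = ∫ y, f (Φ y) ∂μ := by
  obtain ⟨s, F, hF⟩ := exists_factor_weightedDeriv f
  have hJ : ∀ i : s, Integrable (fun y => weightedDeriv i.1.1 i.1.2 (Φ y)) μ := fun i =>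
    (hint i.1.1 i.1.2).mono'
      ((continuous_weightedDeriv i.1.1 i.1.2).comp hΦ).aestronglyMeasurable
      (.of_forall fun y => norm_weightedDeriv_le i.1.1 i.1.2 (Φ y))
  simp_rw [hF]
  have hJ' : Integrable (fun y => fun i : s => weightedDeriv i.1.1 i.1.2 (Φ y)) μ :=
    Integrable.of_eval hJ
  rw [F.integral_comp_comm hJ']
  congr 1
  ext1 i
  rw [eval_integral hJ]
  ext1 x
  rw [weightedDeriv_apply, iterDeriv_eq_integral hΦ hint hΨ, ← integral_smul]
  exact (BoundedContinuousFunction.evalCLM ℝ x).integral_comp_comm (hJ i)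

end Pettis

/-! ### Families of Schwartz functions -/

section Families

variable {E : Type*} [NormedAddCommGroup E] [NormedSpace ℝ E]

theorem pow_norm_le_of_norm_sub_le {F : Type*} [NormedAddCommGroup F] {x y : F} {r : ℝ}
    (h : ‖x - y‖ ≤ r) (k : ℕ) : ‖x‖ ^ k ≤ 2 ^ k * (‖y‖ ^ k + r ^ k) := by
  have hr : 0 ≤ r := (norm_nonneg _).trans h
  have h1 : ‖x‖ ≤ ‖y‖ + r := by
    have := norm_add_le y (x - y)
    rw [add_sub_cancel] at this
    linarith
  calc ‖x‖ ^ k ≤ (‖y‖ + r) ^ k := pow_le_pow_left₀ (norm_nonneg _) h1 k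
    _ ≤ 2 ^ (k - 1) * (‖y‖ ^ k + r ^ k) := add_pow_le (norm_nonneg _) hr k
    _ ≤ 2 ^ k * (‖y‖ ^ k + r ^ k) := by
      gcongr
      · norm_num
      · omega

theorem seminorm_translate_le (k l : ℕ) (t : E) (φ : 𝓢(E, ℂ)) :
    SchwartzMap.seminorm ℂ k l (φ.compSubConstCLM ℂ t) ≤
      2 ^ k * (SchwartzMap.seminorm ℂ k l φ + ‖t‖ ^ k * SchwartzMap.seminorm ℂ 0 l φ) := by
  refine SchwartzMap.seminorm_le_bound ℂ k l _ (by positivity) fun x => ?_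
  have h : iteratedFDeriv ℝ l (φ.compSubConstCLM ℂ t) x = iteratedFDeriv ℝ l φ (x - t) :=
    iteratedFDeriv_comp_sub l t x
  rw [h]
  have h1 := pow_norm_le_of_norm_sub_le (x := x) (y := x - t) (r := ‖t‖) (by simp) k
  calc ‖x‖ ^ k * ‖iteratedFDeriv ℝ l φ (x - t)‖
      ≤ 2 ^ k * (‖x - t‖ ^ k + ‖t‖ ^ k) * ‖iteratedFDeriv ℝ l φ (x - t)‖ := by gcongr
    _ = 2 ^ k * (‖x - t‖ ^ k * ‖iteratedFDeriv ℝ l φ (x - t)‖ +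
        ‖t‖ ^ k * ‖iteratedFDeriv ℝ l φ (x - t)‖) := by ring
    _ ≤ _ := by
      gcongr
      · exact SchwartzMap.le_seminorm ℂ k l φ _
      · exact SchwartzMap.norm_iteratedFDeriv_le_seminorm ℂ φ l _

/-- The mean value inequality for small translations of a Schwartz function. -/
theorem seminorm_translate_sub_le (k l : ℕ) (t : E) (φ : 𝓢(E, ℂ)) :
    SchwartzMap.seminorm ℂ k l (φ.compSubConstCLM ℂ t - φ) ≤
      2 ^ k * (SchwartzMap.seminorm ℂ k (l + 1) φ +
        ‖t‖ ^ k * SchwartzMap.seminorm ℂ 0 (l + 1) φ) * ‖t‖ := by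
  set B : ℝ := 2 ^ k * (SchwartzMap.seminorm ℂ k (l + 1) φ +
        ‖t‖ ^ k * SchwartzMap.seminorm ℂ 0 (l + 1) φ) with hB
  refine SchwartzMap.seminorm_le_bound ℂ k l _ (by positivity) fun x => ?_
  have h : iteratedFDeriv ℝ l (φ.compSubConstCLM ℂ t - φ) x =
      iteratedFDeriv ℝ l φ (x - t) - iteratedFDeriv ℝ l φ x := by
    have h0 : (φ.compSubConstCLM ℂ t - φ : 𝓢(E, ℂ)) = ⇑(φ.compSubConstCLM ℂ t) - ⇑φ := rfl
    rw [h0, iteratedFDeriv_sub_apply ((φ.compSubConstCLM ℂ t).smooth l).contDiffAt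
      (φ.smooth l).contDiffAt]
    congr 1
    exact iteratedFDeriv_comp_sub l t x
  have hdiff : ∀ y, DifferentiableAt ℝ (iteratedFDeriv ℝ l φ) y := fun y =>
    (φ.smooth ⊤).differentiable_iteratedFDeriv (by exact_mod_cast WithTop.coe_lt_top l) y
  have key := (convex_segment (x - t) x).norm_image_sub_le_of_norm_fderiv_le (𝕜 := ℝ)
    (f := fun y => (‖x‖ ^ k : ℝ) • iteratedFDeriv ℝ l φ y) (C := B)
    (fun y _ => (hdiff y).fun_const_smul _) (fun y hy => ?_)
    (right_mem_segment ℝ (x - t) x) (left_mem_segment ℝ (x - t) x)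
  · rw [h]
    rwa [← smul_sub, norm_smul, norm_pow, norm_norm,
      show ‖x - t - x‖ = ‖t‖ by rw [sub_right_comm, sub_self, zero_sub, norm_neg]] at key
  · rw [fderiv_fun_const_smul (hdiff y), norm_smul, norm_pow, norm_norm, norm_fderiv_iteratedFDeriv]
    have hxy : ‖x - y‖ ≤ ‖t‖ := by
      have := norm_sub_le_of_mem_segment hy
      rw [segment_symm] at hy
      have := norm_sub_le_of_mem_segment hy
      rw [norm_sub_rev]
      simpa using this
    calc ‖x‖ ^ k * ‖iteratedFDeriv ℝ (l + 1) φ y‖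
        ≤ 2 ^ k * (‖y‖ ^ k + ‖t‖ ^ k) * ‖iteratedFDeriv ℝ (l + 1) φ y‖ := by
          gcongr
          exact pow_norm_le_of_norm_sub_le hxy k
      _ = 2 ^ k * (‖y‖ ^ k * ‖iteratedFDeriv ℝ (l + 1) φ y‖ +
          ‖t‖ ^ k * ‖iteratedFDeriv ℝ (l + 1) φ y‖) := by ring
      _ ≤ B := by
        rw [hB]
        gcongr
        · exact SchwartzMap.le_seminorm ℂ k (l + 1) φ _
        · exact SchwartzMap.norm_iteratedFDeriv_le_seminorm ℂ φ (l + 1) _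

theorem continuous_seminorm (k l : ℕ) :
    Continuous (SchwartzMap.seminorm ℂ k l : 𝓢(E, ℂ) → ℝ) :=
  (schwartz_withSeminorms ℂ E ℂ).continuous_seminorm (k, l)

/-- Translation is jointly continuous in the vector and in the Schwartz function. -/
theorem continuous_translate :
    Continuous fun z : E × 𝓢(E, ℂ) => z.2.compSubConstCLM ℂ z.1 := by
  rw [continuous_iff_continuousAt]
  rintro ⟨t₀, φ₀⟩
  refine ((schwartz_withSeminorms ℂ E ℂ).tendsto_nhds _ _).2 ?_
  rintro ⟨k, l⟩ ε hε
  set ψ := φ₀.compSubConstCLM ℂ t₀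
  let G : E × 𝓢(E, ℂ) → ℝ := fun z =>
    2 ^ k * (SchwartzMap.seminorm ℂ k l (z.2 - φ₀) + ‖z.1‖ ^ k *
      SchwartzMap.seminorm ℂ 0 l (z.2 - φ₀)) +
    2 ^ k * (SchwartzMap.seminorm ℂ k (l + 1) ψ +
        ‖z.1 - t₀‖ ^ k * SchwartzMap.seminorm ℂ 0 (l + 1) ψ) * ‖z.1 - t₀‖
  have hG : Continuous G := by
    have h1 := (continuous_seminorm (E := E) k l).comp
      (continuous_snd.sub continuous_const : Continuous fun z : E × 𝓢(E, ℂ) => z.2 - φ₀)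
    have h2 := (continuous_seminorm (E := E) 0 l).comp
      (continuous_snd.sub continuous_const : Continuous fun z : E × 𝓢(E, ℂ) => z.2 - φ₀)
    simp only [Function.comp_def] at h1 h2
    fun_prop
  have hG0 : G (t₀, φ₀) = 0 := by simp [G]
  have := (hG.tendsto (t₀, φ₀)).eventually (gt_mem_nhds (by rw [hG0]; exact hε))
  filter_upwards [this] with z hz
  refine lt_of_le_of_lt ?_ hz
  have hdec : z.2.compSubConstCLM ℂ z.1 - ψ =
      (z.2 - φ₀).compSubConstCLM ℂ z.1 + (ψ.compSubConstCLM ℂ (z.1 - t₀) - ψ) := by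
    ext x
    simp [ψ]
  change SchwartzMap.seminorm ℂ k l (z.2.compSubConstCLM ℂ z.1 - ψ) ≤ _
  rw [hdec]
  exact (map_add_le_add _ _ _).trans
    (add_le_add (seminorm_translate_le _ _ _ _) (seminorm_translate_sub_le _ _ _ _))

variable {Y : Type*}

/-- A family of Schwartz functions, all of whose seminorms are bounded by powers of a weight. -/
def PolyBounded (W : Y → ℝ) (Φ : Y → 𝓢(E, ℂ)) : Prop :=
  ∀ k l, ∃ C : ℝ, 0 ≤ C ∧ ∃ N : ℕ, ∀ y, SchwartzMap.seminorm ℂ k l (Φ y) ≤ C * W y ^ N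

theorem polyBounded_const {W : Y → ℝ} (φ : 𝓢(E, ℂ)) : PolyBounded W fun _ => φ :=
  fun k l => ⟨SchwartzMap.seminorm ℂ k l φ, apply_nonneg _ _, 0, fun _ => by simp⟩

theorem exists_seminorm_clm_le {E' : Type*} [NormedAddCommGroup E'] [NormedSpace ℝ E']
    (T : 𝓢(E, ℂ) →L[ℂ] 𝓢(E', ℂ)) (k l : ℕ) :
    ∃ (s : Finset (ℕ × ℕ)) (C : ℝ), 0 ≤ C ∧ ∀ φ,
      SchwartzMap.seminorm ℂ k l (T φ) ≤ C * ∑ i ∈ s, SchwartzMap.seminorm ℂ i.1 i.2 φ := by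
  let q : Seminorm ℂ 𝓢(E, ℂ) := (SchwartzMap.seminorm ℂ k l).comp (T : 𝓢(E, ℂ) →ₗ[ℂ] 𝓢(E', ℂ))
  obtain ⟨s, C, -, h⟩ := Seminorm.bound_of_continuous (schwartz_withSeminorms ℂ E ℂ) q
    ((continuous_seminorm k l).comp T.continuous)
  refine ⟨s, C, C.2, fun φ => (h φ).trans ?_⟩
  rw [smul_apply]
  refine mul_le_mul_of_nonneg_left ?_ C.2
  refine (Seminorm.le_def.1 (Seminorm.finset_sup_le_sum _ s) φ).trans_eq ?_
  rw [sum_apply]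
  rfl

theorem PolyBounded.exists_sum_le {W : Y → ℝ} (hW : ∀ y, 1 ≤ W y) {Φ : Y → 𝓢(E, ℂ)}
    (h : PolyBounded W Φ) (s : Finset (ℕ × ℕ)) :
    ∃ C : ℝ, 0 ≤ C ∧ ∃ N : ℕ, ∀ y, ∑ i ∈ s, SchwartzMap.seminorm ℂ i.1 i.2 (Φ y) ≤ C * W y ^ N := by
  choose C hC N hN using h
  refine ⟨∑ i ∈ s, C i.1 i.2, Finset.sum_nonneg fun i _ => hC _ _, ∑ i ∈ s, N i.1 i.2,
    fun y => ?_⟩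
  rw [Finset.sum_mul]
  refine Finset.sum_le_sum fun i hi => (hN _ _ y).trans ?_
  exact mul_le_mul_of_nonneg_left (pow_le_pow_right₀ (hW y)
    (Finset.single_le_sum (f := fun i : ℕ × ℕ => N i.1 i.2) (fun _ _ => Nat.zero_le _) hi)) (hC _ _)

theorem PolyBounded.clm {W : Y → ℝ} (hW : ∀ y, 1 ≤ W y) {Φ : Y → 𝓢(E, ℂ)} (h : PolyBounded W Φ)
    (T : 𝓢(E, ℂ) →L[ℂ] 𝓢(E, ℂ)) : PolyBounded W fun y => T (Φ y) := by
  intro k l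
  obtain ⟨s, C, hC, hT⟩ := exists_seminorm_clm_le T k l
  obtain ⟨C', hC', N, hN⟩ := h.exists_sum_le hW s
  refine ⟨C * C', by positivity, N, fun y => (hT _).trans ?_⟩
  rw [mul_assoc]
  exact mul_le_mul_of_nonneg_left (hN y) hC

theorem PolyBounded.translate {W : Y → ℝ} (hW : ∀ y, 1 ≤ W y) {Φ : Y → 𝓢(E, ℂ)}
    (h : PolyBounded W Φ) {t : Y → E} (ht : ∀ y, ‖t y‖ ≤ W y) :
    PolyBounded W fun y => (Φ y).compSubConstCLM ℂ (t y) := by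
  intro k l
  obtain ⟨C, hC, N, hN⟩ := h k l
  obtain ⟨C', hC', N', hN'⟩ := h 0 l
  refine ⟨2 ^ k * (C + C'), by positivity, N + k + N', fun y =>
    (seminorm_translate_le k l _ _).trans ?_⟩
  have hW0 : 0 ≤ W y := zero_le_one.trans (hW y)
  rw [mul_assoc, add_mul]
  gcongr ?_ * (?_ + ?_)
  · exact (hN y).trans (mul_le_mul_of_nonneg_left
      (pow_le_pow_right₀ (hW y) (by omega)) hC)
  · calc ‖t y‖ ^ k * SchwartzMap.seminorm ℂ 0 l (Φ y) ≤ W y ^ k * (C' * W y ^ N') := by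
          gcongr
          · exact ht y
          · exact hN' y
      _ = C' * W y ^ (k + N') := by ring
      _ ≤ _ := mul_le_mul_of_nonneg_left (pow_le_pow_right₀ (hW y) (by omega)) hC'

end Families

/-! ### Time-frequency shifts -/

theorem norm_conjChar (ξ y : 𝔼) : ‖conjChar ξ y‖ = 1 := by
  rw [conjChar, Complex.norm_exp_ofReal_mul_I]

theorem conjChar_add (ξ η y : 𝔼) : conjChar (ξ + η) y = conjChar ξ y * conjChar η y := by
  rw [conjChar, conjChar, conjChar, ← Complex.exp_add, inner_add_left]
  congr 1
  push_cast
  ring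

theorem conjChar_add_right (ξ y z : 𝔼) : conjChar ξ (y + z) = conjChar ξ y * conjChar ξ z := by
  rw [conjChar, conjChar, conjChar, ← Complex.exp_add, inner_add_right]
  congr 1
  push_cast
  ring

theorem conjChar_comm (ξ y : 𝔼) : conjChar ξ y = conjChar y ξ := by
  rw [conjChar, conjChar, real_inner_comm]

@[simp]
theorem conjChar_zero_left (y : 𝔼) : conjChar 0 y = 1 := by simp [conjChar]

theorem continuous_conjChar : Continuous fun z : 𝔼 × 𝔼 => conjChar z.1 z.2 := by
  unfold conjChar
  fun_prop

theorem fourier_eq_conjChar (h : 𝔼 → ℂ) (ω : 𝔼) : 𝓕 h ω = ∫ y, conjChar ω y * h y := by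
  rw [Real.fourier_eq']
  refine integral_congr_ae (.of_forall fun y => ?_)
  simp only [smul_eq_mul, conjChar]
  rw [real_inner_comm]

theorem fourierInv_eq_conjChar (h : 𝔼 → ℂ) (ω : 𝔼) :
    𝓕⁻ h ω = ∫ y, conjChar (-ω) y * h y := by
  rw [Real.fourierInv_eq_fourier_neg, fourier_eq_conjChar]

theorem fourier_shiftedWindow_eq (g : 𝓢(𝔼, ℂ)) (x ξ ω : 𝔼) :
    𝓕 (shiftedWindow g x ξ) ω = 𝓕 (g.compSubConstCLM ℂ x) (ω + ξ) := by
  rw [SchwartzMap.fourier_coe, SchwartzMap.fourier_coe, fourier_eq_conjChar, fourier_eq_conjChar]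
  refine integral_congr_ae (.of_forall fun y => ?_)
  simp only [shiftedWindow_apply, conjChar_add, SchwartzMap.compSubConstCLM_apply]
  ring

theorem fourier_translate (g : 𝓢(𝔼, ℂ)) (x ω : 𝔼) :
    𝓕 (g.compSubConstCLM ℂ x) ω = conjChar ω x * 𝓕 g ω := by
  rw [SchwartzMap.fourier_coe, SchwartzMap.fourier_coe, fourier_eq_conjChar, fourier_eq_conjChar,
    ← integral_const_mul, ← integral_add_right_eq_self _ x]
  refine integral_congr_ae (.of_forall fun y => ?_)
  simp only [SchwartzMap.compSubConstCLM_apply, conjChar_add_right, add_sub_cancel_right]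
  ring

theorem fourier_shiftedWindow (g : 𝓢(𝔼, ℂ)) (x ξ ω : 𝔼) :
    𝓕 (shiftedWindow g x ξ) ω = conjChar (ω + ξ) x * 𝓕 g (ω + ξ) := by
  rw [fourier_shiftedWindow_eq, fourier_translate]

/-- A modulation is a translation conjugated with the Fourier transform. -/
theorem shiftedWindow_eq_fourierInv (g : 𝓢(𝔼, ℂ)) (x ξ : 𝔼) :
    shiftedWindow g x ξ =
      FourierTransform.fourierInvCLM ℂ 𝓢(𝔼, ℂ) ((FourierTransform.fourierCLM ℂ 𝓢(𝔼, ℂ)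
        (g.compSubConstCLM ℂ x)).compSubConstCLM ℂ (-ξ)) := by
  have : 𝓕 (shiftedWindow g x ξ) = (𝓕 (g.compSubConstCLM ℂ x)).compSubConstCLM ℂ (-ξ) := by
    ext ω
    rw [fourier_shiftedWindow_eq, SchwartzMap.compSubConstCLM_apply, sub_neg_eq_add]
  change _ = 𝓕⁻ ((𝓕 (g.compSubConstCLM ℂ x)).compSubConstCLM ℂ (-ξ))
  rw [← this, FourierTransform.fourierInv_fourier_eq]

theorem continuous_shiftedWindow (g : 𝓢(𝔼, ℂ)) :
    Continuous fun z : 𝔼 × 𝔼 => shiftedWindow g z.1 z.2 := by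
  simp_rw [shiftedWindow_eq_fourierInv]
  refine (FourierTransform.fourierInvCLM ℂ 𝓢(𝔼, ℂ)).continuous.comp ?_
  refine continuous_translate.comp (continuous_snd.neg.prodMk ?_)
  refine (FourierTransform.fourierCLM ℂ 𝓢(𝔼, ℂ)).continuous.comp ?_
  exact continuous_translate.comp (continuous_fst.prodMk continuous_const)

/-- The weight `(1 + ‖x‖) (1 + ‖ξ‖)` on phase space. -/
def phaseWeight (z : 𝔼 × 𝔼) : ℝ := (1 + ‖z.1‖) * (1 + ‖z.2‖)

theorem one_le_phaseWeight (z : 𝔼 × 𝔼) : 1 ≤ phaseWeight z := by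
  unfold phaseWeight
  nlinarith [norm_nonneg z.1, norm_nonneg z.2, mul_nonneg (norm_nonneg z.1) (norm_nonneg z.2)]

theorem norm_le_phaseWeight (z : 𝔼 × 𝔼) : ‖z.1‖ ≤ phaseWeight z ∧ ‖z.2‖ ≤ phaseWeight z := by
  unfold phaseWeight
  constructor <;>
  nlinarith [norm_nonneg z.1, norm_nonneg z.2, mul_nonneg (norm_nonneg z.1) (norm_nonneg z.2)]

/-- The time-frequency shifts of a window grow polynomially, since translations and the continuous
linear maps `𝓕` and `𝓕⁻` preserve polynomial growth. -/
theorem polyBounded_shiftedWindow (g : 𝓢(𝔼, ℂ)) :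
    PolyBounded phaseWeight fun z : 𝔼 × 𝔼 => shiftedWindow g z.1 z.2 := by
  have h1 : PolyBounded phaseWeight fun z : 𝔼 × 𝔼 => g.compSubConstCLM ℂ z.1 :=
    (polyBounded_const g).translate one_le_phaseWeight fun z => (norm_le_phaseWeight z).1
  have h2 := h1.clm one_le_phaseWeight (FourierTransform.fourierCLM ℂ 𝓢(𝔼, ℂ))
  have h3 := h2.translate one_le_phaseWeight (t := fun z => -z.2) fun z =>
    (norm_neg z.2).trans_le (norm_le_phaseWeight z).2
  have h4 := h3.clm one_le_phaseWeight (FourierTransform.fourierInvCLM ℂ 𝓢(𝔼, ℂ))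
  beta_reduce at h4
  simp_rw [shiftedWindow_eq_fourierInv]
  exact h4

theorem continuous_stft (g : 𝓢(𝔼, ℂ)) (f : 𝓢'(𝔼, ℂ)) :
    Continuous fun z : 𝔼 × 𝔼 => stft g f z.1 z.2 :=
  f.continuous.comp (continuous_shiftedWindow g)

theorem continuous_stft_left (g : 𝓢(𝔼, ℂ)) (f : 𝓢'(𝔼, ℂ)) (ξ : 𝔼) :
    Continuous fun x => stft g f x ξ :=
  (continuous_stft g f).comp (f := fun x : 𝔼 => (x, ξ)) (continuous_id.prodMk continuous_const)

theorem exists_seminorm_shiftedWindow_le (g : 𝓢(𝔼, ℂ)) (k l : ℕ) :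
    ∃ C : ℝ, 0 ≤ C ∧ ∃ N : ℕ, ∀ x ξ, SchwartzMap.seminorm ℂ k l (shiftedWindow g x ξ) ≤
      C * ((1 + ‖x‖) * (1 + ‖ξ‖)) ^ N := by
  obtain ⟨C, hC, N, hN⟩ := polyBounded_shiftedWindow g k l
  refine ⟨C, hC, N, fun x ξ => ?_⟩
  have h := hN (x, ξ)
  simp only [phaseWeight] at h
  exact h

theorem exists_norm_stft_le (g : 𝓢(𝔼, ℂ)) (f : 𝓢'(𝔼, ℂ)) :
    ∃ C : ℝ, 0 ≤ C ∧ ∃ N : ℕ, ∀ x ξ, ‖stft g f x ξ‖ ≤ C * ((1 + ‖x‖) * (1 + ‖ξ‖)) ^ N := by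
  obtain ⟨s, C, hC, hf⟩ := exists_seminorm_bound f
  obtain ⟨C', hC', N, hN⟩ := (polyBounded_shiftedWindow g).exists_sum_le one_le_phaseWeight s
  refine ⟨C * C', by positivity, N, fun x ξ => ?_⟩
  have h1 := hN (x, ξ)
  simp only [phaseWeight] at h1
  rw [mul_assoc]
  exact (hf (shiftedWindow g x ξ)).trans (mul_le_mul_of_nonneg_left h1 hC)

/-- The product of a rapidly decaying function with a power of the norm is integrable. -/
theorem integrable_one_add_norm_pow_mul (a : 𝓢(𝔼, ℂ)) (N : ℕ) :
    Integrable fun t => (1 + ‖t‖) ^ N * ‖a t‖ := by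
  have h : (fun t => (1 + ‖t‖) ^ N * ‖a t‖) = fun t =>
      ∑ m ∈ Finset.range (N + 1), (N.choose m : ℝ) * (‖t‖ ^ m * ‖a t‖) := by
    ext t
    rw [add_comm, add_pow, Finset.sum_mul]
    refine Finset.sum_congr rfl fun m _ => ?_
    simp only [one_pow]
    ring
  rw [h]
  exact integrable_finsetSum _ fun m _ => (a.integrable_pow_mul volume m).const_mul _

/-- Pairing `f` with a modulated convolution amounts to integrating its short-time Fourier
transform. -/
theorem apply_shiftedWindow_convolution (f : 𝓢'(𝔼, ℂ)) (a χ c : 𝓢(𝔼, ℂ))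
    (hc : ∀ z, c z = ∫ t, a t * χ (z - t)) (η : 𝔼) :
    f (shiftedWindow c 0 η) = ∫ t, a t * stft χ f t η := by
  have hcont' : Continuous fun t : 𝔼 => shiftedWindow χ t η :=
    (continuous_shiftedWindow χ).comp (f := fun t : 𝔼 => (t, η))
      (continuous_id.prodMk continuous_const)
  have hcont : Continuous fun t : 𝔼 => a t • shiftedWindow χ t η :=
    Continuous.smul (f := fun t => a t) a.continuous hcont'
  have key := apply_eq_integral (μ := (volume : Measure 𝔼)) f hcont
    (Ψ := shiftedWindow c 0 η) (fun k l => ?_) (fun z => ?_)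
  · rw [key]
    refine integral_congr_ae (.of_forall fun t => ?_)
    simp only [map_smul, smul_eq_mul]
    rfl
  · obtain ⟨C, hC, N, hN⟩ := exists_seminorm_shiftedWindow_le χ k l
    refine ((integrable_one_add_norm_pow_mul a N).const_mul (C * (1 + ‖η‖) ^ N)).mono'
      ((continuous_seminorm k l).comp hcont).aestronglyMeasurable
      (.of_forall fun t => ?_)
    rw [Real.norm_of_nonneg (apply_nonneg _ _), map_smul_eq_mul]
    calc ‖a t‖ * SchwartzMap.seminorm ℂ k l (shiftedWindow χ t η)
        ≤ ‖a t‖ * (C * ((1 + ‖t‖) * (1 + ‖η‖)) ^ N) := by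
          exact mul_le_mul_of_nonneg_left (hN t η) (norm_nonneg _)
      _ = _ := by rw [mul_pow]; ring
  · rw [shiftedWindow_apply, sub_zero, hc, ← integral_const_mul]
    refine integral_congr_ae (.of_forall fun t => ?_)
    simp only [smul_apply, smul_eq_mul, shiftedWindow_apply]
    ring

/-! ### The Hausdorff–Young inequality -/

section HausdorffYoung

variable {V : Type*} [NormedAddCommGroup V] [InnerProductSpace ℝ V] [FiniteDimensional ℝ V]
  [MeasurableSpace V] [BorelSpace V]

theorem continuous_fourier {h : V → ℂ} (hi : Integrable h) : Continuous (𝓕 h) :=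
  VectorFourier.fourierIntegral_continuous Real.continuous_fourierChar
    (by exact continuous_inner) hi

theorem enorm_fourier_le (h : V → ℂ) (ω : V) : ‖𝓕 h ω‖ₑ ≤ ∫⁻ v, ‖h v‖ₑ := by
  rw [Real.fourier_eq']
  refine (enorm_integral_le_lintegral_enorm _).trans_eq (lintegral_congr fun v => ?_)
  rw [← ofReal_norm, ← ofReal_norm, norm_smul, Complex.norm_exp_ofReal_mul_I, one_mul]

/-- The Fourier integral of a function in `L¹ ∩ L²` is its `L²` Fourier transform. -/
theorem fourier_toLp_ae_eq {h : V → ℂ} (h1 : Integrable h) (h2 : MemLp h 2) :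
    ((𝓕 (h2.toLp h) : Lp ℂ 2 (volume : Measure V)) : V → ℂ) =ᵐ[volume] 𝓕 h := by
  refine ae_eq_of_integral_contDiff_smul_eq ((Lp.memLp _).locallyIntegrable (by norm_num))
    (continuous_fourier h1).locallyIntegrable fun φ hφ hφc => ?_
  have hg₁ : HasCompactSupport (Complex.ofRealCLM ∘ φ) := hφc.comp_left rfl
  have hg₂ : ContDiff ℝ ((⊤ : ℕ∞) : WithTop ℕ∞) (Complex.ofRealCLM ∘ φ) := by fun_prop
  let ψ : 𝓢(V, ℂ) := hg₁.toSchwartzMap hg₂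
  have hψ : ∀ x, ψ x = (φ x : ℂ) := fun x => rfl
  have key := congrArg (fun T : 𝓢'(V, ℂ) => T ψ)
    (Lp.fourier_toTemperedDistribution_eq (h2.toLp h))
  simp only [Lp.toTemperedDistribution_apply, TemperedDistribution.fourier_apply] at key
  have e1 : ∫ x, φ x • (𝓕 (h2.toLp h) : Lp ℂ 2 (volume : Measure V)) x =
      ∫ x, ψ x • (𝓕 (h2.toLp h) : Lp ℂ 2 (volume : Measure V)) x := by
    refine integral_congr_ae (.of_forall fun x => ?_)
    simp only [hψ, smul_eq_mul, Complex.real_smul]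
  have e2 : ∫ x, φ x • 𝓕 h x = ∫ x, 𝓕 h x • ψ x := by
    refine integral_congr_ae (.of_forall fun x => ?_)
    simp only [hψ, smul_eq_mul, Complex.real_smul, mul_comm]
  rw [e1, ← key, e2]
  have e3 := VectorFourier.integral_fourierIntegral_smul_eq_flip (μ := (volume : Measure V))
    (ν := (volume : Measure V)) (L := innerₗ V) Real.continuous_fourierChar
    (by exact continuous_inner) h1 ψ.integrable
  rw [flip_innerₗ] at e3
  refine Eq.trans ?_ e3.symm
  refine integral_congr_ae ?_
  filter_upwards [h2.coeFn_toLp] with x hx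
  rw [hx, smul_eq_mul, smul_eq_mul, mul_comm]
  rfl

theorem lintegral_fourier_sq_le {h : V → ℂ} (h1 : Integrable h) :
    ∫⁻ ω, ‖𝓕 h ω‖ₑ ^ (2 : ℝ) ≤ ∫⁻ v, ‖h v‖ₑ ^ (2 : ℝ) := by
  by_cases hf : ∫⁻ v, ‖h v‖ₑ ^ (2 : ℝ) = ∞
  · rw [hf]; exact le_top
  have h2 : MemLp h 2 := by
    refine ⟨h1.aestronglyMeasurable, ?_⟩
    rw [eLpNorm_lt_top_iff_lintegral_rpow_enorm_lt_top (by norm_num) (by norm_num)]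
    simpa using lt_top_iff_ne_top.2 hf
  have e0 : ∀ k : V → ℂ, ∫⁻ v, ‖k v‖ₑ ^ (2 : ℝ) = eLpNorm k 2 volume ^ (2 : ℝ) := fun k => by
    rw [eLpNorm_eq_lintegral_rpow_enorm_toReal (by norm_num) (by norm_num), ← ENNReal.rpow_mul]
    norm_num
  rw [e0, e0, ← eLpNorm_congr_ae (fourier_toLp_ae_eq h1 h2), ← eLpNorm_congr_ae h2.coeFn_toLp,
    ← Lp.enorm_def, ← Lp.enorm_def]
  have := Lp.norm_fourier_eq (h2.toLp h)
  rw [← ofReal_norm, ← ofReal_norm, this]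

/-- Chebyshev's inequality for the `L²` bound of the Fourier transform. -/
theorem measure_fourier_le {h : V → ℂ} (h1 : Integrable h) {τ : ℝ} (hτ : 0 < τ) :
    volume {ω | τ < ‖𝓕 h ω‖} ≤
      ENNReal.ofReal (τ ^ (-2 : ℝ)) * ∫⁻ v, ‖h v‖ₑ ^ (2 : ℝ) := by
  have hτ' : ENNReal.ofReal (τ ^ (2 : ℝ)) ≠ 0 := by
    rw [Ne, ENNReal.ofReal_eq_zero, not_le]
    exact Real.rpow_pos_of_pos hτ 2
  have h3 := mul_meas_ge_le_lintegral₀ (μ := (volume : Measure V))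
    ((continuous_fourier h1).measurable.enorm.pow_const (2 : ℝ)).aemeasurable
    (ENNReal.ofReal (τ ^ (2 : ℝ)))
  have h4 : {ω | τ < ‖𝓕 h ω‖} ⊆ {ω | ENNReal.ofReal (τ ^ (2 : ℝ)) ≤ ‖𝓕 h ω‖ₑ ^ (2 : ℝ)} := by
    intro ω hω
    rw [Set.mem_ofPred_eq] at hω ⊢
    rw [← ENNReal.ofReal_rpow_of_pos hτ, ← ofReal_norm]
    exact ENNReal.rpow_le_rpow (ENNReal.ofReal_le_ofReal hω.le) (by norm_num)
  rw [Real.rpow_neg hτ.le, ENNReal.ofReal_inv_of_pos (Real.rpow_pos_of_pos hτ _), mul_comm,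
    ← div_eq_mul_inv, ENNReal.le_div_iff_mul_le (.inl hτ') (.inl ENNReal.ofReal_ne_top), mul_comm]
  exact ((mul_le_mul_right (measure_mono h4) _).trans h3).trans (lintegral_fourier_sq_le h1)

/-- Cutting `h` at height `A`, where `A ^ (1 - s) ‖h‖_s ^ s = τ`, bounds the distribution function
of `𝓕 h` at `2 τ` by the `L²` norm of the part of `h` below `A`. -/
theorem measure_two_mul_lt_fourier_le {h : V → ℂ} (hm : Measurable h) (h1 : Integrable h) {s m : ℝ}
    (hs : 1 < s) (hm0 : 0 < m) (hms : ∫⁻ v, ‖h v‖ₑ ^ s = ENNReal.ofReal m) {τ : ℝ} (hτ : 0 < τ) :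
    volume {ω | τ < ‖𝓕 h ω‖ / 2} ≤ ENNReal.ofReal (τ ^ (-2 : ℝ)) *
      ∫⁻ v in {v | ‖h v‖ ≤ (m / τ) ^ (1 / (s - 1))}, ‖h v‖ₑ ^ (2 : ℝ) := by
  set A : ℝ := (m / τ) ^ (1 / (s - 1)) with hA
  have hA0 : 0 < A := by positivity
  have hAτ : A ^ (1 - s) * m = τ := by
    rw [hA, ← Real.rpow_mul (by positivity),
      show 1 / (s - 1) * (1 - s) = -1 by have : s - 1 ≠ 0 := by linarith
                                         field_simp; ring, Real.rpow_neg_one]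
    field_simp
  set S : Set V := {v | ‖h v‖ ≤ A}
  have hS : MeasurableSet S := measurableSet_le hm.norm measurable_const
  have hs1 : Integrable (S.indicator h) := h1.indicator hS
  have hs2 : Integrable (Sᶜ.indicator h) := h1.indicator hS.compl
  have hsum : ∀ ω, 𝓕 h ω = 𝓕 (S.indicator h) ω + 𝓕 (Sᶜ.indicator h) ω := fun ω => by
    have e : h = S.indicator h + Sᶜ.indicator h := (S.indicator_self_add_compl h).symm
    conv_lhs => rw [e]
    have := VectorFourier.fourierIntegral_add (L := innerₗ V) (μ := (volume : Measure V))
      Real.continuous_fourierChar (by exact continuous_inner) hs1 hs2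
    have e2 : ∀ k : V → ℂ, 𝓕 k =
      VectorFourier.fourierIntegral Real.fourierChar volume (innerₗ V) k := fun k => rfl
    rw [e2, e2, e2]
    exact congrFun this ω
  -- `|h| ≤ A ^ (1 - s) |h| ^ s` above the height `A`
  have hbig : ∀ ω, ‖𝓕 (Sᶜ.indicator h) ω‖ ≤ τ := fun ω => by
    have h5 : ‖𝓕 (Sᶜ.indicator h) ω‖ₑ ≤ ENNReal.ofReal τ := by
      refine (enorm_fourier_le _ ω).trans ?_
      rw [← hAτ, ENNReal.ofReal_mul (by positivity), ← hms, ← lintegral_const_mul _ (by fun_prop)]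
      refine lintegral_mono fun v => ?_
      by_cases hv : v ∈ S
      · simp [Set.indicator_of_notMem (show v ∉ Sᶜ from fun h => h hv)]
      rw [Set.indicator_of_mem (show v ∈ Sᶜ from hv)]
      have hv' : A < ‖h v‖ := not_le.1 hv
      have hv0 : 0 < ‖h v‖ := hA0.trans hv'
      rw [← ofReal_norm, ENNReal.ofReal_rpow_of_pos hv0, ← ENNReal.ofReal_mul (by positivity)]
      refine ENNReal.ofReal_le_ofReal ?_
      have h6 : ‖h v‖ ^ (1 - s) ≤ A ^ (1 - s) :=
        Real.rpow_le_rpow_of_nonpos hA0 hv'.le (by linarith)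
      calc ‖h v‖ = ‖h v‖ ^ (1 - s) * ‖h v‖ ^ s := by
            rw [← Real.rpow_add hv0]; simp
        _ ≤ _ := by gcongr
    rwa [← ofReal_norm, ENNReal.ofReal_le_ofReal_iff hτ.le] at h5
  have hsub : {ω | τ < ‖𝓕 h ω‖ / 2} ⊆ {ω | τ < ‖𝓕 (S.indicator h) ω‖} := by
    intro ω hω
    rw [Set.mem_ofPred_eq] at hω ⊢
    have := norm_add_le (𝓕 (S.indicator h) ω) (𝓕 (Sᶜ.indicator h) ω)
    rw [← hsum] at this
    linarith [hbig ω]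
  refine (measure_mono hsub).trans ((measure_fourier_le hs1 hτ).trans_eq ?_)
  rw [← lintegral_indicator hS]
  congr 1
  refine lintegral_congr fun v => ?_
  by_cases hv : v ∈ S <;> simp [hv]

theorem lintegral_Ioc_rpow {e T : ℝ} (he : -1 < e) (hT : 0 ≤ T) :
    ∫⁻ τ in Set.Ioc 0 T, ENNReal.ofReal (τ ^ e) = ENNReal.ofReal (T ^ (e + 1) / (e + 1)) := by
  have hi : IntervalIntegrable (fun τ : ℝ => τ ^ e) volume 0 T :=
    intervalIntegral.intervalIntegrable_rpow' he
  rw [intervalIntegrable_iff_integrableOn_Ioc_of_le hT] at hi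
  rw [← ofReal_integral_eq_lintegral_ofReal hi, ← intervalIntegral.integral_of_le hT,
    integral_rpow (.inl he), Real.zero_rpow (by linarith), sub_zero]
  exact (ae_restrict_iff' measurableSet_Ioc).2 (.of_forall fun τ hτ => Real.rpow_nonneg hτ.1.le _)

/-- The Hausdorff–Young inequality for `1 < s < 2`, up to a constant, by real interpolation between
`L¹ → L^∞` and `L² → L²`. -/
theorem lintegral_fourier_rpow_le {h : V → ℂ} (hm : Measurable h) (h1 : Integrable h) {s r m : ℝ}
    (hs : 1 < s) (hs2 : s < 2) (hr : r = s / (s - 1)) (hm0 : 0 < m)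
    (hms : ∫⁻ v, ‖h v‖ₑ ^ s = ENNReal.ofReal m) :
    ∫⁻ ω, ‖𝓕 h ω‖ₑ ^ r ≤ ENNReal.ofReal (2 ^ r * (r / (r - 2)) * m ^ (r - 1)) := by
  have hs1 : 0 < s - 1 := by linarith
  have hr2 : 2 < r := by rw [hr, lt_div_iff₀ hs1]; linarith
  have hr0 : 0 < r := by linarith
  have hrs : (s - 1) * (r - 2) = 2 - s := by rw [hr]; field_simp; ring
  -- the factor `2` makes room for the splitting of `h` in `measure_two_mul_lt_fourier_le`
  have htwo : ∫⁻ ω, ‖𝓕 h ω‖ₑ ^ r =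
      ENNReal.ofReal (2 ^ r) * ∫⁻ ω, ENNReal.ofReal ((‖𝓕 h ω‖ / 2) ^ r) := by
    rw [← lintegral_const_mul' _ _ ENNReal.ofReal_ne_top]
    refine lintegral_congr fun ω => ?_
    rw [← ENNReal.ofReal_mul (by positivity), ← ofReal_norm,
      ENNReal.ofReal_rpow_of_nonneg (norm_nonneg _) hr0.le,
      ← Real.mul_rpow (by norm_num) (by positivity)]
    congr 2
    ring
  have hlayer : ∫⁻ ω, ENNReal.ofReal ((‖𝓕 h ω‖ / 2) ^ r) = ENNReal.ofReal r *
      ∫⁻ τ in Set.Ioi (0 : ℝ), volume {ω | τ < ‖𝓕 h ω‖ / 2} * ENNReal.ofReal (τ ^ (r - 1)) :=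
    lintegral_rpow_eq_lintegral_meas_lt_mul _ (.of_forall fun ω => by positivity)
      ((continuous_fourier h1).norm.div_const 2).aemeasurable hr0
  -- `K τ v` is the contribution of `h v` to the bound of the distribution function at height `τ`
  let D : Set (ℝ × V) := {z | ‖h z.2‖ ≤ (m / z.1) ^ (1 / (s - 1))}
  have hD : MeasurableSet D :=
    measurableSet_le (hm.comp measurable_snd).norm
      ((measurable_const.div measurable_fst).pow_const _)
  let K : ℝ → V → ℝ≥0∞ := fun τ v => D.indicator
    (fun z => ENNReal.ofReal (z.1 ^ (r - 3)) * ‖h z.2‖ₑ ^ (2 : ℝ)) (τ, v)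
  have hK : Measurable (Function.uncurry K) := by
    refine Measurable.indicator ?_ hD
    exact (measurable_fst.pow_const _).ennreal_ofReal.mul
      ((hm.comp measurable_snd).enorm.pow_const _)
  have hdistr : ∫⁻ τ in Set.Ioi (0 : ℝ), volume {ω | τ < ‖𝓕 h ω‖ / 2} * ENNReal.ofReal (τ ^ (r - 1))
      ≤ ∫⁻ τ in Set.Ioi (0 : ℝ), ∫⁻ v, K τ v := by
    refine setLIntegral_mono_ae' measurableSet_Ioi (.of_forall fun τ hτ => ?_)
    have hτ0 : 0 < τ := hτ
    have hSm : MeasurableSet {v | ‖h v‖ ≤ (m / τ) ^ (1 / (s - 1))} :=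
      measurableSet_le hm.norm measurable_const
    calc volume {ω | τ < ‖𝓕 h ω‖ / 2} * ENNReal.ofReal (τ ^ (r - 1))
        ≤ (ENNReal.ofReal (τ ^ (-2 : ℝ)) * ∫⁻ v in {v | ‖h v‖ ≤ (m / τ) ^ (1 / (s - 1))},
            ‖h v‖ₑ ^ (2 : ℝ)) * ENNReal.ofReal (τ ^ (r - 1)) := by
          gcongr
          exact measure_two_mul_lt_fourier_le hm h1 hs hm0 hms hτ0
      _ = ENNReal.ofReal (τ ^ (r - 3)) * ∫⁻ v in {v | ‖h v‖ ≤ (m / τ) ^ (1 / (s - 1))},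
            ‖h v‖ₑ ^ (2 : ℝ) := by
          rw [mul_right_comm, ← ENNReal.ofReal_mul (by positivity), ← Real.rpow_add hτ0]
          congr 3
          ring
      _ = ∫⁻ v, K τ v := by
          rw [← lintegral_const_mul _ (hm.enorm.pow_const _), ← lintegral_indicator hSm]
          rfl
  have hswap : ∫⁻ τ in Set.Ioi (0 : ℝ), ∫⁻ v, K τ v = ∫⁻ v, ∫⁻ τ in Set.Ioi (0 : ℝ), K τ v :=
    lintegral_lintegral_swap hK.aemeasurable
  -- only `τ ≤ m |h v| ^ (1 - s)` contribute, and `(s - 1) (r - 2) = 2 - s` yields the power `s`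
  have hheight : ∀ v, ∫⁻ τ in Set.Ioi (0 : ℝ), K τ v ≤
      ENNReal.ofReal (m ^ (r - 2) / (r - 2)) * ‖h v‖ₑ ^ s := by
    intro v
    rcases (norm_nonneg (h v)).eq_or_lt with h0 | h0
    · have hz : ∀ τ, K τ v = 0 := fun τ => by
        have : h v = 0 := norm_eq_zero.1 h0.symm
        simp [K, Set.indicator_apply, this]
      simp [hz]
    set a := ‖h v‖ with ha
    set T : ℝ := m * a ^ (-(s - 1)) with hT
    have hT0 : 0 < T := by positivity
    have hle : ∫⁻ τ in Set.Ioi (0 : ℝ), K τ v ≤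
        ∫⁻ τ in Set.Ioc (0 : ℝ) T, ENNReal.ofReal (τ ^ (r - 3)) * ENNReal.ofReal (a ^ (2 : ℝ)) := by
      rw [← lintegral_indicator measurableSet_Ioi, ← lintegral_indicator measurableSet_Ioc]
      refine lintegral_mono fun τ => ?_
      by_cases hτ : τ ∈ Set.Ioi (0 : ℝ)
      swap
      · simp [Set.indicator_of_notMem hτ]
      rw [Set.indicator_of_mem hτ]
      by_cases hD' : (τ, v) ∈ D
      swap
      · simp [K, Set.indicator_of_notMem hD']
      have hτ0 : (0 : ℝ) < τ := hτ
      have hτT : τ ∈ Set.Ioc (0 : ℝ) T := by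
        refine ⟨hτ, ?_⟩
        have h5 : a ≤ (m / τ) ^ (1 / (s - 1)) := hD'
        have h6 : a ^ (s - 1) ≤ m / τ := by
          have := Real.rpow_le_rpow h0.le h5 hs1.le
          rwa [← Real.rpow_mul (by positivity), one_div_mul_cancel hs1.ne', Real.rpow_one] at this
        rw [hT, Real.rpow_neg h0.le]
        rw [le_div_iff₀ hτ0] at h6
        rw [← div_eq_mul_inv, le_div_iff₀ (by positivity)]
        linarith
      rw [Set.indicator_of_mem hτT]
      simp only [K, Set.indicator_of_mem hD']
      rw [← ENNReal.ofReal_rpow_of_pos h0, ha, ofReal_norm]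
    refine hle.trans ?_
    rw [lintegral_mul_const' _ _ ENNReal.ofReal_ne_top,
      lintegral_Ioc_rpow (by linarith) hT0.le, ← ofReal_norm, ← ha,
      ENNReal.ofReal_rpow_of_pos h0, ← ENNReal.ofReal_mul (by
        have : 0 < r - 3 + 1 := by linarith
        positivity), ← ENNReal.ofReal_mul (by
        have : 0 < r - 2 := by linarith
        positivity)]
    refine ENNReal.ofReal_le_ofReal (le_of_eq ?_)
    rw [show r - 3 + 1 = r - 2 by ring, hT, Real.mul_rpow hm0.le (by positivity),
      ← Real.rpow_mul h0.le, show -(s - 1) * (r - 2) = s - 2 by rw [neg_mul, hrs]; ring,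
      mul_div_right_comm, mul_assoc, ← Real.rpow_add h0]
    congr 2
    ring
  calc ∫⁻ ω, ‖𝓕 h ω‖ₑ ^ r
      ≤ ENNReal.ofReal (2 ^ r) * (ENNReal.ofReal r *
          ∫⁻ v, ENNReal.ofReal (m ^ (r - 2) / (r - 2)) * ‖h v‖ₑ ^ s) := by
        rw [htwo, hlayer]
        gcongr
        exact hdistr.trans (hswap.trans_le (lintegral_mono hheight))
    _ = _ := by
        have hr3 : 0 < r - 2 := by linarith
        rw [lintegral_const_mul' _ _ ENNReal.ofReal_ne_top, hms,
          ← ENNReal.ofReal_mul (by positivity), ← ENNReal.ofReal_mul (by positivity),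
          ← ENNReal.ofReal_mul (by positivity)]
        congr 1
        rw [show r - 1 = (r - 2) + 1 by ring, Real.rpow_add hm0, Real.rpow_one]
        ring

/-- The Hausdorff–Young inequality `‖𝓕 h‖_r ≤ C ‖h‖_s`, with `1 < s ≤ 2` and `r` the exponent
conjugate to `s`, with a constant that is not optimal. -/
theorem exists_hausdorffYoung {s r : ℝ} (hs : 1 < s) (hs2 : s ≤ 2) (hr : r = s / (s - 1)) :
    ∃ C : ℝ, 0 < C ∧ ∀ h : V → ℂ, Measurable h → Integrable h →
      (∫⁻ ω, ‖𝓕 h ω‖ₑ ^ r) ^ (1 / r) ≤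
        ENNReal.ofReal C * (∫⁻ v, ‖h v‖ₑ ^ s) ^ (1 / s) := by
  have hs1 : 0 < s - 1 := by linarith
  have hs0 : 0 < s := by linarith
  have hr0 : 0 < r := by rw [hr]; positivity
  rcases hs2.eq_or_lt with rfl | hs2
  · have : r = 2 := by rw [hr]; norm_num
    subst this
    refine ⟨1, one_pos, fun h _ h1 => ?_⟩
    rw [ENNReal.ofReal_one, one_mul]
    exact ENNReal.rpow_le_rpow (lintegral_fourier_sq_le h1) (by norm_num)
  have hr2 : 2 < r := by rw [hr, lt_div_iff₀ hs1]; linarith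
  have hr3 : 0 < r - 2 := by linarith
  refine ⟨(2 ^ r * (r / (r - 2))) ^ (1 / r), by positivity, fun h hm h1 => ?_⟩
  by_cases hinf : ∫⁻ v, ‖h v‖ₑ ^ s = ∞
  · rw [hinf, ENNReal.top_rpow_of_pos (by positivity), ENNReal.mul_top]
    · exact le_top
    · rw [Ne, ENNReal.ofReal_eq_zero, not_le]; positivity
  by_cases hzero : ∫⁻ v, ‖h v‖ₑ ^ s = 0
  · rw [lintegral_eq_zero_iff (by fun_prop)] at hzero
    have h0 : h =ᵐ[volume] 0 := by
      filter_upwards [hzero] with v hv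
      simpa [hs0] using hv
    have h00 : ∀ ω, 𝓕 h ω = 0 := fun ω => by
      rw [Real.fourier_congr_ae h0 ω, Real.fourier_eq]
      simp
    simp [h00, hr0]
  have hms : ∫⁻ v, ‖h v‖ₑ ^ s = ENNReal.ofReal (∫⁻ v, ‖h v‖ₑ ^ s).toReal :=
    (ENNReal.ofReal_toReal hinf).symm
  have hm0 := ENNReal.toReal_pos hzero hinf
  set m := (∫⁻ v, ‖h v‖ₑ ^ s).toReal
  rw [hms, ENNReal.ofReal_rpow_of_pos hm0, ← ENNReal.ofReal_mul (by positivity)]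
  refine (ENNReal.rpow_le_rpow (lintegral_fourier_rpow_le hm h1 hs hs2 hr hm0 hms)
    (by positivity)).trans_eq ?_
  rw [ENNReal.ofReal_rpow_of_pos (by positivity), Real.mul_rpow (by positivity) (by positivity),
    ← Real.rpow_mul hm0.le]
  congr 3
  rw [hr]
  field_simp
  ring

end HausdorffYoung

/-! ### Minkowski's and Young's inequalities -/

section Minkowski

variable {X Y : Type*} [MeasurableSpace X] [MeasurableSpace Y] {μ : Measure X} {ν : Measure Y}

/-- Minkowski's integral inequality. -/
theorem lintegral_minkowski [SigmaFinite μ] [SFinite ν] {P : ℝ} (hP : 1 ≤ P) {F : X → Y → ℝ≥0∞}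
    (hF : Measurable (Function.uncurry F)) :
    (∫⁻ x, (∫⁻ y, F x y ∂ν) ^ P ∂μ) ^ (1 / P) ≤ ∫⁻ y, (∫⁻ x, F x y ^ P ∂μ) ^ (1 / P) ∂ν := by
  rcases hP.eq_or_lt with rfl | hP1
  · simp only [div_one, ENNReal.rpow_one]
    exact (lintegral_lintegral_swap hF.aemeasurable).le
  have hP0 : 0 < P := by linarith
  set R := ∫⁻ y, (∫⁻ x, F x y ^ P ∂μ) ^ (1 / P) ∂ν with hR
  let S : X → ℝ≥0∞ := fun x => ∫⁻ y, F x y ∂ν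
  have hS : Measurable S := hF.lintegral_prod_right'
  -- truncations of `S` of finite `L^P` norm, so that a power of it can be cancelled
  let W : ℕ → X → ℝ≥0∞ := fun n => (spanningSets μ n).indicator fun x => min (S x) n
  have hW : ∀ n, Measurable (W n) := fun n =>
    (hS.min measurable_const).indicator (measurableSet_spanningSets μ n)
  have hWS : ∀ n x, W n x ≤ S x := fun n x => by
    refine (Set.indicator_le_self' (fun _ _ => zero_le) x).trans (min_le_left _ _)
  have hWmono : Monotone W := by
    intro n k hnk x
    by_cases hx : x ∈ spanningSets μ n
    · simp only [W, Set.indicator_of_mem hx,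
        Set.indicator_of_mem (monotone_spanningSets μ hnk hx)]
      exact min_le_min_left _ (by exact_mod_cast hnk)
    · simp [W, Set.indicator_of_notMem hx]
  have hWsup : ∀ x, ⨆ n, W n x = S x := fun x => by
    refine le_antisymm (iSup_le fun n => hWS n x) ?_
    obtain ⟨k, hk⟩ := Set.mem_iUnion.1 ((iUnion_spanningSets μ).symm ▸ Set.mem_univ x)
    refine le_of_forall_lt fun c hc => ?_
    obtain ⟨n, hn⟩ := ENNReal.exists_nat_gt (hc.trans_le le_top).ne
    refine lt_of_lt_of_le ?_ (le_iSup (fun n => W n x) (max k n))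
    simp only [W, Set.indicator_of_mem (monotone_spanningSets μ (le_max_left k n) hk)]
    refine lt_min hc (hn.trans_le ?_)
    exact_mod_cast le_max_right k n
  have hbound : ∀ n, ∫⁻ x, W n x ^ P ∂μ ≤ R ^ P := fun n => by
    set I := ∫⁻ x, W n x ^ P ∂μ with hI
    have hIfin : I ≠ ∞ := by
      have : I ≤ ∫⁻ x in spanningSets μ n, (n : ℝ≥0∞) ^ P ∂μ := by
        rw [hI, ← lintegral_indicator (measurableSet_spanningSets μ n)]
        refine lintegral_mono fun x => ?_
        by_cases hx : x ∈ spanningSets μ n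
        · simp only [W, Set.indicator_of_mem hx]
          exact ENNReal.rpow_le_rpow (min_le_right _ _) hP0.le
        · simp [W, Set.indicator_of_notMem hx, hP0]
      refine (this.trans_lt ?_).ne
      rw [setLIntegral_const]
      exact ENNReal.mul_lt_top (ENNReal.rpow_lt_top_of_nonneg hP0.le (ENNReal.natCast_ne_top n))
        (measure_spanningSets_lt_top μ n)
    rcases eq_or_ne I 0 with h0 | h0
    · rw [h0]; exact zero_le
    have hconj : P.HolderConjugate (P / (P - 1)) := Real.HolderConjugate.conjExponent hP1
    have h1 : I ≤ R * I ^ (1 - 1 / P) := by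
      calc I = ∫⁻ x, W n x * W n x ^ (P - 1) ∂μ := by
            refine lintegral_congr fun x => ?_
            conv_lhs => rw [show P = 1 + (P - 1) by ring,
              ENNReal.rpow_add_of_nonneg _ _ zero_le_one (by linarith), ENNReal.rpow_one]
        _ ≤ ∫⁻ x, ∫⁻ y, F x y * W n x ^ (P - 1) ∂ν ∂μ := by
            refine lintegral_mono fun x => ?_
            rw [lintegral_mul_const _ (by fun_prop)]
            gcongr
            exact hWS n x
        _ = ∫⁻ y, ∫⁻ x, F x y * W n x ^ (P - 1) ∂μ ∂ν := by
            refine lintegral_lintegral_swap (Measurable.aemeasurable ?_)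
            exact hF.mul (((hW n).comp measurable_fst).pow_const _)
        _ ≤ ∫⁻ y, (∫⁻ x, F x y ^ P ∂μ) ^ (1 / P) * I ^ (1 - 1 / P) ∂ν := by
            refine lintegral_mono fun y => ?_
            have := ENNReal.lintegral_mul_le_Lp_mul_Lq μ hconj (f := fun x => F x y)
              (g := fun x => W n x ^ (P - 1)) (by fun_prop) ((hW n).pow_const _).aemeasurable
            refine this.trans_eq ?_
            congr 1
            have hP1' : P - 1 ≠ 0 := by linarith
            rw [hI]
            congr 1
            · refine lintegral_congr fun x => ?_
              rw [← ENNReal.rpow_mul]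
              congr 1
              field_simp
            · field_simp
        _ = R * I ^ (1 - 1 / P) := by
            rw [lintegral_mul_const' _ _ (ENNReal.rpow_ne_top_of_nonneg (by
              rw [sub_nonneg, div_le_one hP0]; exact hP) hIfin)]
    have h2 : I ^ (1 / P) ≤ R := by
      have h3 : I = I ^ (1 / P) * I ^ (1 - 1 / P) := by
        rw [← ENNReal.rpow_add _ _ h0 hIfin]; simp
      rw [h3] at h1
      have h1' : I ^ (1 / P) * I ^ (1 - 1 / P) ≤ R * I ^ (1 - 1 / P) := by
        rwa [← h3] at h1 ⊢
      refine (ENNReal.mul_le_mul_iff_left ?_ ?_).1 h1'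
      · exact (ENNReal.rpow_pos (pos_iff_ne_zero.2 h0) hIfin).ne'
      · exact ENNReal.rpow_ne_top_of_nonneg (by rw [sub_nonneg, div_le_one hP0]; exact hP) hIfin
    calc I = (I ^ (1 / P)) ^ P := by
          rw [← ENNReal.rpow_mul, one_div_mul_cancel hP0.ne', ENNReal.rpow_one]
      _ ≤ R ^ P := ENNReal.rpow_le_rpow h2 hP0.le
  have hfin : ∫⁻ x, S x ^ P ∂μ ≤ R ^ P := by
    have h4 : ∫⁻ x, S x ^ P ∂μ = ⨆ n, ∫⁻ x, W n x ^ P ∂μ := by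
      rw [← lintegral_iSup (fun n => (hW n).pow_const P)
        (fun n k hnk x => ENNReal.rpow_le_rpow (hWmono hnk x) hP0.le)]
      refine lintegral_congr fun x => ?_
      rw [← hWsup x]
      exact (ENNReal.orderIsoRpow P hP0).map_iSup _
    rw [h4]
    exact iSup_le hbound
  calc (∫⁻ x, S x ^ P ∂μ) ^ (1 / P) ≤ (R ^ P) ^ (1 / P) :=
        ENNReal.rpow_le_rpow hfin (by positivity)
    _ = R := by rw [← ENNReal.rpow_mul, mul_one_div_cancel hP0.ne', ENNReal.rpow_one]

/-- Mixed norms: the larger exponent may be moved inside. -/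
theorem lintegral_mixed_le [SFinite μ] [SigmaFinite ν] {p r : ℝ} (hp : 0 < p) (hpr : p ≤ r)
    {F : X → Y → ℝ≥0∞} (hF : Measurable (Function.uncurry F)) :
    (∫⁻ y, (∫⁻ x, F x y ^ p ∂μ) ^ (r / p) ∂ν) ^ (1 / r) ≤
      (∫⁻ x, (∫⁻ y, F x y ^ r ∂ν) ^ (p / r) ∂μ) ^ (1 / p) := by
  have hr : 0 < r := hp.trans_le hpr
  have h := lintegral_minkowski (μ := ν) (ν := μ) (P := r / p) ((one_le_div hp).2 hpr)
    (F := fun y x => F x y ^ p) ((hF.comp measurable_swap).pow_const p)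
  have h' := ENNReal.rpow_le_rpow h (z := 1 / p) (by positivity)
  rw [← ENNReal.rpow_mul, show 1 / (r / p) * (1 / p) = 1 / r by field_simp] at h'
  refine h'.trans_eq ?_
  congr 1
  refine lintegral_congr fun x => ?_
  rw [one_div_div]
  congr 1
  refine lintegral_congr fun y => ?_
  rw [← ENNReal.rpow_mul]
  congr 1
  field_simp

end Minkowski

theorem eLpNorm_ennreal_eq {α : Type*} [MeasurableSpace α] {μ : Measure α} {p : ℝ≥0∞}
    (h0 : p ≠ 0) (ht : p ≠ ∞) (u : α → ℝ≥0∞) :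
    eLpNorm u p μ = (∫⁻ x, u x ^ p.toReal ∂μ) ^ (1 / p.toReal) := by
  rw [eLpNorm_eq_lintegral_rpow_enorm_toReal h0 ht]
  rfl

theorem eLpNorm_enorm' {α F : Type*} [NormedAddCommGroup F] [MeasurableSpace α] {μ : Measure α}
    {p : ℝ≥0∞} (u : α → F) : eLpNorm (fun x => ‖u x‖ₑ) p μ = eLpNorm u p μ :=
  eLpNorm_congr_enorm_ae (.of_forall fun _ => rfl)

/-- Young's inequality with an `L¹` function, for all exponents. -/
theorem eLpNorm_lintegral_mul_translate_le {p : ℝ≥0∞} (hp : 1 ≤ p) {k u : 𝔼 → ℝ≥0∞}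
    (hk : Measurable k) (hu : Measurable u) :
    eLpNorm (fun x => ∫⁻ t, k t * u (x + t)) p volume ≤ (∫⁻ t, k t) * eLpNorm u p volume := by
  have hp0 : p ≠ 0 := (zero_lt_one.trans_le hp).ne'
  rcases eq_or_ne p ∞ with rfl | ht
  · simp only [eLpNorm_exponent_top]
    refine essSup_le_of_ae_le _ (.of_forall fun x => ?_)
    change ∫⁻ t, k t * u (x + t) ≤ _
    rw [← lintegral_mul_const _ hk]
    have h1 : ∀ᵐ y, u y ≤ eLpNormEssSup u (volume : Measure 𝔼) := ae_le_eLpNormEssSup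
    have h2 : ∀ᵐ t, u (x + t) ≤ eLpNormEssSup u (volume : Measure 𝔼) :=
      (measurePreserving_add_left volume x).quasiMeasurePreserving.ae h1
    refine lintegral_mono_ae ?_
    filter_upwards [h2] with t h
    gcongr
  · rw [eLpNorm_ennreal_eq hp0 ht, eLpNorm_ennreal_eq hp0 ht]
    have hP : 1 ≤ p.toReal := by
      rw [← ENNReal.toReal_one]; exact (ENNReal.toReal_le_toReal ENNReal.one_ne_top ht).2 hp
    refine (lintegral_minkowski hP (F := fun x t : 𝔼 => k t * u (x + t)) (by
      simp only [Function.uncurry_def]; fun_prop)).trans_eq ?_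
    rw [← lintegral_mul_const _ hk]
    refine lintegral_congr fun t => ?_
    simp_rw [ENNReal.mul_rpow_of_nonneg _ _ (zero_le_one.trans hP)]
    rw [lintegral_const_mul _ (by fun_prop), ENNReal.mul_rpow_of_nonneg _ _ (by positivity),
      ← ENNReal.rpow_mul, mul_one_div_cancel (by linarith), ENNReal.rpow_one,
      lintegral_add_right_eq_self (fun x => u x ^ p.toReal)]

theorem eLpNorm_lintegral_sub_mul_le {p : ℝ≥0∞} (hp : 1 ≤ p) {k u : 𝔼 → ℝ≥0∞}
    (hk : Measurable k) (hu : Measurable u) :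
    eLpNorm (fun x => ∫⁻ t, k (t - x) * u t) p volume ≤ (∫⁻ t, k t) * eLpNorm u p volume := by
  refine le_of_eq_of_le ?_ (eLpNorm_lintegral_mul_translate_le hp hk hu)
  congr 1
  ext x
  rw [← lintegral_add_left_eq_self _ x]
  simp

theorem lintegral_lintegral_sub_mul_rpow_le {P : ℝ} (hP : 1 ≤ P) {k u : 𝔼 → ℝ≥0∞}
    (hk : Measurable k) (hu : Measurable u) :
    ∫⁻ x, (∫⁻ t, k (t - x) * u t) ^ P ≤ (∫⁻ t, k t) ^ P * ∫⁻ t, u t ^ P := by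
  have hP0 : 0 < P := by linarith
  have h := eLpNorm_lintegral_sub_mul_le (p := ENNReal.ofReal P) (by simpa using hP) hk hu
  rw [eLpNorm_ennreal_eq (by simpa using hP0) (by simp),
    eLpNorm_ennreal_eq (by simpa using hP0) (by simp), ENNReal.toReal_ofReal hP0.le] at h
  have h' := ENNReal.rpow_le_rpow h hP0.le
  rwa [ENNReal.mul_rpow_of_nonneg _ _ hP0.le, ← ENNReal.rpow_mul, ← ENNReal.rpow_mul,
    one_div_mul_cancel hP0.ne', ENNReal.rpow_one, ENNReal.rpow_one] at h'

theorem recip_eq {p : ℝ≥0∞} : recip p = (1 / p).toReal := by rw [recip, one_div]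

/-- Linear change of variables in an `L^p` norm, `1 / ∞ = 0`. -/
theorem eLpNorm_comp_equiv {ε : Type*} [TopologicalSpace ε] [ContinuousENorm ε]
    (L : 𝔼 ≃L[ℝ] 𝔼) (u : 𝔼 → ε) (p : ℝ≥0∞) :
    eLpNorm (fun x => u (L x)) p volume =
      ENNReal.ofReal (|LinearMap.det (L : 𝔼 →ₗ[ℝ] 𝔼)| ^ (-recip p)) * eLpNorm u p volume := by
  have hdet : LinearMap.det (L : 𝔼 →ₗ[ℝ] 𝔼) ≠ 0 := L.toLinearEquiv.isUnit_det'.ne_zero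
  have hm := Measure.map_linearMap_addHaar_eq_smul_addHaar (volume : Measure 𝔼) hdet
  have h := L.toHomeomorph.measurableEmbedding.eLpNorm_map_measure (p := p) (μ := volume) (g := u)
  have hm' : Measure.map L.toHomeomorph (volume : Measure 𝔼) = _ := hm
  have habs : 0 < |(LinearMap.det (L : 𝔼 →ₗ[ℝ] 𝔼))⁻¹| := abs_pos.2 (inv_ne_zero hdet)
  rw [hm', eLpNorm_smul_measure_of_ne_zero (by simpa using hdet), ← recip_eq,
    ENNReal.ofReal_rpow_of_pos habs, abs_inv, Real.inv_rpow (abs_nonneg _),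
    ← Real.rpow_neg (abs_nonneg _), smul_eq_mul] at h
  exact h.symm

theorem lintegral_comp_equiv (L : 𝔼 ≃L[ℝ] 𝔼) (u : 𝔼 → ℝ≥0∞) :
    ∫⁻ x, u (L x) = ENNReal.ofReal (|LinearMap.det (L : 𝔼 →ₗ[ℝ] 𝔼)|⁻¹) * ∫⁻ x, u x := by
  have h := eLpNorm_comp_equiv L u 1
  simp only [eLpNorm_one_eq_lintegral_enorm, enorm_eq_self] at h
  rw [h, recip, inv_one, ENNReal.toReal_one, Real.rpow_neg_one]

/-- The essential supremum of a continuous function bounds all its values. -/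
theorem enorm_le_eLpNormEssSup {u : 𝔼 → ℂ} (hu : Continuous u) (x : 𝔼) :
    ‖u x‖ₑ ≤ eLpNormEssSup u volume := by
  by_contra! hlt
  have hopen : IsOpen {y | eLpNormEssSup u (volume : Measure 𝔼) < ‖u y‖ₑ} :=
    isOpen_lt continuous_const hu.enorm
  have hae : ∀ᵐ y, ‖u y‖ₑ ≤ eLpNormEssSup u (volume : Measure 𝔼) := ae_le_eLpNormEssSup
  have h0 : volume {y | eLpNormEssSup u (volume : Measure 𝔼) < ‖u y‖ₑ} = 0 := by
    simpa only [not_le] using ae_iff.1 hae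
  exact (hopen.measure_pos volume ⟨x, hlt⟩).ne' h0

/-- The inner norm of a mixed norm of a continuous function is a measurable function of the outer
variable. -/
theorem measurable_eLpNorm_left {u : 𝔼 → 𝔼 → ℂ} (hu : Continuous (Function.uncurry u)) (p : ℝ≥0∞) :
    Measurable fun ξ => eLpNorm (fun x => u x ξ) p volume := by
  rcases eq_or_ne p 0 with rfl | h0
  · simp
  rcases eq_or_ne p ∞ with rfl | ht
  · simp only [eLpNorm_exponent_top]
    have h : ∀ ξ, eLpNormEssSup (fun x => u x ξ) volume = ⨆ x, ‖u x ξ‖ₑ := fun ξ => by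
      have hc : Continuous fun x => u x ξ :=
        hu.comp (f := fun x : 𝔼 => (x, ξ)) (by fun_prop)
      refine le_antisymm ?_ (iSup_le fun x => enorm_le_eLpNormEssSup hc x)
      exact essSup_le_of_ae_le _ (.of_forall fun x => le_iSup (fun x => ‖u x ξ‖ₑ) x)
    simp_rw [h]
    refine LowerSemicontinuous.measurable (lowerSemicontinuous_iSup fun x => ?_)
    have hc : Continuous fun ξ => u x ξ := hu.comp (f := fun ξ : 𝔼 => (x, ξ)) (by fun_prop)
    exact hc.enorm.lowerSemicontinuous
  · simp_rw [eLpNorm_eq_lintegral_rpow_enorm_toReal h0 ht]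
    refine Measurable.pow_const ?_ _
    have hm : Measurable fun z : 𝔼 × 𝔼 => ‖u z.1 z.2‖ₑ ^ p.toReal :=
      (hu.measurable.enorm).pow_const _
    exact hm.lintegral_prod_left'

/-! ### Band-limited windows -/

theorem eLpNorm_le_mul_of_le {α ε ε' : Type*} [MeasurableSpace α] {μ : Measure α}
    [TopologicalSpace ε] [ContinuousENorm ε] [TopologicalSpace ε'] [ContinuousENorm ε'] {c : ℝ≥0∞}
    (hc : c ≠ ∞) {n : α → ε} {b : α → ε'} (h : ∀ x, ‖n x‖ₑ ≤ c * ‖b x‖ₑ) (p : ℝ≥0∞) :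
    eLpNorm n p μ ≤ c * eLpNorm b p μ := by
  lift c to NNReal using hc
  exact eLpNorm_le_nnreal_smul_eLpNorm_of_ae_le_mul' (.of_forall h) p

/-- If `𝓕 χ = 1` wherever `𝓕 a ≠ 0`, then convolution with `χ` reproduces `a`. -/
theorem eq_integral_of_fourier_mul_eq {a χ : 𝓢(𝔼, ℂ)} (h : ∀ ω, 𝓕 a ω * 𝓕 χ ω = 𝓕 a ω) (z : 𝔼) :
    a z = ∫ t, a t * χ (z - t) := by
  have h1 : SchwartzMap.convolution (ContinuousLinearMap.mul ℂ ℂ) a χ = a := by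
    have h2 : 𝓕 (SchwartzMap.convolution (ContinuousLinearMap.mul ℂ ℂ) a χ) = 𝓕 a := by
      ext ω
      rw [SchwartzMap.fourier_convolution, SchwartzMap.pairing_apply_apply]
      exact h ω
    have h3 := congrArg (fun φ : 𝓢(𝔼, ℂ) => 𝓕⁻ φ) h2
    simpa using h3
  conv_lhs => rw [← h1]
  rw [SchwartzMap.convolution_apply]
  rfl

/-- The short-time Fourier transform with a band-limited window `G` factors through the one with a
window `χ` whose Fourier transform is `1` near the band of `G`, and the frequency of the latter may
be chosen freely at distance at most `1`. -/
theorem stft_eq_integral_of_bandlimited {G χ : 𝓢(𝔼, ℂ)} {R : ℝ}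
    (hG : ∀ ω, R < ‖ω‖ → 𝓕 G ω = 0) (hχ : ∀ ω, ‖ω‖ ≤ R + 1 → 𝓕 χ ω = 1) (f : 𝓢'(𝔼, ℂ))
    (x : 𝔼) {ξ η : 𝔼} (hξ : ‖ξ - η‖ ≤ 1) :
    stft G f x ξ = ∫ t, shiftedWindow G x (ξ - η) t * stft χ f t η := by
  have h := apply_shiftedWindow_convolution f (shiftedWindow G x (ξ - η)) χ
    (shiftedWindow G x (ξ - η)) (eq_integral_of_fourier_mul_eq fun ω => ?_) η
  · rw [← h, stft]
    congr 1
    ext z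
    rw [shiftedWindow_apply, shiftedWindow_apply, shiftedWindow_apply, sub_zero, ← mul_assoc,
      ← conjChar_add, add_sub_cancel]
  · rw [fourier_shiftedWindow]
    rcases lt_or_ge R ‖ω + (ξ - η)‖ with hω | hω
    · rw [hG _ hω]; simp
    · rw [hχ ω, mul_one]
      have := norm_sub_le (ω + (ξ - η)) (ξ - η)
      rw [add_sub_cancel_right] at this
      linarith

theorem continuous_mul_stft (G χ : 𝓢(𝔼, ℂ)) (f : 𝓢'(𝔼, ℂ)) (η : 𝔼) :
    Continuous fun z : 𝔼 × 𝔼 => G (z.2 - z.1) * stft χ f z.2 η := by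
  have h1 := continuous_stft_left χ f η
  have h2 := G.continuous
  fun_prop

theorem integrable_mul_stft (G χ : 𝓢(𝔼, ℂ)) (f : 𝓢'(𝔼, ℂ)) (x η : 𝔼) :
    Integrable fun t => G (t - x) * stft χ f t η := by
  obtain ⟨C, hC, N, hN⟩ := exists_norm_stft_le χ f
  refine ((integrable_one_add_norm_pow_mul (G.compSubConstCLM ℂ x) N).const_mul
    (C * (1 + ‖η‖) ^ N)).mono' ?_ (.of_forall fun t => ?_)
  · exact ((continuous_mul_stft G χ f η).comp (f := fun t : 𝔼 => (x, t))
      (by fun_prop)).aestronglyMeasurable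
  · rw [norm_mul]
    calc ‖G (t - x)‖ * ‖stft χ f t η‖ ≤ ‖G (t - x)‖ * (C * ((1 + ‖t‖) * (1 + ‖η‖)) ^ N) := by
          gcongr
          exact hN t η
      _ = _ := by
          rw [mul_pow, SchwartzMap.compSubConstCLM_apply]
          ring

theorem measurable_fourier_mul_stft (G χ : 𝓢(𝔼, ℂ)) (f : 𝓢'(𝔼, ℂ)) (η : 𝔼) :
    Measurable fun z : 𝔼 × 𝔼 => ‖𝓕 (fun t => G (t - z.1) * stft χ f t η) z.2‖ₑ := by
  have h : Continuous (Function.uncurry fun (z : 𝔼 × 𝔼) (t : 𝔼) =>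
      conjChar z.2 t * (G (t - z.1) * stft χ f t η)) := by
    have h1 := continuous_stft_left χ f η
    have h2 := G.continuous
    have h3 : Continuous fun w : (𝔼 × 𝔼) × 𝔼 => conjChar w.1.2 w.2 :=
      continuous_conjChar.comp (f := fun w : (𝔼 × 𝔼) × 𝔼 => (w.1.2, w.2)) (by fun_prop)
    simp only [Function.uncurry_def]
    fun_prop
  simp_rw [fourier_eq_conjChar]
  exact (h.stronglyMeasurable.integral_prod_right).measurable.enorm

/-- The mixed norm of the localized slices `G(· - x) V_χ f(·, η)`, Fourier transformed, is bounded
by the `L^p` norm of the slice: Minkowski's inequality moves the exponent `r ≥ p` inside, the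
Hausdorff–Young inequality replaces it by `s ≤ p`, and Young's inequality removes the window. -/
theorem exists_mixed_fourier_le {s r p : ℝ} (hs : 1 < s) (hs2 : s ≤ 2) (hr : r = s / (s - 1))
    (hsp : s ≤ p) (hpr : p ≤ r) :
    ∃ C : ℝ, 0 < C ∧ ∀ (G χ : 𝓢(𝔼, ℂ)) (f : 𝓢'(𝔼, ℂ)) (η : 𝔼),
      (∫⁻ ζ, (∫⁻ x, ‖𝓕 (fun t => G (t - x) * stft χ f t η) ζ‖ₑ ^ p) ^ (r / p)) ^ (1 / r) ≤
        ENNReal.ofReal C * (∫⁻ t, ‖G t‖ₑ ^ s) ^ (1 / s) *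
          (∫⁻ t, ‖stft χ f t η‖ₑ ^ p) ^ (1 / p) := by
  obtain ⟨C, hC, hHY⟩ := exists_hausdorffYoung (V := 𝔼) hs hs2 hr
  have hs0 : 0 < s := by linarith
  have hp0 : 0 < p := by linarith
  have hr0 : 0 < r := by linarith
  refine ⟨C, hC, fun G χ f η => ?_⟩
  have hu : Measurable fun t => ‖stft χ f t η‖ₑ :=
    (continuous_stft_left χ f η).measurable.enorm
  have hG : Measurable fun t => ‖G t‖ₑ := G.continuous.measurable.enorm
  calc (∫⁻ ζ, (∫⁻ x, ‖𝓕 (fun t => G (t - x) * stft χ f t η) ζ‖ₑ ^ p) ^ (r / p)) ^ (1 / r)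
      ≤ (∫⁻ x, (∫⁻ ζ, ‖𝓕 (fun t => G (t - x) * stft χ f t η) ζ‖ₑ ^ r) ^ (p / r)) ^ (1 / p) :=
        lintegral_mixed_le hp0 hpr (measurable_fourier_mul_stft G χ f η)
    _ ≤ (∫⁻ x, ENNReal.ofReal C ^ p *
          (∫⁻ t, ‖G (t - x)‖ₑ ^ s * ‖stft χ f t η‖ₑ ^ s) ^ (p / s)) ^ (1 / p) := by
        refine ENNReal.rpow_le_rpow (lintegral_mono fun x => ?_) (by positivity)
        have h1 := hHY (fun t => G (t - x) * stft χ f t η)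
          ((continuous_mul_stft G χ f η).comp (f := fun t : 𝔼 => (x, t))
            (by fun_prop)).measurable (integrable_mul_stft G χ f x η)
        have h2 := ENNReal.rpow_le_rpow h1 hp0.le
        rw [ENNReal.mul_rpow_of_nonneg _ _ hp0.le, ← ENNReal.rpow_mul, ← ENNReal.rpow_mul,
          one_div_mul_eq_div, one_div_mul_eq_div] at h2
        refine h2.trans_eq ?_
        simp_rw [enorm_mul, ENNReal.mul_rpow_of_nonneg _ _ hs0.le]
    _ = ENNReal.ofReal C * (∫⁻ x, (∫⁻ t, ‖G (t - x)‖ₑ ^ s * ‖stft χ f t η‖ₑ ^ s) ^ (p / s)) ^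
          (1 / p) := by
        rw [lintegral_const_mul' _ _ (by finiteness),
          ENNReal.mul_rpow_of_nonneg _ _ (by positivity), ← ENNReal.rpow_mul,
          mul_one_div_cancel hp0.ne', ENNReal.rpow_one]
    _ ≤ ENNReal.ofReal C * ((∫⁻ t, ‖G t‖ₑ ^ s) ^ (p / s) *
          ∫⁻ t, (‖stft χ f t η‖ₑ ^ s) ^ (p / s)) ^ (1 / p) := by
        gcongr
        exact lintegral_lintegral_sub_mul_rpow_le ((one_le_div hs0).2 hsp)
          (hG.pow_const s) (hu.pow_const s)
    _ = _ := by
        rw [ENNReal.mul_rpow_of_nonneg _ _ (by positivity), ← ENNReal.rpow_mul, mul_assoc]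
        congr 3
        · field_simp
        · refine lintegral_congr fun t => ?_
          rw [← ENNReal.rpow_mul, mul_div_cancel₀ _ hs0.ne']

/-- If the local `L^r` norms of `n`, on balls of a fixed radius, are controlled by `b`, then
`‖n‖_q ≲ ‖b‖_q` for `q ≤ r`. -/
theorem eLpNorm_le_of_local {q : ℝ≥0∞} {r ε : ℝ} (hε : 0 < ε) (hq1 : 1 ≤ q) (hqt : q ≠ ∞)
    (hqr : q.toReal ≤ r)
    {n b : 𝔼 → ℝ≥0∞} (hn : Measurable n) {K : ℝ≥0∞} (hK : K ≠ ∞)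
    (h : ∀ η, (∫⁻ ξ in Metric.closedBall η ε, n ξ ^ r) ^ (1 / r) ≤ K * b η) :
    eLpNorm n q volume ≤
      (volume (Metric.closedBall (0 : 𝔼) ε)) ^ (-(1 / r)) * K * eLpNorm b q volume := by
  have hq0 : q ≠ 0 := (zero_lt_one.trans_le hq1).ne'
  set Q := q.toReal with hQ
  have hQ0 : 0 < Q := ENNReal.toReal_pos hq0 hqt
  have hr0 : 0 < r := hQ0.trans_le hqr
  set v := volume (Metric.closedBall (0 : 𝔼) ε) with hv
  have hvη : ∀ η : 𝔼, volume (Metric.closedBall η ε) = v := fun η =>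
    Measure.addHaar_closedBall_center _ _ _
  have hv0 : v ≠ 0 := (Metric.measure_closedBall_pos volume _ hε).ne'
  have hvt : v ≠ ∞ := measure_closedBall_lt_top.ne
  have hloc : ∀ η, ∫⁻ ξ in Metric.closedBall η ε, n ξ ^ Q ≤
      v ^ (1 - Q / r) * (K ^ Q * b η ^ Q) := fun η => by
    have h1 := eLpNorm_le_eLpNorm_mul_rpow_measure_univ
      (μ := volume.restrict (Metric.closedBall η ε)) (p := q) (q := ENNReal.ofReal r) (f := n)
      ((ENNReal.le_ofReal_iff_toReal_le hqt hr0.le).2 hqr) hn.aestronglyMeasurable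
    rw [eLpNorm_ennreal_eq hq0 hqt, eLpNorm_ennreal_eq (by simpa using hr0) (by simp),
      ENNReal.toReal_ofReal hr0.le, Measure.restrict_apply_univ, hvη, ← hQ] at h1
    have h2 := ENNReal.rpow_le_rpow (h1.trans (mul_le_mul_left (h η) _)) hQ0.le
    rw [← ENNReal.rpow_mul, one_div_mul_cancel hQ0.ne', ENNReal.rpow_one,
      ENNReal.mul_rpow_of_nonneg _ _ hQ0.le, ENNReal.mul_rpow_of_nonneg _ _ hQ0.le,
      ← ENNReal.rpow_mul, mul_comm] at h2
    refine h2.trans_eq ?_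
    congr 2
    field_simp
  have hswap : ∫⁻ η, ∫⁻ ξ in Metric.closedBall η ε, n ξ ^ Q = v * ∫⁻ ξ, n ξ ^ Q := by
    have h1 : ∀ η : 𝔼, ∫⁻ ξ in Metric.closedBall η ε, n ξ ^ Q =
        ∫⁻ ξ, (Metric.closedBall (0 : 𝔼) ε).indicator 1 (ξ - η) * n ξ ^ Q := fun η => by
      rw [← lintegral_indicator measurableSet_closedBall]
      refine lintegral_congr fun ξ => ?_
      by_cases hξ : ξ ∈ Metric.closedBall η ε
      · have : ξ - η ∈ Metric.closedBall (0 : 𝔼) ε := by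
          simpa [dist_eq_norm] using hξ
        rw [Set.indicator_of_mem hξ, Set.indicator_of_mem this, Pi.one_apply, one_mul]
      · have : ξ - η ∉ Metric.closedBall (0 : 𝔼) ε := by
          simpa [dist_eq_norm] using hξ
        rw [Set.indicator_of_notMem hξ, Set.indicator_of_notMem this, zero_mul]
    have hi : Measurable ((Metric.closedBall (0 : 𝔼) ε).indicator (1 : 𝔼 → ℝ≥0∞)) :=
      measurable_one.indicator measurableSet_closedBall
    simp_rw [h1]
    rw [lintegral_lintegral_swap (Measurable.aemeasurable (by
      simp only [Function.uncurry_def]; fun_prop)), ← lintegral_const_mul' _ _ hvt]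
    refine lintegral_congr fun ξ => ?_
    rw [lintegral_mul_const _ (by fun_prop),
      lintegral_sub_left_eq_self (fun η => (Metric.closedBall (0 : 𝔼) ε).indicator 1 η) ξ,
      lintegral_indicator_one measurableSet_closedBall]
  have hfin : ∫⁻ ξ, n ξ ^ Q ≤ v ^ (-(Q / r)) * (K ^ Q * ∫⁻ η, b η ^ Q) := by
    have h1 : v * ∫⁻ ξ, n ξ ^ Q ≤ v * (v ^ (-(Q / r)) * (K ^ Q * ∫⁻ η, b η ^ Q)) := by
      rw [← hswap]
      refine (lintegral_mono hloc).trans_eq ?_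
      rw [lintegral_const_mul' _ _ (ENNReal.rpow_ne_top_of_ne_zero hv0 hvt),
        lintegral_const_mul' _ _ (ENNReal.rpow_ne_top_of_nonneg hQ0.le hK), ← mul_assoc v,
        show 1 - Q / r = 1 + -(Q / r) by ring, ENNReal.rpow_add _ _ hv0 hvt, ENNReal.rpow_one]
    exact (ENNReal.mul_le_mul_iff_right hv0 hvt).1 h1
  rw [eLpNorm_ennreal_eq hq0 hqt, eLpNorm_ennreal_eq hq0 hqt, ← hQ]
  refine (ENNReal.rpow_le_rpow hfin (by positivity)).trans_eq ?_
  rw [ENNReal.mul_rpow_of_nonneg _ _ (by positivity),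
    ENNReal.mul_rpow_of_nonneg _ _ (by positivity), ← ENNReal.rpow_mul, ← ENNReal.rpow_mul,
    mul_one_div_cancel hQ0.ne', ENNReal.rpow_one, mul_assoc]
  congr 2
  field_simp

/-- The `L^p` norm of the short-time Fourier transform at a fixed frequency. -/
def sliceNorm (g : 𝓢(𝔼, ℂ)) (p : ℝ≥0∞) (f : 𝓢'(𝔼, ℂ)) (ξ : 𝔼) : ℝ≥0∞ :=
  eLpNorm (fun x => stft g f x ξ) p volume

theorem modNorm_eq (g : 𝓢(𝔼, ℂ)) (p q : ℝ≥0∞) (f : 𝓢'(𝔼, ℂ)) :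
    modNorm g p q f = eLpNorm (sliceNorm g p f) q volume := rfl

theorem measurable_sliceNorm (g : 𝓢(𝔼, ℂ)) (p : ℝ≥0∞) (f : 𝓢'(𝔼, ℂ)) :
    Measurable (sliceNorm g p f) :=
  measurable_eLpNorm_left (u := fun x ξ => stft g f x ξ) (continuous_stft g f) p

theorem sliceNorm_eq_lintegral (g : 𝓢(𝔼, ℂ)) {p : ℝ≥0∞} (h0 : p ≠ 0) (ht : p ≠ ∞) (f : 𝓢'(𝔼, ℂ))
    (ξ : 𝔼) : sliceNorm g p f ξ = (∫⁻ x, ‖stft g f x ξ‖ₑ ^ p.toReal) ^ (1 / p.toReal) :=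
  eLpNorm_eq_lintegral_rpow_enorm_toReal h0 ht

theorem recip_nonneg (p : ℝ≥0∞) : 0 ≤ recip p := ENNReal.toReal_nonneg

theorem recip_le_one {p : ℝ≥0∞} (hp : 1 ≤ p) : recip p ≤ 1 := by
  have h : p⁻¹ ≤ 1 := ENNReal.inv_le_one.2 hp
  have := ENNReal.toReal_mono ENNReal.one_ne_top h
  simpa [recip] using this

theorem recip_eq_one_div {p : ℝ≥0∞} : recip p = 1 / p.toReal := by
  rw [recip, ENNReal.toReal_inv, one_div]

theorem ne_top_of_recip_pos {p : ℝ≥0∞} (h : 0 < recip p) : p ≠ ∞ := by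
  rintro rfl
  simp [recip] at h

/-- For windows `G` with a common band, the modulation norm with window `G` is controlled by
`‖G‖_{1 / ρ}`, where `ρ = max (1/p, 1/p', 1/q')`. When `ρ = 1`, Young's inequality suffices.
Otherwise `s = 1 / ρ` lies in `(1, 2]`, its conjugate exponent is `r = 1 / (1 - ρ)`, and `p` and `q`
are such that `s ≤ p ≤ r` and `q ≤ r`. -/
theorem exists_modNorm_le_of_bandlimited {p q : ℝ≥0∞} (hp : 1 ≤ p) (hq : 1 ≤ q) {R ρ : ℝ}
    (hρ : ρ = max (max (recip p) (1 - recip p)) (1 - recip q)) {χ : 𝓢(𝔼, ℂ)}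
    (hχ : ∀ ω, ‖ω‖ ≤ R + 1 → 𝓕 χ ω = 1) :
    ∃ C : ℝ, 0 < C ∧ ∀ G : 𝓢(𝔼, ℂ), (∀ ω, R < ‖ω‖ → 𝓕 G ω = 0) → ∀ f : 𝓢'(𝔼, ℂ),
      modNorm G p q f ≤
        ENNReal.ofReal C * (∫⁻ t, ‖G t‖ₑ ^ (1 / ρ)) ^ ρ * modNorm χ p q f := by
  have hp0 := recip_nonneg p
  have hp1 := recip_le_one hp
  have hq0 := recip_nonneg q
  have hρp : recip p ≤ ρ := by rw [hρ]; simp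
  have hρp' : 1 - recip p ≤ ρ := by rw [hρ]; simp
  have hρq : 1 - recip q ≤ ρ := by rw [hρ]; simp
  have hρ1 : ρ ≤ 1 := by
    rw [hρ]
    exact max_le (max_le hp1 (by linarith)) (by linarith)
  have hGfin : ∀ (G : 𝓢(𝔼, ℂ)) {s : ℝ}, 0 < s → ∫⁻ t, ‖G t‖ₑ ^ s ≠ ∞ := fun G s hs => by
    have h := (G.memLp (ENNReal.ofReal s) volume).2
    rw [eLpNorm_lt_top_iff_lintegral_rpow_enorm_lt_top (by simpa using hs) (by simp),
      ENNReal.toReal_ofReal hs.le] at h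
    exact h.ne
  rcases hρ1.eq_or_lt with h1 | h1
  · refine ⟨1, one_pos, fun G hG f => ?_⟩
    rw [h1, ENNReal.ofReal_one, one_mul, div_one, ENNReal.rpow_one, modNorm_eq, modNorm_eq]
    refine eLpNorm_le_mul_of_le (hGfin G one_pos) (fun ξ => ?_) q
    simp only [enorm_eq_self, sliceNorm, ENNReal.rpow_one]
    rw [← eLpNorm_enorm' fun x => stft χ f x ξ]
    refine le_trans (eLpNorm_mono_enorm fun x => ?_) (eLpNorm_lintegral_sub_mul_le hp
      G.continuous.measurable.enorm (continuous_stft_left χ f ξ).measurable.enorm)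
    rw [stft_eq_integral_of_bandlimited hG hχ f x (ξ := ξ) (η := ξ) (by simp)]
    refine (enorm_integral_le_lintegral_enorm _).trans_eq (lintegral_congr fun t => ?_)
    rw [enorm_mul, shiftedWindow_apply, enorm_mul, ← ofReal_norm (conjChar _ _), norm_conjChar]
    simp
  · have hρhalf : 1 / 2 ≤ ρ := by linarith
    have hρ0 : 0 < ρ := by linarith
    have hpt : p ≠ ∞ := ne_top_of_recip_pos (by linarith)
    have hqt : q ≠ ∞ := ne_top_of_recip_pos (by linarith)
    have hpn : p ≠ 0 := (zero_lt_one.trans_le hp).ne'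
    have hqn : q ≠ 0 := (zero_lt_one.trans_le hq).ne'
    have hP0 : 0 < p.toReal := ENNReal.toReal_pos hpn hpt
    have hQ0 : 0 < q.toReal := ENNReal.toReal_pos hqn hqt
    rw [recip_eq_one_div] at hρp hρp' hρq
    have h1ρ : 0 < 1 - ρ := by linarith
    have hr : 1 / (1 - ρ) = 1 / ρ / (1 / ρ - 1) := by field_simp
    obtain ⟨C, hC, hmix⟩ := exists_mixed_fourier_le (d := d) (s := 1 / ρ) (r := 1 / (1 - ρ))
      (p := p.toReal) (by rw [lt_div_iff₀ hρ0]; linarith)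
      (by rw [div_le_iff₀ hρ0]; linarith) hr
      (by rw [one_div_le hρ0 hP0]; exact hρp)
      (by rw [le_one_div hP0 h1ρ]; linarith)
    have hqr : q.toReal ≤ 1 / (1 - ρ) := by rw [le_one_div hQ0 h1ρ]; linarith
    set r := 1 / (1 - ρ)
    have hr0 : 0 < r := by positivity
    set v := volume (Metric.closedBall (0 : 𝔼) 1) with hv
    have hv0 : v ≠ 0 := (Metric.measure_closedBall_pos volume _ one_pos).ne'
    have hvt : v ≠ ∞ := measure_closedBall_lt_top.ne
    have hvr0 : 0 < (v ^ (-(1 / r))).toReal := ENNReal.toReal_pos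
      (ENNReal.rpow_pos (pos_iff_ne_zero.2 hv0) hvt).ne' (ENNReal.rpow_ne_top_of_ne_zero hv0 hvt)
    refine ⟨(v ^ (-(1 / r))).toReal * C, by positivity, fun G hG f => ?_⟩
    rw [ENNReal.ofReal_mul hvr0.le, ENNReal.ofReal_toReal
      (ENNReal.rpow_ne_top_of_ne_zero hv0 hvt), modNorm_eq, modNorm_eq]
    have hgfin := hGfin G (s := 1 / ρ) (by positivity)
    have hρρ : 1 / (1 / ρ) = ρ := one_div_one_div ρ
    have := eLpNorm_le_of_local (n := sliceNorm G p f) (b := sliceNorm χ p f) one_pos hq hqt hqr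
      (measurable_sliceNorm G p f)
      (K := ENNReal.ofReal C * (∫⁻ t, ‖G t‖ₑ ^ (1 / ρ)) ^ (1 / (1 / ρ)))
      (ENNReal.mul_ne_top ENNReal.ofReal_ne_top
        (ENNReal.rpow_ne_top_of_nonneg (by positivity) hgfin)) (fun η => ?_)
    · refine this.trans_eq ?_
      rw [hρρ]
      simp only [mul_assoc]
      rfl
    · rw [sliceNorm_eq_lintegral χ hpn hpt]
      refine le_trans ?_ (hmix G χ f η)
      refine ENNReal.rpow_le_rpow ?_ (by positivity)
      rw [← lintegral_indicator measurableSet_closedBall, ← lintegral_add_right_eq_self _ η]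
      refine lintegral_mono fun ζ => ?_
      by_cases hζ : ζ + η ∈ Metric.closedBall η 1
      swap
      · simp [Set.indicator_of_notMem hζ]
      rw [Set.indicator_of_mem hζ, sliceNorm_eq_lintegral G hpn hpt, ← ENNReal.rpow_mul,
        one_div_mul_eq_div]
      have hζ' : ‖ζ + η - η‖ ≤ 1 := by simpa [dist_eq_norm] using hζ
      refine le_of_eq ?_
      congr 1
      refine lintegral_congr fun x => ?_
      rw [stft_eq_integral_of_bandlimited hG hχ f x hζ', add_sub_cancel_right, fourier_eq_conjChar]
      congr 3
      ext t
      rw [shiftedWindow_apply, mul_assoc]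

/-! ### Contracted windows -/

/-- Minkowski's integral inequality for all exponents. At `p = ∞` pointwise bounds are assumed, to
avoid the measurability of essential suprema. -/
theorem eLpNorm_lintegral_le {X Y : Type*} [MeasurableSpace X] [MeasurableSpace Y] {μ : Measure X}
    {ν : Measure Y} [SigmaFinite μ] [SFinite ν] {p : ℝ≥0∞} (hp : 1 ≤ p) {F : X → Y → ℝ≥0∞}
    (hF : Measurable (Function.uncurry F)) {B : Y → ℝ≥0∞}
    (hB : p ≠ ∞ → ∀ y, eLpNorm (fun x => F x y) p μ ≤ B y) (hB' : p = ∞ → ∀ x y, F x y ≤ B y) :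
    eLpNorm (fun x => ∫⁻ y, F x y ∂ν) p μ ≤ ∫⁻ y, B y ∂ν := by
  rcases eq_or_ne p ∞ with rfl | ht
  · rw [eLpNorm_exponent_top]
    exact essSup_le_of_ae_le _ (.of_forall fun x => lintegral_mono (hB' rfl x))
  · have h0 : p ≠ 0 := (zero_lt_one.trans_le hp).ne'
    have h1 : 1 ≤ p.toReal := by
      have := ENNReal.toReal_mono ht hp
      simpa using this
    rw [eLpNorm_ennreal_eq h0 ht]
    refine (lintegral_minkowski h1 hF).trans (lintegral_mono fun y => ?_)
    rw [← eLpNorm_ennreal_eq h0 ht fun x => F x y]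
    exact hB ht y

theorem convolution_mul_apply (a χ : 𝓢(𝔼, ℂ)) (z : 𝔼) :
    SchwartzMap.convolution (ContinuousLinearMap.mul ℂ ℂ) a χ z = ∫ t, a t * χ (z - t) := by
  rw [SchwartzMap.convolution_apply]
  rfl

theorem shiftedWindow_shiftedWindow (χ : 𝓢(𝔼, ℂ)) (t η x ξ : 𝔼) :
    shiftedWindow (shiftedWindow χ t η) x ξ =
      conjChar (-η) x • shiftedWindow χ (t + x) (ξ + η) := by
  ext y
  rw [smul_apply, shiftedWindow_apply, shiftedWindow_apply, shiftedWindow_apply,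
    smul_eq_mul, conjChar_add, sub_eq_add_neg y x, conjChar_add_right, add_comm t x, ← sub_sub,
    ← sub_eq_add_neg]
  have : conjChar η (-x) = conjChar (-η) x := by simp [conjChar]
  rw [this]
  ring

/-- The Fourier transform of a localized slice `ψ(· - x) V_G f(·, ξ)` is a pairing of `f` with a
single Schwartz function. -/
theorem fourier_mul_stft_eq_apply (G ψ : 𝓢(𝔼, ℂ)) (f : 𝓢'(𝔼, ℂ)) (x ξ ζ : 𝔼) :
    𝓕 (fun t => ψ (t - x) * stft G f t ξ) ζ =
      f (shiftedWindow (SchwartzMap.convolution (ContinuousLinearMap.mul ℂ ℂ)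
        (shiftedWindow ψ x ζ) G) 0 ξ) := by
  rw [apply_shiftedWindow_convolution f (shiftedWindow ψ x ζ) G _
    (convolution_mul_apply _ _) ξ, fourier_eq_conjChar]
  refine integral_congr_ae (.of_forall fun t => ?_)
  simp only [shiftedWindow_apply, mul_assoc]

/-- The Fourier transform of a localized slice `ψ(· - x) V_G f(·, ξ)`, expressed through the
short-time Fourier transform with window `ψ`. -/
theorem fourier_mul_stft_eq_integral (G ψ : 𝓢(𝔼, ℂ)) (f : 𝓢'(𝔼, ℂ)) (x ξ ζ : 𝔼) :
    𝓕 (fun t => ψ (t - x) * stft G f t ξ) ζ =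
      ∫ s, G s * (conjChar (-ζ) s * stft ψ f (x + s) (ξ + ζ)) := by
  rw [fourier_mul_stft_eq_apply, apply_shiftedWindow_convolution f G (shiftedWindow ψ x ζ)]
  · refine integral_congr_ae (.of_forall fun s => ?_)
    simp only [stft]
    rw [shiftedWindow_shiftedWindow, map_smul, smul_eq_mul]
  · intro z
    rw [convolution_mul_apply, ← integral_sub_left_eq_self _ _ z]
    refine integral_congr_ae (.of_forall fun s => ?_)
    simp only [sub_sub_cancel]
    ring

/-- The Fourier transform of a localized slice vanishes at those `ζ` for which the supports of `𝓕 G`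
and of the translate `𝓕 ψ(· + ζ)` are disjoint. -/
theorem fourier_mul_stft_eq_zero {G ψ : 𝓢(𝔼, ℂ)} {ζ : 𝔼}
    (h : ∀ ω, 𝓕 G ω * 𝓕 ψ (ω + ζ) = 0) (f : 𝓢'(𝔼, ℂ)) (x ξ : 𝔼) :
    𝓕 (fun t => ψ (t - x) * stft G f t ξ) ζ = 0 := by
  rw [fourier_mul_stft_eq_apply]
  have h1 : SchwartzMap.convolution (ContinuousLinearMap.mul ℂ ℂ) (shiftedWindow ψ x ζ) G = 0 := by
    have h2 : 𝓕 (SchwartzMap.convolution (ContinuousLinearMap.mul ℂ ℂ) (shiftedWindow ψ x ζ) G) =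
        𝓕 (0 : 𝓢(𝔼, ℂ)) := by
      ext ω
      rw [SchwartzMap.fourier_convolution, SchwartzMap.pairing_apply_apply, fourier_shiftedWindow]
      have h0 : 𝓕 (0 : 𝓢(𝔼, ℂ)) = 0 := map_zero (FourierTransform.fourierCLM ℂ 𝓢(𝔼, ℂ))
      rw [h0]
      simp only [ContinuousLinearMap.mul_apply', zero_apply]
      rw [mul_assoc, mul_comm (𝓕 ψ _), h, mul_zero]
    have h3 := congrArg (fun φ : 𝓢(𝔼, ℂ) => 𝓕⁻ φ) h2
    simpa using h3
  have h4 : shiftedWindow (0 : 𝓢(𝔼, ℂ)) 0 ξ = 0 := by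
    ext y
    simp [shiftedWindow_apply]
  rw [h1, h4, map_zero]

theorem enorm_fourier_mul_stft_le (G ψ : 𝓢(𝔼, ℂ)) (f : 𝓢'(𝔼, ℂ)) (x ξ ζ : 𝔼) :
    ‖𝓕 (fun t => ψ (t - x) * stft G f t ξ) ζ‖ₑ ≤
      ∫⁻ s, ‖G s‖ₑ * ‖stft ψ f (x + s) (ξ + ζ)‖ₑ := by
  rw [fourier_mul_stft_eq_integral]
  refine (enorm_integral_le_lintegral_enorm _).trans_eq (lintegral_congr fun s => ?_)
  rw [enorm_mul, enorm_mul, ← ofReal_norm (conjChar _ _), norm_conjChar]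
  simp

theorem eLpNorm_fourier_mul_stft_le {p : ℝ≥0∞} (hp : 1 ≤ p) (G ψ : 𝓢(𝔼, ℂ)) (f : 𝓢'(𝔼, ℂ))
    (ξ ζ : 𝔼) :
    eLpNorm (fun x => ‖𝓕 (fun t => ψ (t - x) * stft G f t ξ) ζ‖ₑ) p volume ≤
      (∫⁻ s, ‖G s‖ₑ) * sliceNorm ψ p f (ξ + ζ) := by
  rw [sliceNorm, ← eLpNorm_enorm' fun x => stft ψ f x (ξ + ζ)]
  refine le_trans (eLpNorm_mono_enorm fun x => ?_) (eLpNorm_lintegral_mul_translate_le hp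
      G.continuous.measurable.enorm (continuous_stft_left ψ f (ξ + ζ)).measurable.enorm)
  simp only [enorm_eq_self]
  exact enorm_fourier_mul_stft_le G ψ f x ξ ζ

theorem lintegral_enorm_ne_top (G : 𝓢(𝔼, ℂ)) : ∫⁻ s, ‖G s‖ₑ ≠ ∞ := G.integrable.2.ne

/-- Inversion of the Fourier transform of a localized slice. -/
theorem mul_stft_eq_fourierInv {G ψ : 𝓢(𝔼, ℂ)} {B : Set 𝔼} (hB : Bornology.IsBounded B)
    (h : ∀ ζ ∉ B, ∀ ω, 𝓕 G ω * 𝓕 ψ (ω + ζ) = 0) (f : 𝓢'(𝔼, ℂ)) (x ξ : 𝔼) :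
    Integrable (𝓕 (fun t => ψ (t - x) * stft G f t ξ)) ∧
      𝓕⁻ (𝓕 (fun t => ψ (t - x) * stft G f t ξ)) = fun t => ψ (t - x) * stft G f t ξ := by
  have hi := integrable_mul_stft ψ G f x ξ
  have hc := continuous_fourier hi
  have hI : Integrable (𝓕 (fun t => ψ (t - x) * stft G f t ξ)) := by
    refine hc.integrable_of_hasCompactSupport
      (HasCompactSupport.intro hB.isCompact_closure fun ζ hζ => ?_)
    exact fourier_mul_stft_eq_zero (h ζ fun hζB => hζ (subset_closure hζB)) f x ξ
  refine ⟨hI, Continuous.fourierInv_fourier_eq ?_ hi hI⟩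
  exact (continuous_mul_stft ψ G f ξ).comp (f := fun t : 𝔼 => (x, t)) (by fun_prop)

theorem lintegral_eq_setLIntegral {B : Set 𝔼} (hB : MeasurableSet B) {u : 𝔼 → ℝ≥0∞}
    (hu : ∀ ζ ∉ B, u ζ = 0) : ∫⁻ ζ, u ζ = ∫⁻ ζ in B, u ζ := by
  rw [← lintegral_indicator hB]
  refine lintegral_congr fun ζ => ?_
  by_cases hζ : ζ ∈ B
  · rw [Set.indicator_of_mem hζ]
  · rw [Set.indicator_of_notMem hζ, hu ζ hζ]

/-- Fourier inversion on the localized slice, evaluated at its centre: the case `s = 1`, `r = ∞` of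
`exists_sliceNorm_le_rpow`, valid for every `p`. -/
theorem exists_sliceNorm_le_lintegral {p : ℝ≥0∞} (hp : 1 ≤ p) {ψ : 𝓢(𝔼, ℂ)} (hψ : ψ 0 ≠ 0) :
    ∃ C : ℝ, 0 < C ∧ ∀ (G : 𝓢(𝔼, ℂ)) (B : Set 𝔼), MeasurableSet B → Bornology.IsBounded B →
      (∀ ζ ∉ B, ∀ ω, 𝓕 G ω * 𝓕 ψ (ω + ζ) = 0) → ∀ (f : 𝓢'(𝔼, ℂ)) (ξ : 𝔼),
        sliceNorm G p f ξ ≤ ENNReal.ofReal C * (∫⁻ s, ‖G s‖ₑ) *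
          ∫⁻ ζ in B, sliceNorm ψ p f (ξ + ζ) := by
  have hψ' : 0 < ‖ψ 0‖ := norm_pos_iff.2 hψ
  refine ⟨‖ψ 0‖⁻¹, by positivity, fun G B hBm hB h f ξ => ?_⟩
  have h1 : ∀ x, ‖stft G f x ξ‖ₑ ≤ ENNReal.ofReal ‖ψ 0‖⁻¹ *
      ‖∫⁻ ζ in B, ‖𝓕 (fun t => ψ (t - x) * stft G f t ξ) ζ‖ₑ‖ₑ := fun x => by
    obtain ⟨hI, hinv⟩ := mul_stft_eq_fourierInv hB h f x ξ
    have h2 := congrFun hinv x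
    rw [sub_self, Real.fourierInv_eq_fourier_neg] at h2
    have h3 := enorm_fourier_le (𝓕 (fun t => ψ (t - x) * stft G f t ξ)) (-x)
    rw [h2, enorm_mul, lintegral_eq_setLIntegral hBm fun ζ hζ => by
      rw [fourier_mul_stft_eq_zero (h ζ hζ), enorm_zero]] at h3
    rw [enorm_eq_self, ENNReal.ofReal_inv_of_pos hψ', ofReal_norm, ← ENNReal.div_eq_inv_mul,
      ENNReal.le_div_iff_mul_le (by simp [hψ]) (by simp), mul_comm]
    exact h3
  refine (eLpNorm_le_mul_of_le ENNReal.ofReal_ne_top h1 p).trans ?_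
  rw [mul_assoc, ← lintegral_const_mul' _ _ (lintegral_enorm_ne_top G)]
  refine mul_le_mul_right (eLpNorm_lintegral_le hp (measurable_fourier_mul_stft ψ G f ξ)
    (fun _ ζ => eLpNorm_fourier_mul_stft_le hp G ψ f ξ ζ) ?_) _
  rintro rfl x ζ
  refine (enorm_fourier_mul_stft_le G ψ f x ξ ζ).trans ?_
  rw [← lintegral_mul_const _ G.continuous.measurable.enorm]
  refine lintegral_mono fun s => mul_le_mul_right ?_ _
  rw [sliceNorm, eLpNorm_exponent_top]
  exact enorm_le_eLpNormEssSup (continuous_stft_left ψ f (ξ + ζ)) (x + s)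

theorem measurable_fourier_mul_stft_swap (G χ : 𝓢(𝔼, ℂ)) (f : 𝓢'(𝔼, ℂ)) (η : 𝔼) :
    Measurable (Function.uncurry fun (ζ x : 𝔼) => ‖𝓕 (fun t => G (t - x) * stft χ f t η) ζ‖ₑ) := by
  have h := measurable_fourier_mul_stft G χ f η
  have h2 : Measurable fun z : 𝔼 × 𝔼 => (z.2, z.1) := measurable_swap
  have h3 := h.comp h2
  simp only [Function.comp_def] at h3
  simp only [Function.uncurry_def]
  exact h3

theorem exists_norm_ge_near_zero {ψ : 𝓢(𝔼, ℂ)} (hψ : ψ 0 ≠ 0) :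
    ∃ ε > 0, ∃ δ > 0, ∀ y, ‖y‖ ≤ ε → δ ≤ ‖ψ y‖ := by
  have h : ∀ᶠ y in 𝓝 (0 : 𝔼), ‖ψ 0‖ / 2 < ‖ψ y‖ :=
    ψ.continuous.norm.continuousAt.eventually (lt_mem_nhds (half_lt_self (norm_pos_iff.2 hψ)))
  obtain ⟨ε, hε, hb⟩ := Metric.nhds_basis_closedBall.eventually_iff.1 h
  exact ⟨ε, hε, ‖ψ 0‖ / 2, half_pos (norm_pos_iff.2 hψ), fun y hy => (hb (by simpa using hy)).le⟩

/-- Mixed norms: the larger exponent may be moved inside. -/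
theorem eLpNorm_rpow_lintegral_le {X Y : Type*} [MeasurableSpace X] [MeasurableSpace Y]
    {μ : Measure X} {ν : Measure Y} [SFinite μ] [SigmaFinite ν] {p : ℝ≥0∞} {s : ℝ} (hs : 0 < s)
    (hpt : p ≠ ∞) (hsp : s ≤ p.toReal) {F : X → Y → ℝ≥0∞} (hF : Measurable (Function.uncurry F)) :
    eLpNorm (fun y => (∫⁻ x, F x y ^ s ∂μ) ^ (1 / s)) p ν ≤
      (∫⁻ x, eLpNorm (F x) p ν ^ s ∂μ) ^ (1 / s) := by
  have hp0 : p ≠ 0 := by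
    rintro rfl
    simp at hsp
    linarith
  have h := lintegral_mixed_le (μ := μ) (ν := ν) hs hsp hF
  have h1 : ∀ x, (∫⁻ y, F x y ^ p.toReal ∂ν) ^ (s / p.toReal) = eLpNorm (F x) p ν ^ s := fun x => by
    rw [eLpNorm_ennreal_eq hp0 hpt, ← ENNReal.rpow_mul, one_div_mul_eq_div]
  have h2 : ∀ y, (∫⁻ x, F x y ^ s ∂μ) ^ (p.toReal / s) =
      ((∫⁻ x, F x y ^ s ∂μ) ^ (1 / s)) ^ p.toReal := fun y => by
    rw [← ENNReal.rpow_mul, one_div_mul_eq_div]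
  simp only [h1, h2] at h
  rwa [eLpNorm_ennreal_eq hp0 hpt]

/-- The localized slices of `V_G f(·, ξ)` are the inverse transforms of functions supported in `B`,
so the Hausdorff–Young inequality bounds their `L^r` norms by `L^s` norms over `B`. As `s ≤ p ≤ r`,
the `L^p` norm in `x` can be recovered from the local `L^r` norms and moved inside the integral over
`B`. -/
theorem exists_sliceNorm_le_rpow {p : ℝ≥0∞} (hp : 1 ≤ p) (hpt : p ≠ ∞) {s r : ℝ} (hs : 1 < s)
    (hs2 : s ≤ 2) (hr : r = s / (s - 1)) (hsp : s ≤ p.toReal) (hpr : p.toReal ≤ r)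
    {ψ : 𝓢(𝔼, ℂ)} (hψ : ψ 0 ≠ 0) :
    ∃ C : ℝ, 0 < C ∧ ∀ (G : 𝓢(𝔼, ℂ)) (B : Set 𝔼), MeasurableSet B → Bornology.IsBounded B →
      (∀ ζ ∉ B, ∀ ω, 𝓕 G ω * 𝓕 ψ (ω + ζ) = 0) → ∀ (f : 𝓢'(𝔼, ℂ)) (ξ : 𝔼),
        sliceNorm G p f ξ ≤ ENNReal.ofReal C * (∫⁻ s, ‖G s‖ₑ) *
          (∫⁻ ζ in B, sliceNorm ψ p f (ξ + ζ) ^ s) ^ (1 / s) := by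
  obtain ⟨C, hC, hHY⟩ := exists_hausdorffYoung (V := 𝔼) hs hs2 hr
  obtain ⟨ε, hε, δ, hδ, hψδ⟩ := exists_norm_ge_near_zero hψ
  have hs0 : 0 < s := by linarith
  have hp0 : p ≠ 0 := (zero_lt_one.trans_le hp).ne'
  have hP0 : 0 < p.toReal := hs0.trans_le hsp
  have hr0 : 0 < r := hP0.trans_le hpr
  set v := volume (Metric.closedBall (0 : 𝔼) ε) with hv
  have hv0 : v ≠ 0 := (Metric.measure_closedBall_pos volume _ hε).ne'
  have hvt : v ≠ ∞ := measure_closedBall_lt_top.ne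
  have hvr0 : 0 < (v ^ (-(1 / r))).toReal := ENNReal.toReal_pos
    (ENNReal.rpow_pos (pos_iff_ne_zero.2 hv0) hvt).ne' (ENNReal.rpow_ne_top_of_ne_zero hv0 hvt)
  refine ⟨(v ^ (-(1 / r))).toReal * (C * δ⁻¹), by positivity, fun G B hBm hB h f ξ => ?_⟩
  rw [ENNReal.ofReal_mul hvr0.le, ENNReal.ofReal_toReal (ENNReal.rpow_ne_top_of_ne_zero hv0 hvt)]
  have h1 := eLpNorm_le_of_local (n := fun x => ‖stft G f x ξ‖ₑ)
    (b := fun x => (∫⁻ ζ in B, ‖𝓕 (fun t => ψ (t - x) * stft G f t ξ) ζ‖ₑ ^ s) ^ (1 / s))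
    hε hp hpt hpr (continuous_stft_left G f ξ).measurable.enorm
    (K := ENNReal.ofReal (C * δ⁻¹)) ENNReal.ofReal_ne_top fun x => ?_
  · rw [sliceNorm, ← eLpNorm_enorm' fun x => stft G f x ξ]
    refine h1.trans ?_
    rw [← hv]
    simp only [mul_assoc]
    refine mul_le_mul_right (mul_le_mul_right ?_ _) _
    refine (eLpNorm_rpow_lintegral_le hs0 hpt hsp (μ := volume.restrict B)
      (measurable_fourier_mul_stft_swap ψ G f ξ)).trans ?_
    have h2 : ∀ ζ, eLpNorm (fun x => ‖𝓕 (fun t => ψ (t - x) * stft G f t ξ) ζ‖ₑ) p volume ^ s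
        ≤ (∫⁻ t, ‖G t‖ₑ) ^ s * sliceNorm ψ p f (ξ + ζ) ^ s := fun ζ => by
      rw [← ENNReal.mul_rpow_of_nonneg _ _ hs0.le]
      exact ENNReal.rpow_le_rpow (eLpNorm_fourier_mul_stft_le hp G ψ f ξ ζ) hs0.le
    refine (ENNReal.rpow_le_rpow (lintegral_mono h2) (by positivity)).trans_eq ?_
    rw [lintegral_const_mul' _ _
      (ENNReal.rpow_ne_top_of_nonneg hs0.le (lintegral_enorm_ne_top G)),
      ENNReal.mul_rpow_of_nonneg _ _ (by positivity), ← ENNReal.rpow_mul,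
      mul_one_div_cancel hs0.ne', ENNReal.rpow_one]
  · obtain ⟨hI, hinv⟩ := mul_stft_eq_fourierInv hB h f x ξ
    have h2 := hHY _ (continuous_fourier (integrable_mul_stft ψ G f x ξ)).measurable hI
    rw [lintegral_eq_setLIntegral (u := fun ζ => ‖𝓕 (fun t => ψ (t - x) * stft G f t ξ) ζ‖ₑ ^ s)
      hBm fun ζ hζ => by
        rw [fourier_mul_stft_eq_zero (h ζ hζ), enorm_zero, ENNReal.zero_rpow_of_pos hs0]] at h2
    rw [ENNReal.ofReal_mul hC.le, mul_comm (ENNReal.ofReal C), mul_assoc]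
    rw [← lintegral_sub_left_eq_self
      (fun ω => ‖𝓕 (𝓕 fun t => ψ (t - x) * stft G f t ξ) ω‖ₑ ^ r) 0] at h2
    simp_rw [zero_sub, ← Real.fourierInv_eq_fourier_neg, hinv] at h2
    refine le_trans ?_ (mul_le_mul_right h2 _)
    rw [← ENNReal.rpow_rpow_inv hr0.ne' (ENNReal.ofReal δ⁻¹), inv_eq_one_div r,
      ← ENNReal.mul_rpow_of_nonneg _ _ (by positivity)]
    refine ENNReal.rpow_le_rpow ?_ (by positivity)
    rw [← lintegral_const_mul' _ _ (ENNReal.rpow_ne_top_of_nonneg hr0.le ENNReal.ofReal_ne_top)]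
    refine le_trans (setLIntegral_mono' measurableSet_closedBall fun y hy => ?_)
      (setLIntegral_le_lintegral (Metric.closedBall x ε) _)
    rw [← ENNReal.mul_rpow_of_nonneg _ _ hr0.le, enorm_mul, ← mul_assoc]
    refine ENNReal.rpow_le_rpow ?_ hr0.le
    have h3 : 1 ≤ ENNReal.ofReal δ⁻¹ * ‖ψ (y - x)‖ₑ := by
      rw [← ofReal_norm, ← ENNReal.ofReal_mul (by positivity), ← ENNReal.ofReal_one]
      refine ENNReal.ofReal_le_ofReal ?_
      rw [← div_eq_inv_mul, one_le_div hδ]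
      exact hψδ _ (by simpa [dist_eq_norm] using hy)
    calc ‖stft G f y ξ‖ₑ = 1 * ‖stft G f y ξ‖ₑ := (one_mul _).symm
      _ ≤ _ := mul_le_mul_left h3 _

/-- Young's inequality for the characteristic function of a set of finite measure. -/
theorem eLpNorm_setLIntegral_translate_rpow_le {q : ℝ≥0∞} {s : ℝ} (hs : 0 < s)
    (hsq : ENNReal.ofReal s ≤ q) {B : Set 𝔼} (hB : MeasurableSet B) {b : 𝔼 → ℝ≥0∞}
    (hb : Measurable b) :
    eLpNorm (fun ξ => (∫⁻ ζ in B, b (ξ + ζ) ^ s) ^ (1 / s)) q volume ≤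
      volume B ^ (1 / s) * eLpNorm b q volume := by
  have hs' : ENNReal.ofReal s ≠ 0 := by simpa using hs
  have h1 := eLpNorm_enorm_rpow (p := q) (μ := volume)
    (fun ξ => ∫⁻ ζ in B, b (ξ + ζ) ^ s) (one_div_pos.2 hs)
  simp only [enorm_eq_self] at h1
  have h2 := eLpNorm_enorm_rpow (p := q * ENNReal.ofReal (1 / s)) (μ := volume) b hs
  simp only [enorm_eq_self] at h2
  rw [mul_assoc, ← ENNReal.ofReal_mul (by positivity), one_div_mul_cancel hs.ne',
    ENNReal.ofReal_one, mul_one] at h2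
  have h3 := eLpNorm_lintegral_mul_translate_le (p := q * ENNReal.ofReal (1 / s))
    (k := B.indicator 1) (u := fun ζ => b ζ ^ s) (by
      rw [one_div, ENNReal.ofReal_inv_of_pos hs, ← div_eq_mul_inv,
        ENNReal.le_div_iff_mul_le (Or.inl hs') (Or.inl ENNReal.ofReal_ne_top), one_mul]
      exact hsq) (measurable_one.indicator hB) (hb.pow_const s)
  rw [h2, lintegral_indicator_one hB] at h3
  have h4 : ∀ ξ, ∫⁻ t, B.indicator 1 t * b (ξ + t) ^ s = ∫⁻ ζ in B, b (ξ + ζ) ^ s := fun ξ => by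
    rw [← lintegral_indicator hB]
    refine lintegral_congr fun ζ => ?_
    by_cases hζ : ζ ∈ B
    · simp [Set.indicator_of_mem hζ]
    · simp [Set.indicator_of_notMem hζ]
  simp_rw [h4] at h3
  rw [h1]
  refine (ENNReal.rpow_le_rpow h3 (by positivity)).trans_eq ?_
  rw [ENNReal.mul_rpow_of_nonneg _ _ (by positivity), ← ENNReal.rpow_mul,
    mul_one_div_cancel hs.ne', ENNReal.rpow_one]

/-- If the supports of `𝓕 G` and `𝓕 ψ(· + ζ)` are disjoint for `ζ ∉ B`, the modulation norm with
window `G` is controlled by `‖G‖₁ |B|^{1 - ρ}`, where `ρ = min (1/p, 1/p', 1/q')`. The exponent used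
in the frequency variable is `s = 1 / (1 - ρ) ≤ min (p, q)`. -/
theorem exists_modNorm_le_of_disjoint_bands {p q : ℝ≥0∞} (hp : 1 ≤ p) (hq : 1 ≤ q) {ρ : ℝ}
    (hρ : ρ = min (min (recip p) (1 - recip p)) (1 - recip q)) {ψ : 𝓢(𝔼, ℂ)} (hψ : ψ 0 ≠ 0) :
    ∃ C : ℝ, 0 < C ∧ ∀ (G : 𝓢(𝔼, ℂ)) (B : Set 𝔼), MeasurableSet B → Bornology.IsBounded B →
      (∀ ζ ∉ B, ∀ ω, 𝓕 G ω * 𝓕 ψ (ω + ζ) = 0) → ∀ f : 𝓢'(𝔼, ℂ),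
        modNorm G p q f ≤
          ENNReal.ofReal C * (∫⁻ s, ‖G s‖ₑ) * volume B ^ (1 - ρ) * modNorm ψ p q f := by
  have hp0 := recip_nonneg p
  have hp1 := recip_le_one hp
  have hq0 := recip_nonneg q
  have hq1 := recip_le_one hq
  have hρp : ρ ≤ recip p := by rw [hρ]; simp
  have hρp' : ρ ≤ 1 - recip p := by rw [hρ]; simp
  have hρq : ρ ≤ 1 - recip q := by rw [hρ]; simp
  have hρ0 : 0 ≤ ρ := by
    rw [hρ]
    exact le_min (le_min hp0 (by linarith)) (by linarith)
  have h1ρ : 0 < 1 - ρ := by linarith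
  set s := 1 / (1 - ρ) with hs
  have hs0 : 0 < s := by positivity
  have hss : 1 / s = 1 - ρ := one_div_one_div _
  have key : ∃ C : ℝ, 0 < C ∧ ∀ (G : 𝓢(𝔼, ℂ)) (B : Set 𝔼), MeasurableSet B →
      Bornology.IsBounded B → (∀ ζ ∉ B, ∀ ω, 𝓕 G ω * 𝓕 ψ (ω + ζ) = 0) →
      ∀ (f : 𝓢'(𝔼, ℂ)) (ξ : 𝔼), sliceNorm G p f ξ ≤ ENNReal.ofReal C * (∫⁻ s, ‖G s‖ₑ) *
          (∫⁻ ζ in B, sliceNorm ψ p f (ξ + ζ) ^ s) ^ (1 / s) := by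
    rcases hρ0.eq_or_lt with h0 | h0
    · have : s = 1 := by rw [hs, ← h0]; norm_num
      simp only [this, ENNReal.rpow_one, div_one]
      exact exists_sliceNorm_le_lintegral hp hψ
    · have hpt : p ≠ ∞ := ne_top_of_recip_pos (by linarith)
      have hP0 : 0 < p.toReal := ENNReal.toReal_pos (zero_lt_one.trans_le hp).ne' hpt
      rw [recip_eq_one_div] at hρp hρp'
      refine exists_sliceNorm_le_rpow (r := 1 / ρ) hp hpt ?_ ?_ ?_ ?_ ?_ hψ
      · rw [hs, one_lt_div h1ρ]; linarith
      · rw [hs, div_le_iff₀ h1ρ]; linarith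
      · have h1 : s - 1 = ρ / (1 - ρ) := by rw [hs]; field_simp; ring
        rw [h1, hs]
        field_simp
      · rw [hs, one_div_le h1ρ hP0]; linarith
      · rw [le_one_div hP0 h0]; exact hρp
  obtain ⟨C, hC, hkey⟩ := key
  refine ⟨C, hC, fun G B hBm hB h f => ?_⟩
  rw [modNorm_eq, modNorm_eq, mul_assoc (_ * _), ← hss]
  refine le_trans (eLpNorm_le_mul_of_le (n := sliceNorm G p f)
    (b := fun ξ => (∫⁻ ζ in B, sliceNorm ψ p f (ξ + ζ) ^ s) ^ (1 / s))
    (ENNReal.mul_ne_top ENNReal.ofReal_ne_top (lintegral_enorm_ne_top G))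
    (fun ξ => by simpa only [enorm_eq_self] using hkey G B hBm hB h f ξ) q) ?_
  refine mul_le_mul_right (eLpNorm_setLIntegral_translate_rpow_le hs0 ?_ hBm
    (measurable_sliceNorm ψ p f)) _
  rcases eq_or_ne q ∞ with rfl | hqt
  · exact le_top
  · rw [ENNReal.ofReal_le_iff_le_toReal hqt, hs, one_div_le h1ρ
      (ENNReal.toReal_pos (zero_lt_one.trans_le hq).ne' hqt), ← recip_eq_one_div]
    linarith

/-! ### Change of window -/

/-- The Schwartz function `g · w(· - t)`. -/
def mulTranslate (g w : 𝓢(𝔼, ℂ)) (t : 𝔼) : 𝓢(𝔼, ℂ) :=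
  SchwartzMap.pairing (ContinuousLinearMap.mul ℂ ℂ) g (w.compSubConstCLM ℂ t)

theorem mulTranslate_apply (g w : 𝓢(𝔼, ℂ)) (t y : 𝔼) :
    mulTranslate g w t y = g y * w (y - t) := rfl

/-- The seminorms of the products `g · w(· - t)` decay faster than any power of `t`. -/
theorem exists_seminorm_mulTranslate_le (g w : 𝓢(𝔼, ℂ)) (k l M : ℕ) :
    ∃ C : ℝ, 0 ≤ C ∧ ∀ t,
      (1 + ‖t‖) ^ M * SchwartzMap.seminorm ℂ k l (mulTranslate g w t) ≤ C := by
  set S₁ : ℝ := 2 ^ (k + M) *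
    (Finset.Iic (k + M, l)).sup (fun m => SchwartzMap.seminorm ℂ m.1 m.2) g with hS₁
  set S₂ : ℝ := 2 ^ M * (Finset.Iic (M, l)).sup (fun m => SchwartzMap.seminorm ℂ m.1 m.2) w with hS₂
  have hS₁0 : 0 ≤ S₁ := mul_nonneg (by positivity) (apply_nonneg _ _)
  have hS₂0 : 0 ≤ S₂ := mul_nonneg (by positivity) (apply_nonneg _ _)
  have h₁ : ∀ i ≤ l, ∀ x, (1 + ‖x‖) ^ (k + M) * ‖iteratedFDeriv ℝ i g x‖ ≤ S₁ := fun i hi x =>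
    SchwartzMap.one_add_le_sup_seminorm_apply (𝕜 := ℂ) (m := (k + M, l)) le_rfl hi g x
  have h₂ : ∀ i ≤ l, ∀ x, (1 + ‖x‖) ^ M * ‖iteratedFDeriv ℝ i w x‖ ≤ S₂ := fun i hi x =>
    SchwartzMap.one_add_le_sup_seminorm_apply (𝕜 := ℂ) (m := (M, l)) le_rfl hi w x
  set C : ℝ := ∑ i ∈ Finset.range (l + 1), (l.choose i : ℝ) * (S₁ * S₂) with hC
  have hC0 : 0 ≤ C := Finset.sum_nonneg fun i _ => by positivity
  refine ⟨C, hC0, fun t => ?_⟩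
  have hpos : 0 < (1 + ‖t‖) ^ M := by positivity
  rw [← le_div_iff₀' hpos]
  refine SchwartzMap.seminorm_le_bound ℂ k l _ (by positivity) fun x => ?_
  rw [le_div_iff₀' hpos]
  have h := norm_iteratedFDeriv_mul_le (g.smooth l) ((w.compSubConstCLM ℂ t).smooth l) x le_rfl
  have hw : ∀ i, iteratedFDeriv ℝ i (w.compSubConstCLM ℂ t) x = iteratedFDeriv ℝ i w (x - t) :=
    fun i => iteratedFDeriv_comp_sub i t x
  have ht : (1 + ‖t‖) ^ M ≤ (1 + ‖x‖) ^ M * (1 + ‖x - t‖) ^ M := by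
    rw [← mul_pow]
    refine pow_le_pow_left₀ (by positivity) ?_ M
    have := norm_sub_le x (x - t)
    rw [sub_sub_cancel] at this
    nlinarith [norm_nonneg x, norm_nonneg (x - t), mul_nonneg (norm_nonneg x) (norm_nonneg (x - t))]
  have hx : ‖x‖ ^ k ≤ (1 + ‖x‖) ^ k := pow_le_pow_left₀ (norm_nonneg x) (by linarith) k
  calc (1 + ‖t‖) ^ M * (‖x‖ ^ k * ‖iteratedFDeriv ℝ l (mulTranslate g w t) x‖)
      ≤ ((1 + ‖x‖) ^ M * (1 + ‖x - t‖) ^ M) * ((1 + ‖x‖) ^ k *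
        ∑ i ∈ Finset.range (l + 1), (l.choose i : ℝ) * ‖iteratedFDeriv ℝ i g x‖ *
          ‖iteratedFDeriv ℝ (l - i) (w.compSubConstCLM ℂ t) x‖) := by
        gcongr
        exact h
    _ = ∑ i ∈ Finset.range (l + 1), (l.choose i : ℝ) *
          (((1 + ‖x‖) ^ (k + M) * ‖iteratedFDeriv ℝ i g x‖) *
          ((1 + ‖x - t‖) ^ M * ‖iteratedFDeriv ℝ (l - i) w (x - t)‖)) := by
        rw [Finset.mul_sum, Finset.mul_sum]
        refine Finset.sum_congr rfl fun i _ => ?_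
        rw [hw]
        ring
    _ ≤ C := by
        refine Finset.sum_le_sum fun i hi => ?_
        have hi' : i ≤ l := by simpa [Nat.lt_succ_iff] using hi
        gcongr
        · exact h₁ i hi' x
        · exact h₂ (l - i) (Nat.sub_le l i) (x - t)

/-- The coefficients `(t, η) ↦ ∫ e^{2πi η·y} g(y) w(y - t) dy` of the expansion of `g` in
time-frequency shifts of another window. -/
def shiftCoeff (g w : 𝓢(𝔼, ℂ)) (z : 𝔼 × 𝔼) : ℂ := 𝓕 (mulTranslate g w z.1) (-z.2)

theorem continuous_shiftCoeff (g w : 𝓢(𝔼, ℂ)) : Continuous (shiftCoeff g w) := by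
  -- the coefficients are values of the short-time Fourier transform of `g` with window `w`
  have h : shiftCoeff g w = fun z : 𝔼 × 𝔼 =>
      stft w (SchwartzMap.toTemperedDistributionCLM 𝔼 ℂ volume g) z.1 (-z.2) := by
    ext z
    rw [shiftCoeff, stft, SchwartzMap.fourier_coe, fourier_eq_conjChar]
    simp only [SchwartzMap.toTemperedDistributionCLM_apply_apply]
    refine integral_congr_ae (.of_forall fun y => ?_)
    simp only [mulTranslate_apply, shiftedWindow_apply, smul_eq_mul]
    ring
  rw [h]
  exact (continuous_stft w _).comp (f := fun z : 𝔼 × 𝔼 => (z.1, -z.2)) (by fun_prop)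

theorem exists_shiftCoeff_le (g w : 𝓢(𝔼, ℂ)) (M N : ℕ) :
    ∃ C : ℝ, 0 ≤ C ∧ ∀ z, (1 + ‖z.1‖) ^ M * (1 + ‖z.2‖) ^ N * ‖shiftCoeff g w z‖ ≤ C := by
  have key : ∀ k, ∃ C : ℝ, 0 ≤ C ∧ ∀ t, (1 + ‖t‖) ^ M *
      SchwartzMap.seminorm ℂ k 0 (FourierTransform.fourierCLM ℂ 𝓢(𝔼, ℂ) (mulTranslate g w t)) ≤
        C := fun k => by
    obtain ⟨s, C, hC, h⟩ := exists_seminorm_clm_le (FourierTransform.fourierCLM ℂ 𝓢(𝔼, ℂ)) k 0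
    choose C' hC' h' using fun i : ℕ × ℕ => exists_seminorm_mulTranslate_le g w i.1 i.2 M
    refine ⟨C * ∑ i ∈ s, C' i, mul_nonneg hC (Finset.sum_nonneg fun i _ => hC' i), fun t => ?_⟩
    refine (mul_le_mul_of_nonneg_left (h _) (by positivity)).trans ?_
    rw [mul_left_comm, Finset.mul_sum]
    exact mul_le_mul_of_nonneg_left (Finset.sum_le_sum fun i _ => h' i t) hC
  obtain ⟨C₀, hC₀, h₀⟩ := key 0
  obtain ⟨C₁, hC₁, h₁⟩ := key N
  refine ⟨2 ^ N * (C₀ + C₁), by positivity, fun z => ?_⟩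
  have a₀ := SchwartzMap.le_seminorm ℂ 0 0
    (FourierTransform.fourierCLM ℂ 𝓢(𝔼, ℂ) (mulTranslate g w z.1)) (-z.2)
  have a₁ := SchwartzMap.le_seminorm ℂ N 0
    (FourierTransform.fourierCLM ℂ 𝓢(𝔼, ℂ) (mulTranslate g w z.1)) (-z.2)
  rw [norm_iteratedFDeriv_zero, norm_neg] at a₀ a₁
  rw [pow_zero, one_mul] at a₀
  have hp : (1 + ‖z.2‖) ^ N ≤ 2 ^ N * (1 + ‖z.2‖ ^ N) := by
    have h := add_pow_le (zero_le_one (α := ℝ)) (norm_nonneg z.2) N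
    rw [one_pow] at h
    refine h.trans ?_
    gcongr
    · norm_num
    · omega
  have e : ‖shiftCoeff g w z‖ =
      ‖FourierTransform.fourierCLM ℂ 𝓢(𝔼, ℂ) (mulTranslate g w z.1) (-z.2)‖ := rfl
  rw [e]
  set F := ‖FourierTransform.fourierCLM ℂ 𝓢(𝔼, ℂ) (mulTranslate g w z.1) (-z.2)‖
  calc (1 + ‖z.1‖) ^ M * (1 + ‖z.2‖) ^ N * F
      ≤ (1 + ‖z.1‖) ^ M * (2 ^ N * (1 + ‖z.2‖ ^ N)) * F := by gcongr
    _ = 2 ^ N * ((1 + ‖z.1‖) ^ M * F + (1 + ‖z.1‖) ^ M * (‖z.2‖ ^ N * F)) := by ring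
    _ ≤ 2 ^ N * (C₀ + C₁) := by
        gcongr
        · exact (mul_le_mul_of_nonneg_left a₀ (by positivity)).trans (h₀ _)
        · exact (mul_le_mul_of_nonneg_left a₁ (by positivity)).trans (h₁ _)

theorem integrable_phaseWeight_mul_shiftCoeff (g w : 𝓢(𝔼, ℂ)) (n : ℕ) :
    Integrable fun z : 𝔼 × 𝔼 => phaseWeight z ^ n * ‖shiftCoeff g w z‖ := by
  obtain ⟨C, hC, h⟩ := exists_shiftCoeff_le g w (n + (d + 1)) (n + (d + 1))
  have h1 : Integrable fun x : 𝔼 => (1 + ‖x‖) ^ (-(d + 1 : ℝ)) :=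
    integrable_one_add_norm (by simp)
  refine ((h1.mul_prod h1).const_mul C).mono' ?_ (.of_forall fun z => ?_)
  · have : Continuous (phaseWeight (d := d)) := by
      unfold phaseWeight
      fun_prop
    exact ((this.pow n).mul (continuous_shiftCoeff g w).norm).aestronglyMeasurable
  · have e : ∀ x : 𝔼, (1 + ‖x‖) ^ (-(d + 1 : ℝ)) = ((1 + ‖x‖) ^ (d + 1))⁻¹ := fun x => by
      rw [Real.rpow_neg (by positivity), ← Nat.cast_add_one, Real.rpow_natCast]
    have hpw : phaseWeight z ^ n = (1 + ‖z.1‖) ^ n * (1 + ‖z.2‖) ^ n := mul_pow _ _ _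
    rw [Real.norm_of_nonneg (mul_nonneg (pow_nonneg (zero_le_one.trans (one_le_phaseWeight z)) n)
      (norm_nonneg _)), e, e, hpw, ← mul_inv, ← div_eq_mul_inv, le_div_iff₀ (by positivity)]
    refine le_trans (le_of_eq ?_) (h z)
    ring

theorem integrable_seminorm_shiftCoeff_smul (g w χ : 𝓢(𝔼, ℂ)) (k l : ℕ) :
    Integrable fun z : 𝔼 × 𝔼 =>
      SchwartzMap.seminorm ℂ k l (shiftCoeff g w z • shiftedWindow χ z.1 z.2) := by
  obtain ⟨C, hC, N, hN⟩ := polyBounded_shiftedWindow χ k l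
  refine ((integrable_phaseWeight_mul_shiftCoeff g w N).const_mul C).mono' ?_
    (.of_forall fun z => ?_)
  · exact ((continuous_seminorm k l).comp
      ((continuous_shiftCoeff g w).smul (continuous_shiftedWindow χ))).aestronglyMeasurable
  · have h := hN z
    beta_reduce at h
    rw [Real.norm_of_nonneg (apply_nonneg _ _), map_smul_eq_mul]
    refine (mul_le_mul_of_nonneg_left h (norm_nonneg _)).trans_eq (by ring)

/-- The window `g` is a superposition of time-frequency shifts of `χ`, up to the factor `∫ w χ`, by
Fourier inversion of the products `g · w(· - t)`. -/
theorem mul_eq_integral_shiftCoeff (g w χ : 𝓢(𝔼, ℂ)) (y : 𝔼) :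
    (∫ t, w t * χ t) * g y = ∫ z : 𝔼 × 𝔼, shiftCoeff g w z * shiftedWindow χ z.1 z.2 y := by
  have hi : Integrable fun z : 𝔼 × 𝔼 => shiftCoeff g w z * shiftedWindow χ z.1 z.2 y := by
    refine (integrable_seminorm_shiftCoeff_smul g w χ 0 0).mono' ?_ (.of_forall fun z => ?_)
    · refine ((continuous_shiftCoeff g w).mul ?_).aestronglyMeasurable
      simp only [shiftedWindow_apply]
      have h1 : Continuous fun z : 𝔼 × 𝔼 => conjChar z.2 y :=
        continuous_conjChar.comp (f := fun z : 𝔼 × 𝔼 => (z.2, y)) (by fun_prop)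
      have h2 := χ.continuous
      fun_prop
    · have := SchwartzMap.norm_le_seminorm ℂ (shiftCoeff g w z • shiftedWindow χ z.1 z.2) y
      rwa [smul_apply, smul_eq_mul] at this
  have hi' : Integrable (fun z : 𝔼 × 𝔼 => shiftCoeff g w z * shiftedWindow χ z.1 z.2 y)
      (volume.prod volume) := hi
  rw [Measure.volume_eq_prod, integral_prod _ hi', ← integral_sub_left_eq_self _ _ y,
    ← integral_mul_const]
  refine integral_congr_ae (.of_forall fun t => ?_)
  beta_reduce
  have h1 : 𝓕⁻ (𝓕 (mulTranslate g w t)) = mulTranslate g w t :=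
    FourierTransform.fourierInv_fourier_eq _
  have h2 := congrArg (fun φ : 𝓢(𝔼, ℂ) => φ y) h1
  beta_reduce at h2
  rw [SchwartzMap.fourierInv_coe, fourierInv_eq_conjChar, mulTranslate_apply,
    ← integral_neg_eq_self] at h2
  have h3 : ∀ η, shiftCoeff g w (t, η) * shiftedWindow χ t η y =
      (conjChar (-y) (-η) * 𝓕 (mulTranslate g w t) (-η)) * χ (y - t) := fun η => by
    rw [shiftCoeff, shiftedWindow_apply, conjChar_comm (-y)]
    have : conjChar (-η) (-y) = conjChar η y := by simp [conjChar]
    rw [this]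
    ring
  simp_rw [h3]
  rw [integral_mul_const, h2]
  ring

theorem exists_integral_mul_ne_zero {χ : 𝓢(𝔼, ℂ)} (hχ : χ ≠ 0) :
    ∃ w : 𝓢(𝔼, ℂ), ∫ t, w t * χ t ≠ 0 := by
  by_contra! h
  refine hχ ?_
  have h1 := ae_eq_zero_of_integral_contDiff_smul_eq_zero (μ := (volume : Measure 𝔼))
    χ.integrable.locallyIntegrable fun φ hφ hφc => ?_
  · have h2 := (Continuous.ae_eq_iff_eq volume χ.continuous continuous_zero).1 h1
    ext x
    exact congrFun h2 x
  · have hg₁ : HasCompactSupport (Complex.ofRealCLM ∘ φ) := hφc.comp_left rfl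
    have hg₂ : ContDiff ℝ ((⊤ : ℕ∞) : WithTop ℕ∞) (Complex.ofRealCLM ∘ φ) := by fun_prop
    rw [← h (hg₁.toSchwartzMap hg₂)]
    refine integral_congr_ae (.of_forall fun x => ?_)
    simp only [Complex.real_smul]
    rfl

/-- The expansion of `g` in time-frequency shifts of `χ` turns `V_g f` into a superposition of
translates of `V_χ f`. -/
theorem stft_mul_eq_integral_shiftCoeff (g w χ : 𝓢(𝔼, ℂ)) (f : 𝓢'(𝔼, ℂ)) (x ξ : 𝔼) :
    (∫ t, w t * χ t) * stft g f x ξ = ∫ z : 𝔼 × 𝔼, shiftCoeff g w z *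
      (conjChar (-z.2) x * stft χ f (z.1 + x) (ξ + z.2)) := by
  -- the expansion of `g` is applied to the distribution `f ∘ T`, `T` being the shift by `(x, ξ)`
  let T : 𝓢(𝔼, ℂ) →L[ℂ] 𝓢(𝔼, ℂ) := (SchwartzMap.smulLeftCLM ℂ (conjChar ξ)).comp
    (SchwartzMap.compSubConstCLM ℂ x)
  have hT : ∀ φ, T φ = shiftedWindow φ x ξ := fun φ => rfl
  have h := apply_eq_integral (μ := (volume : Measure (𝔼 × 𝔼)))
    (PointwiseConvergenceCLM.precomp ℂ T f)
    (Φ := fun z : 𝔼 × 𝔼 => shiftCoeff g w z • shiftedWindow χ z.1 z.2)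
    (Ψ := (∫ t, w t * χ t) • g)
    ((continuous_shiftCoeff g w).smul (continuous_shiftedWindow χ))
    (integrable_seminorm_shiftCoeff_smul g w χ) fun y => by
      simp only [smul_apply, smul_eq_mul]
      exact mul_eq_integral_shiftCoeff g w χ y
  have h' : ∀ φ, PointwiseConvergenceCLM.precomp ℂ T f φ = f (T φ) := fun φ => rfl
  simp only [h', map_smul, smul_eq_mul] at h
  simp only [hT] at h
  rw [stft, h]
  refine integral_congr_ae (.of_forall fun z => ?_)
  beta_reduce
  rw [shiftedWindow_shiftedWindow, map_smul, smul_eq_mul, stft]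

/-- Any two windows define comparable modulation norms. -/
theorem exists_modNorm_le_modNorm {p q : ℝ≥0∞} (hp : 1 ≤ p) (hq : 1 ≤ q) (g : 𝓢(𝔼, ℂ))
    {χ : 𝓢(𝔼, ℂ)} (hχ : χ ≠ 0) :
    ∃ C : ℝ, 0 < C ∧ ∀ f : 𝓢'(𝔼, ℂ), modNorm g p q f ≤ ENNReal.ofReal C * modNorm χ p q f := by
  obtain ⟨w, hw⟩ := exists_integral_mul_ne_zero hχ
  set c := ∫ t, w t * χ t with hc
  have hKm : Measurable fun z => ‖shiftCoeff g w z‖ₑ := (continuous_shiftCoeff g w).measurable.enorm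
  have hK : ∫⁻ z, ‖shiftCoeff g w z‖ₑ ≠ ∞ := by
    have h := integrable_phaseWeight_mul_shiftCoeff g w 0
    simp only [pow_zero, one_mul] at h
    have := h.2.ne
    simpa only [enorm_norm] using this
  have hc0 : 0 < ‖c‖⁻¹ := inv_pos.2 (norm_pos_iff.2 hw)
  have hK1 : Measurable fun η => ∫⁻ t, ‖shiftCoeff g w (t, η)‖ₑ := hKm.lintegral_prod_left'
  have hslice : ∀ f ξ, sliceNorm g p f ξ ≤ ENNReal.ofReal ‖c‖⁻¹ *
      ‖∫⁻ η, (∫⁻ t, ‖shiftCoeff g w (t, η)‖ₑ) * sliceNorm χ p f (ξ + η)‖ₑ := fun f ξ => by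
    have hpt : ∀ x, ‖stft g f x ξ‖ₑ ≤ ENNReal.ofReal ‖c‖⁻¹ *
        ‖∫⁻ z : 𝔼 × 𝔼, ‖shiftCoeff g w z‖ₑ * ‖stft χ f (z.1 + x) (ξ + z.2)‖ₑ‖ₑ := fun x => by
      have h1 := congrArg (fun a : ℂ => ‖a‖ₑ) (stft_mul_eq_integral_shiftCoeff g w χ f x ξ)
      beta_reduce at h1
      rw [enorm_mul, ← hc] at h1
      rw [enorm_eq_self, ENNReal.ofReal_inv_of_pos (norm_pos_iff.2 hw), ofReal_norm,
        ← ENNReal.div_eq_inv_mul, ENNReal.le_div_iff_mul_le (by simp [hw]) (by simp), mul_comm, h1]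
      refine (enorm_integral_le_lintegral_enorm _).trans_eq (lintegral_congr fun z => ?_)
      rw [enorm_mul, enorm_mul, ← ofReal_norm (conjChar _ _), norm_conjChar]
      simp
    refine (eLpNorm_le_mul_of_le ENNReal.ofReal_ne_top hpt p).trans (mul_le_mul_right ?_ _)
    have hF : Continuous fun y : 𝔼 × 𝔼 × 𝔼 => stft χ f (y.2.1 + y.1) (ξ + y.2.2) :=
      (continuous_stft χ f).comp (f := fun y : 𝔼 × 𝔼 × 𝔼 => (y.2.1 + y.1, ξ + y.2.2)) (by fun_prop)
    have hF' : Measurable (Function.uncurry fun (x : 𝔼) (z : 𝔼 × 𝔼) =>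
        ‖shiftCoeff g w z‖ₑ * ‖stft χ f (z.1 + x) (ξ + z.2)‖ₑ) :=
      (hKm.comp measurable_snd).mul hF.measurable.enorm
    have h2 := eLpNorm_lintegral_le (μ := volume) (ν := volume) hp hF'
      (B := fun z => ‖shiftCoeff g w z‖ₑ * sliceNorm χ p f (ξ + z.2)) (fun _ z => ?_) ?_
    · refine h2.trans_eq ?_
      rw [enorm_eq_self, Measure.volume_eq_prod, lintegral_prod_symm]
      · refine lintegral_congr fun η => ?_
        exact lintegral_mul_const (sliceNorm χ p f (ξ + η))
          (hKm.comp (measurable_id.prodMk measurable_const))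
      · exact (hKm.mul ((measurable_sliceNorm χ p f).comp
          (measurable_const.add measurable_snd))).aemeasurable
    · refine (eLpNorm_le_mul_of_le (b := fun x => stft χ f (z.1 + x) (ξ + z.2)) enorm_ne_top
        (fun x => le_rfl) p).trans_eq ?_
      have h3 := eLpNorm_comp_measurePreserving (p := p)
        (continuous_stft_left χ f (ξ + z.2)).aestronglyMeasurable
        (measurePreserving_add_left (volume : Measure 𝔼) z.1)
      rw [sliceNorm, ← h3]
      rfl
    · rintro rfl x z
      refine mul_le_mul_right ?_ _
      rw [sliceNorm, eLpNorm_exponent_top]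
      exact enorm_le_eLpNormEssSup (continuous_stft_left χ f (ξ + z.2)) (z.1 + x)
  have hK2 : ∫⁻ η, ∫⁻ t, ‖shiftCoeff g w (t, η)‖ₑ = ∫⁻ z, ‖shiftCoeff g w z‖ₑ := by
    rw [Measure.volume_eq_prod, lintegral_prod_symm _ hKm.aemeasurable]
  refine ⟨‖c‖⁻¹ * ((∫⁻ z, ‖shiftCoeff g w z‖ₑ).toReal + 1), by positivity, fun f => ?_⟩
  rw [modNorm_eq, modNorm_eq]
  refine (eLpNorm_le_mul_of_le ENNReal.ofReal_ne_top (hslice f) q).trans ?_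
  rw [ENNReal.ofReal_mul hc0.le, mul_assoc]
  refine mul_le_mul_right ((eLpNorm_lintegral_mul_translate_le hq hK1
    (measurable_sliceNorm χ p f)).trans (mul_le_mul_left ?_ _)) _
  rw [hK2, ENNReal.ofReal_add ENNReal.toReal_nonneg zero_le_one, ENNReal.ofReal_toReal hK]
  exact le_self_add

/-! ### Dilations and windows -/

/-- The transpose of an invertible matrix. -/
def transposeGL (A : GL (Fin d) ℝ) : GL (Fin d) ℝ where
  val := (A : Matrix (Fin d) (Fin d) ℝ).transpose
  inv := ((A⁻¹ : GL (Fin d) ℝ) : Matrix (Fin d) (Fin d) ℝ).transpose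
  val_inv := by rw [← Matrix.transpose_mul, Units.inv_mul, Matrix.transpose_one]
  inv_val := by rw [← Matrix.transpose_mul, Units.mul_inv, Matrix.transpose_one]

/-- The absolute value of the determinant. -/
def absDet (A : GL (Fin d) ℝ) : ℝ := |(A : Matrix (Fin d) (Fin d) ℝ).det|

theorem absDet_pos (A : GL (Fin d) ℝ) : 0 < absDet A :=
  abs_pos.2 (Matrix.GeneralLinearGroup.det A).ne_zero

theorem absDet_mul (A B : GL (Fin d) ℝ) : absDet (A * B) = absDet A * absDet B := by
  simp [absDet, abs_mul]

theorem absDet_transposeGL (A : GL (Fin d) ℝ) : absDet (transposeGL A) = absDet A := by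
  simp [absDet, transposeGL, Matrix.det_transpose]

theorem abs_det_matrixEquiv (A : GL (Fin d) ℝ) :
    |LinearMap.det (matrixEquiv A : 𝔼 →ₗ[ℝ] 𝔼)| = absDet A := by
  have : (matrixEquiv A : 𝔼 →ₗ[ℝ] 𝔼) =
      Matrix.toEuclideanLin (A : Matrix (Fin d) (Fin d) ℝ) := rfl
  rw [this, Matrix.toEuclideanLin_eq_toLin_orthonormal, LinearMap.det_toLin, absDet]

theorem abs_det_matrixEquiv_symm (A : GL (Fin d) ℝ) :
    |LinearMap.det ((matrixEquiv A).symm : 𝔼 →ₗ[ℝ] 𝔼)| = (absDet A)⁻¹ := by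
  rw [← abs_det_matrixEquiv, ← abs_inv]
  congr 1
  refine eq_inv_of_mul_eq_one_left ?_
  exact (matrixEquiv A).toLinearEquiv.det_symm_mul_det

theorem inner_transposeGL (A : GL (Fin d) ℝ) (ω x : 𝔼) :
    inner ℝ (matrixEquiv (transposeGL A) ω) x = inner ℝ ω (matrixEquiv A x) := by
  rw [matrixEquiv_apply, matrixEquiv_apply, EuclideanSpace.inner_eq_star_dotProduct,
    EuclideanSpace.inner_eq_star_dotProduct]
  simp only [star_trivial, transposeGL]
  rw [Matrix.mulVec_transpose, dotProduct_comm, ← Matrix.dotProduct_mulVec, dotProduct_comm]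

theorem conjChar_matrixEquiv (A : GL (Fin d) ℝ) (ω x : 𝔼) :
    conjChar ω (matrixEquiv A x) = conjChar (matrixEquiv (transposeGL A) ω) x := by
  rw [conjChar, conjChar, inner_transposeGL]

/-- The window `g ∘ A⁻¹`. -/
def dilWindow (A : GL (Fin d) ℝ) (g : 𝓢(𝔼, ℂ)) : 𝓢(𝔼, ℂ) :=
  SchwartzMap.compCLMOfContinuousLinearEquiv ℂ (matrixEquiv A).symm g

theorem dilWindow_apply (A : GL (Fin d) ℝ) (g : 𝓢(𝔼, ℂ)) (x : 𝔼) :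
    dilWindow A g x = g ((matrixEquiv A).symm x) := rfl

theorem matrixEquiv_mul_apply (A B : GL (Fin d) ℝ) (x : 𝔼) :
    matrixEquiv (A * B) x = matrixEquiv A (matrixEquiv B x) := by
  simp [matrixEquiv_apply]

theorem dilation_mul (A B : GL (Fin d) ℝ) (f : 𝓢'(𝔼, ℂ)) :
    dilation (A * B) f = dilation B (dilation A f) := by
  ext φ
  rw [dilation_apply, dilation_apply, dilation_apply, ← mul_assoc]
  congr 1
  · simp [abs_mul, mul_comm]
  · congr 1
    ext y
    change φ ((matrixEquiv (A * B)).symm y) = φ ((matrixEquiv B).symm ((matrixEquiv A).symm y))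
    congr 1
    rw [ContinuousLinearEquiv.symm_apply_eq]
    simp [matrixEquiv_mul_apply]

/-- A dilation of the distribution can be moved to the window. -/
theorem stft_dilation (A : GL (Fin d) ℝ) (g : 𝓢(𝔼, ℂ)) (f : 𝓢'(𝔼, ℂ)) (x ξ : 𝔼) :
    stft g (dilation A f) x ξ = (((absDet A)⁻¹ : ℝ) : ℂ) *
      stft (dilWindow A g) f (matrixEquiv A x) ((matrixEquiv (transposeGL A)).symm ξ) := by
  rw [stft, dilation_apply, stft, absDet]
  congr 2
  ext y
  rw [shiftedWindow_apply, dilWindow_apply, map_sub, ContinuousLinearEquiv.symm_apply_apply]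
  change shiftedWindow g x ξ ((matrixEquiv A).symm y) = _
  rw [shiftedWindow_apply]
  congr 1
  have h := conjChar_matrixEquiv A ((matrixEquiv (transposeGL A)).symm ξ) ((matrixEquiv A).symm y)
  simp only [ContinuousLinearEquiv.apply_symm_apply] at h
  exact h.symm

theorem eLpNorm_ennreal_const_mul {α : Type*} [MeasurableSpace α] {μ : Measure α} {c : ℝ≥0∞}
    (h0 : c ≠ 0) (ht : c ≠ ∞) (u : α → ℝ≥0∞) (p : ℝ≥0∞) :
    eLpNorm (fun x => c * u x) p μ = c * eLpNorm u p μ := by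
  refine le_antisymm (eLpNorm_le_mul_of_le ht (fun x => le_rfl) p) ?_
  rw [mul_comm, ← ENNReal.le_div_iff_mul_le (.inl h0) (.inl ht), div_eq_mul_inv, mul_comm]
  refine eLpNorm_le_mul_of_le (ENNReal.inv_ne_top.2 h0) (fun x => ?_) p
  simp only [enorm_eq_self]
  rw [← mul_assoc, ENNReal.inv_mul_cancel h0 ht, one_mul]

/-- The modulation norm of a dilated distribution is, up to a power of the determinant, the one of
the distribution computed with the dilated window. -/
theorem modNorm_dilation (A : GL (Fin d) ℝ) (g : 𝓢(𝔼, ℂ)) (p q : ℝ≥0∞) (f : 𝓢'(𝔼, ℂ)) :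
    modNorm g p q (dilation A f) =
      ENNReal.ofReal (absDet A ^ (-1 - recip p + recip q)) * modNorm (dilWindow A g) p q f := by
  have hA := absDet_pos A
  have h1 : ∀ ξ, sliceNorm g p (dilation A f) ξ = ENNReal.ofReal (absDet A ^ (-1 - recip p)) *
      sliceNorm (dilWindow A g) p f ((matrixEquiv (transposeGL A)).symm ξ) := fun ξ => by
    have h2 : (fun x => stft g (dilation A f) x ξ) = (((absDet A)⁻¹ : ℝ) : ℂ) • fun x =>
        stft (dilWindow A g) f (matrixEquiv A x) ((matrixEquiv (transposeGL A)).symm ξ) := by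
      ext x
      rw [stft_dilation]
      rfl
    rw [sliceNorm, h2, eLpNorm_const_smul, eLpNorm_comp_equiv (matrixEquiv A)
      (fun x => stft (dilWindow A g) f x ((matrixEquiv (transposeGL A)).symm ξ)),
      abs_det_matrixEquiv, ← mul_assoc, ← ofReal_norm, ← ENNReal.ofReal_mul (norm_nonneg _)]
    congr 2
    rw [Complex.norm_real, Real.norm_of_nonneg (by positivity), ← Real.rpow_neg_one,
      ← Real.rpow_add hA, sub_eq_add_neg]
  rw [modNorm_eq, modNorm_eq]
  have h3 : sliceNorm g p (dilation A f) = fun ξ => ENNReal.ofReal (absDet A ^ (-1 - recip p)) *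
      sliceNorm (dilWindow A g) p f ((matrixEquiv (transposeGL A)).symm ξ) := funext h1
  rw [h3, eLpNorm_ennreal_const_mul (by simp; positivity) ENNReal.ofReal_ne_top,
    eLpNorm_comp_equiv (matrixEquiv (transposeGL A)).symm (sliceNorm (dilWindow A g) p f),
    abs_det_matrixEquiv_symm, absDet_transposeGL, ← mul_assoc]
  congr 1
  rw [← ENNReal.ofReal_mul (by positivity), Real.inv_rpow hA.le, ← Real.rpow_neg hA.le, neg_neg,
    ← Real.rpow_add hA]

theorem lintegral_dilWindow (A : GL (Fin d) ℝ) (g : 𝓢(𝔼, ℂ)) (s : ℝ) :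
    ∫⁻ x, ‖dilWindow A g x‖ₑ ^ s = ENNReal.ofReal (absDet A) * ∫⁻ x, ‖g x‖ₑ ^ s := by
  have h := lintegral_comp_equiv (matrixEquiv A).symm fun x => ‖g x‖ₑ ^ s
  rw [abs_det_matrixEquiv_symm, inv_inv] at h
  exact h

theorem fourier_dilWindow (A : GL (Fin d) ℝ) (g : 𝓢(𝔼, ℂ)) (ω : 𝔼) :
    𝓕 (dilWindow A g) ω = (absDet A : ℂ) * 𝓕 g (matrixEquiv (transposeGL A) ω) := by
  rw [SchwartzMap.fourier_coe, SchwartzMap.fourier_coe, fourier_eq_conjChar, fourier_eq_conjChar]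
  have h := (matrixEquiv A).toHomeomorph.measurableEmbedding.integral_map (μ := volume)
    (fun x => conjChar ω x * dilWindow A g x)
  have hm := Measure.map_linearMap_addHaar_eq_smul_addHaar (volume : Measure 𝔼)
    (f := (matrixEquiv A : 𝔼 →ₗ[ℝ] 𝔼))
    (by rw [← abs_pos, abs_det_matrixEquiv]; exact absDet_pos A)
  rw [abs_inv, abs_det_matrixEquiv] at hm
  have hm' : Measure.map (matrixEquiv A).toHomeomorph (volume : Measure 𝔼) = _ := hm
  rw [hm', integral_smul_measure, ENNReal.toReal_ofReal (inv_nonneg.2 (absDet_pos A).le)] at h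
  have h2 : ∀ x, conjChar ω ((matrixEquiv A).toHomeomorph x) *
      dilWindow A g ((matrixEquiv A).toHomeomorph x) =
      conjChar (matrixEquiv (transposeGL A) ω) x * g x := fun x => by
    change conjChar ω (matrixEquiv A x) * dilWindow A g (matrixEquiv A x) = _
    rw [conjChar_matrixEquiv, dilWindow_apply, ContinuousLinearEquiv.symm_apply_apply]
  simp_rw [h2] at h
  rw [← h, Complex.real_smul, ← mul_assoc, ← Complex.ofReal_mul, mul_inv_cancel₀ (absDet_pos A).ne']
  simp

/-- Band-limited windows equal to `1` near the origin in frequency. -/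
theorem exists_bandlimited {R : ℝ} (hR : 0 < R) :
    ∃ χ : 𝓢(𝔼, ℂ), (∀ ω, ‖ω‖ ≤ R → 𝓕 χ ω = 1) ∧ (∀ ω, R + 1 < ‖ω‖ → 𝓕 χ ω = 0) ∧ χ 0 ≠ 0 := by
  let φ : ContDiffBump (0 : 𝔼) := ⟨R, R + 1, hR, by linarith⟩
  have hg₁ : HasCompactSupport (Complex.ofRealCLM ∘ φ) := φ.hasCompactSupport.comp_left rfl
  have hg₂ : ContDiff ℝ ((⊤ : ℕ∞) : WithTop ℕ∞) (Complex.ofRealCLM ∘ φ) :=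
    Complex.ofRealCLM.contDiff.comp φ.contDiff
  let Φ : 𝓢(𝔼, ℂ) := hg₁.toSchwartzMap hg₂
  have hΦ : ∀ x, Φ x = (φ x : ℂ) := fun x => rfl
  have hF : 𝓕 (𝓕⁻ Φ) = Φ := FourierTransform.fourier_fourierInv_eq _
  refine ⟨𝓕⁻ Φ, fun ω hω => ?_, fun ω hω => ?_, ?_⟩
  · rw [hF, hΦ, φ.one_of_mem_closedBall (by simpa using hω), Complex.ofReal_one]
  · rw [hF, hΦ, φ.zero_of_le_dist (by simpa using hω.le), Complex.ofReal_zero]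
  · rw [SchwartzMap.fourierInv_coe, fourierInv_eq_conjChar]
    simp only [neg_zero, conjChar_zero_left, one_mul, hΦ]
    rw [integral_complex_ofReal]
    exact_mod_cast φ.integral_pos.ne'

/-! ### Boundedness of dilations -/

/-- The exponent `μ₂` is the sum of `min (1/p, 1/p', 1/q')`, which comes from the dilated window,
and of the exponent of the changes of variables in `modNorm_dilation`. -/
theorem mu2_eq {p q : ℝ≥0∞} :
    mu2 p q = min (min (recip p) (1 - recip p)) (1 - recip q) + (-1 - recip p + recip q) := by
  obtain ⟨h1, h2, h3, h4⟩ := mu2_cases p q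
  simp only [max_le_iff] at h1 h2 h3 h4
  rcases h4 with h | h | h
  · rw [h1 h, min_eq_right (le_min (by linarith) (by linarith))]
    ring
  · rw [h2 h, min_eq_left, min_eq_left] <;> first | linarith | skip
    exact min_le_iff.2 (.inl (by linarith))
  · rw [h3 h, min_eq_left, min_eq_right] <;> first | linarith | skip
    exact min_le_iff.2 (.inr (by linarith))

/-- The exponent `μ₁` is the sum of `max (1/p, 1/p', 1/q')`, which comes from the dilated window,
and of the exponent of the changes of variables in `modNorm_dilation`. -/
theorem mu1_eq {p q : ℝ≥0∞} :
    mu1 p q = max (max (recip p) (1 - recip p)) (1 - recip q) + (-1 - recip p + recip q) := by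
  obtain ⟨h1, h2, h3, h4⟩ := mu1_cases p q
  simp only [le_min_iff] at h1 h2 h3 h4
  rcases h4 with h | h | h
  · rw [h1 h, max_eq_right (max_le (by linarith) (by linarith))]
    ring
  · rw [h2 h, max_eq_left, max_eq_left] <;> first | linarith | skip
    exact le_max_iff.2 (.inl (by linarith))
  · rw [h3 h, max_eq_left, max_eq_right] <;> first | linarith | skip
    exact le_max_iff.2 (.inr (by linarith))

/-- For a contracting `A`, the supports of `𝓕 (ψ ∘ A⁻¹)` and `𝓕 ψ(· + ζ)` meet only if
`‖Aᵀ ζ‖ ≤ 2 R`. These `ζ` form a set of measure `≲ |det A|⁻¹`, and `‖ψ ∘ A⁻¹‖₁ ≲ |det A|`. -/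
theorem exists_modNorm_dilWindow_le_of_contracting {p q : ℝ≥0∞} (hp : 1 ≤ p) (hq : 1 ≤ q) {ρ R : ℝ}
    (hρ : ρ = min (min (recip p) (1 - recip p)) (1 - recip q)) {ψ : 𝓢(𝔼, ℂ)} (hψ : ψ 0 ≠ 0)
    (hψR : ∀ ω, R < ‖ω‖ → 𝓕 ψ ω = 0) :
    ∃ C : ℝ, 0 < C ∧ ∀ A : GL (Fin d) ℝ, (∀ ω, ‖matrixEquiv (transposeGL A) ω‖ ≤ ‖ω‖) →
      ∀ f : 𝓢'(𝔼, ℂ), modNorm (dilWindow A ψ) p q f ≤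
        ENNReal.ofReal (C * absDet A ^ ρ) * modNorm ψ p q f := by
  obtain ⟨C, hC, h⟩ := exists_modNorm_le_of_disjoint_bands hp hq hρ hψ
  have h1ρ : 0 ≤ 1 - ρ := by
    have : ρ ≤ 1 - recip q := by rw [hρ]; simp
    linarith [recip_nonneg q]
  set I := ∫⁻ s, ‖ψ s‖ₑ with hI
  have hIt : I ≠ ∞ := lintegral_enorm_ne_top ψ
  set v := volume (Metric.closedBall (0 : 𝔼) (2 * R)) with hv
  have hvt : v ≠ ∞ := measure_closedBall_lt_top.ne
  refine ⟨C * (I.toReal * v.toReal ^ (1 - ρ) + 1), by positivity, fun A hA f => ?_⟩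
  set T := matrixEquiv (transposeGL A) with hT
  have hδ := absDet_pos A
  have hvol : volume (T ⁻¹' Metric.closedBall (0 : 𝔼) (2 * R)) =
      ENNReal.ofReal (absDet A)⁻¹ * v := by
    rw [Measure.addHaar_preimage_continuousLinearEquiv, hT, abs_det_matrixEquiv_symm,
      absDet_transposeGL]
  have h1 := h (dilWindow A ψ) (T ⁻¹' Metric.closedBall (0 : 𝔼) (2 * R))
    (T.continuous.measurable measurableSet_closedBall) ?_ ?_ f
  · refine h1.trans (mul_le_mul_left ?_ _)
    have h2 := lintegral_dilWindow A ψ 1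
    simp only [ENNReal.rpow_one] at h2
    have hi := (ENNReal.ofReal_toReal hIt).symm
    have hw := (ENNReal.ofReal_toReal hvt).symm
    set i := I.toReal
    set w := v.toReal
    have hi0 : 0 ≤ i := ENNReal.toReal_nonneg
    have hw0 : 0 ≤ w := ENNReal.toReal_nonneg
    rw [h2, hvol, ← hI, hi, hw, ← ENNReal.ofReal_mul hδ.le,
      ← ENNReal.ofReal_mul (inv_nonneg.2 hδ.le),
      ENNReal.ofReal_rpow_of_nonneg (by positivity) h1ρ,
      ← ENNReal.ofReal_mul (by positivity), ← ENNReal.ofReal_mul (by positivity)]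
    refine ENNReal.ofReal_le_ofReal ?_
    rw [Real.mul_rpow (by positivity) (by positivity), Real.inv_rpow hδ.le, ← Real.rpow_neg hδ.le]
    have h3 : absDet A * absDet A ^ (-(1 - ρ)) = absDet A ^ ρ := by
      conv_lhs => rw [← Real.rpow_one (absDet A), ← Real.rpow_mul hδ.le, ← Real.rpow_add hδ]
      congr 1
      ring
    calc C * (absDet A * i) * (absDet A ^ (-(1 - ρ)) * w ^ (1 - ρ))
        = C * (i * w ^ (1 - ρ)) * (absDet A * absDet A ^ (-(1 - ρ))) := by ring
      _ ≤ C * (i * w ^ (1 - ρ) + 1) * (absDet A * absDet A ^ (-(1 - ρ))) := by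
        gcongr
        linarith
      _ = _ := by rw [h3]
  · exact (T.antilipschitz.isBounded_preimage Metric.isBounded_closedBall)
  · intro ζ hζ ω
    rw [fourier_dilWindow]
    have hζ' : 2 * R < ‖T ζ‖ := by simpa using hζ
    by_contra hne
    have hω : ‖T ω‖ ≤ R := by
      by_contra! hlt
      exact hne (by rw [hψR _ hlt]; simp)
    have hωζ : ‖ω + ζ‖ ≤ R := by
      by_contra! hlt
      exact hne (by rw [hψR _ hlt]; simp)
    have h2 := norm_sub_le (T (ω + ζ)) (T ω)
    rw [map_add, add_sub_cancel_left, ← map_add] at h2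
    linarith [hA (ω + ζ)]

/-- For an expanding `A`, the support of `𝓕 (ψ ∘ A⁻¹)` stays in a fixed ball, while
`‖ψ ∘ A⁻¹‖_{1/ρ} ≲ |det A|^ρ`. -/
theorem exists_modNorm_dilWindow_le_of_expanding {p q : ℝ≥0∞} (hp : 1 ≤ p) (hq : 1 ≤ q) {ρ R : ℝ}
    (hρ : ρ = max (max (recip p) (1 - recip p)) (1 - recip q)) {ψ χ : 𝓢(𝔼, ℂ)}
    (hψR : ∀ ω, R < ‖ω‖ → 𝓕 ψ ω = 0) (hχ : ∀ ω, ‖ω‖ ≤ R + 1 → 𝓕 χ ω = 1) :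
    ∃ C : ℝ, 0 < C ∧ ∀ A : GL (Fin d) ℝ, (∀ ω, ‖ω‖ ≤ ‖matrixEquiv (transposeGL A) ω‖) →
      ∀ f : 𝓢'(𝔼, ℂ), modNorm (dilWindow A ψ) p q f ≤
        ENNReal.ofReal (C * absDet A ^ ρ) * modNorm χ p q f := by
  obtain ⟨C, hC, h⟩ := exists_modNorm_le_of_bandlimited hp hq hρ hχ
  have hρ0 : 0 < ρ := by
    have h1 : recip p ≤ ρ := by rw [hρ]; simp
    have h2 : 1 - recip p ≤ ρ := by rw [hρ]; simp
    linarith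
  set I := ∫⁻ s, ‖ψ s‖ₑ ^ (1 / ρ) with hI
  have hIt : I ≠ ∞ := by
    have h1 := (ψ.memLp (ENNReal.ofReal (1 / ρ)) volume).2
    rw [eLpNorm_lt_top_iff_lintegral_rpow_enorm_lt_top (by simpa using hρ0) (by simp),
      ENNReal.toReal_ofReal (by positivity)] at h1
    exact h1.ne
  refine ⟨C * (I.toReal ^ ρ + 1), by positivity, fun A hA f => ?_⟩
  have hδ := absDet_pos A
  refine (h (dilWindow A ψ) (fun ω hω => ?_) f).trans (mul_le_mul_left ?_ _)
  · rw [fourier_dilWindow, hψR _ (hω.trans_le (hA ω)), mul_zero]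
  · have hi := (ENNReal.ofReal_toReal hIt).symm
    set i := I.toReal
    have hi0 : 0 ≤ i := ENNReal.toReal_nonneg
    rw [lintegral_dilWindow, ← hI, hi,
      ← ENNReal.ofReal_mul (by positivity), ENNReal.ofReal_rpow_of_nonneg (by positivity) hρ0.le,
      ← ENNReal.ofReal_mul (by positivity)]
    refine ENNReal.ofReal_le_ofReal ?_
    rw [Real.mul_rpow hδ.le (by positivity)]
    have : 0 ≤ C * absDet A ^ ρ := by positivity
    linarith

/-- Dilations by contracting and by expanding matrices, for an arbitrary window. -/
theorem exists_modNorm_dilation_le {p q : ℝ≥0∞} (hp : 1 ≤ p) (hq : 1 ≤ q) {g : 𝓢(𝔼, ℂ)}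
    (hg : g ≠ 0) :
    ∃ C : ℝ, 0 < C ∧
      (∀ A : GL (Fin d) ℝ, (∀ ω, ‖matrixEquiv (transposeGL A) ω‖ ≤ ‖ω‖) → ∀ f : 𝓢'(𝔼, ℂ),
        modNorm g p q (dilation A f) ≤
          ENNReal.ofReal (C * absDet A ^ mu2 p q) * modNorm g p q f) ∧
      (∀ A : GL (Fin d) ℝ, (∀ ω, ‖ω‖ ≤ ‖matrixEquiv (transposeGL A) ω‖) → ∀ f : 𝓢'(𝔼, ℂ),
        modNorm g p q (dilation A f) ≤
          ENNReal.ofReal (C * absDet A ^ mu1 p q) * modNorm g p q f) := by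
  obtain ⟨ψ, -, hψR, hψ0⟩ := exists_bandlimited (d := d) one_pos
  obtain ⟨χ, hχ, -, -⟩ := exists_bandlimited (d := d) (R := 1 + 1 + 1) (by norm_num)
  have hψ : ψ ≠ 0 := by
    rintro rfl
    exact hψ0 rfl
  obtain ⟨C₁, hC₁, h₁⟩ := exists_modNorm_dilWindow_le_of_contracting hp hq rfl hψ0 hψR
  obtain ⟨C₂, hC₂, h₂⟩ := exists_modNorm_dilWindow_le_of_expanding hp hq rfl hψR hχ
  obtain ⟨C₃, hC₃, h₃⟩ := exists_modNorm_le_modNorm hp hq g hψ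
  obtain ⟨C₄, hC₄, h₄⟩ := exists_modNorm_le_modNorm hp hq ψ hg
  obtain ⟨C₅, hC₅, h₅⟩ := exists_modNorm_le_modNorm hp hq χ hg
  -- pass from `g` to `ψ`, dilate `ψ`, and return to `g` from the window `χ'` of the estimate
  have key : ∀ (A : GL (Fin d) ℝ) (f : 𝓢'(𝔼, ℂ)) {c c' ρ μ : ℝ} {χ' : 𝓢(𝔼, ℂ)}, 0 < c → 0 < c' →
      μ = ρ + (-1 - recip p + recip q) →
      c * c' ≤ C₁ * C₄ + C₂ * C₅ →
      modNorm (dilWindow A ψ) p q f ≤ ENNReal.ofReal (c * absDet A ^ ρ) * modNorm χ' p q f →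
      modNorm χ' p q f ≤ ENNReal.ofReal c' * modNorm g p q f →
      modNorm g p q (dilation A f) ≤
        ENNReal.ofReal (C₃ * (C₁ * C₄ + C₂ * C₅) * absDet A ^ μ) * modNorm g p q f := by
    intro A f c c' ρ μ χ' hc hc' hμ hcc h h'
    have hδ := absDet_pos A
    refine (h₃ _).trans ?_
    rw [modNorm_dilation]
    refine (mul_le_mul_right (mul_le_mul_right (h.trans (mul_le_mul_right h' _)) _) _).trans ?_
    rw [← mul_assoc, ← mul_assoc, ← mul_assoc, ← ENNReal.ofReal_mul (by positivity),
      ← ENNReal.ofReal_mul (by positivity), ← ENNReal.ofReal_mul (by positivity)]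
    refine mul_le_mul_left (ENNReal.ofReal_le_ofReal ?_) _
    set b := -1 - recip p + recip q
    rw [hμ, Real.rpow_add hδ ρ b]
    calc C₃ * absDet A ^ b * (c * absDet A ^ ρ) * c'
        = C₃ * (c * c') * (absDet A ^ ρ * absDet A ^ b) := by ring
      _ ≤ C₃ * (C₁ * C₄ + C₂ * C₅) * (absDet A ^ ρ * absDet A ^ b) := by gcongr
  refine ⟨C₃ * (C₁ * C₄ + C₂ * C₅), by positivity, fun A hA f => ?_, fun A hA f => ?_⟩
  · exact key A f hC₁ hC₄ mu2_eq (by nlinarith [mul_pos hC₂ hC₅]) (h₁ A hA f) (h₄ f)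
  · exact key A f hC₂ hC₅ mu1_eq (by nlinarith [mul_pos hC₁ hC₄]) (h₂ A hA f) (h₅ f)

/-- The invertible diagonal matrix with given non-zero entries. -/
def diagonalGL (c : Fin d → ℝ) (hc : ∀ j, c j ≠ 0) : GL (Fin d) ℝ :=
  Matrix.GeneralLinearGroup.mkOfDetNeZero (Matrix.diagonal c) (by
    rw [Matrix.det_diagonal]
    exact Finset.prod_ne_zero_iff.2 fun j _ => hc j)

theorem coe_diagonalGL (c : Fin d → ℝ) (hc : ∀ j, c j ≠ 0) :
    (diagonalGL c hc : Matrix (Fin d) (Fin d) ℝ) = Matrix.diagonal c := rfl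

theorem absDet_diagonalGL (c : Fin d → ℝ) (hc : ∀ j, c j ≠ 0) :
    absDet (diagonalGL c hc) = ∏ j, |c j| := by
  rw [absDet, coe_diagonalGL, Matrix.det_diagonal, Finset.abs_prod]

theorem matrixEquiv_transposeGL_diagonalGL (c : Fin d → ℝ) (hc : ∀ j, c j ≠ 0) (ω : 𝔼) (j : Fin d) :
    matrixEquiv (transposeGL (diagonalGL c hc)) ω j = c j * ω j := by
  rw [matrixEquiv_apply]
  change (Matrix.mulVec (Matrix.diagonal c).transpose (WithLp.ofLp ω)) j = _
  rw [Matrix.diagonal_transpose, Matrix.mulVec_diagonal]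

theorem norm_diagonalGL_le {c : Fin d → ℝ} (hc : ∀ j, c j ≠ 0) (h : ∀ j, |c j| ≤ 1) (ω : 𝔼) :
    ‖matrixEquiv (transposeGL (diagonalGL c hc)) ω‖ ≤ ‖ω‖ := by
  rw [EuclideanSpace.norm_eq, EuclideanSpace.norm_eq]
  refine Real.sqrt_le_sqrt (Finset.sum_le_sum fun j _ => ?_)
  rw [matrixEquiv_transposeGL_diagonalGL, norm_mul]
  refine pow_le_pow_left₀ (by positivity) ?_ 2
  exact mul_le_of_le_one_left (norm_nonneg _) (h j)

theorem le_norm_diagonalGL {c : Fin d → ℝ} (hc : ∀ j, c j ≠ 0) (h : ∀ j, 1 ≤ |c j|) (ω : 𝔼) :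
    ‖ω‖ ≤ ‖matrixEquiv (transposeGL (diagonalGL c hc)) ω‖ := by
  rw [EuclideanSpace.norm_eq, EuclideanSpace.norm_eq]
  refine Real.sqrt_le_sqrt (Finset.sum_le_sum fun j _ => ?_)
  rw [matrixEquiv_transposeGL_diagonalGL, norm_mul]
  refine pow_le_pow_left₀ (by positivity) ?_ 2
  exact le_mul_of_one_le_left (norm_nonneg _) (h j)

theorem norm_orthogonal {U : GL (Fin d) ℝ} (hU : U * transposeGL U = 1) (ω : 𝔼) :
    ‖matrixEquiv (transposeGL U) ω‖ = ‖ω‖ := by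
  have h : inner ℝ (matrixEquiv (transposeGL U) ω) (matrixEquiv (transposeGL U) ω) =
      inner ℝ ω ω := by
    rw [inner_transposeGL, ← matrixEquiv_mul_apply, hU]
    simp [matrixEquiv_apply]
  rw [real_inner_self_eq_norm_sq, real_inner_self_eq_norm_sq] at h
  exact (pow_left_inj₀ (norm_nonneg _) (norm_nonneg _) two_ne_zero).1 h

theorem transposeGL_transposeGL (A : GL (Fin d) ℝ) : transposeGL (transposeGL A) = A := by
  ext i j
  rfl

/-- A symmetric matrix is an orthogonal conjugate of the product of an expanding and a contracting
diagonal matrix. -/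
theorem exists_decomposition {A : GL (Fin d) ℝ} (hA : (A : Matrix (Fin d) (Fin d) ℝ).IsHermitian) :
    (∀ j, hA.eigenvalues j ≠ 0) ∧ ∃ U D₁ D₂ : GL (Fin d) ℝ,
      A = U * D₁ * D₂ * transposeGL U ∧ U * transposeGL U = 1 ∧ transposeGL U * U = 1 ∧
      absDet U = 1 ∧
      absDet D₁ = ∏ j, max 1 |hA.eigenvalues j| ∧ absDet D₂ = ∏ j, min 1 |hA.eigenvalues j| ∧
      (∀ ω, ‖ω‖ ≤ ‖matrixEquiv (transposeGL D₁) ω‖) ∧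
      ∀ ω, ‖matrixEquiv (transposeGL D₂) ω‖ ≤ ‖ω‖ := by
  set e := hA.eigenvalues with he
  have h0 : ∀ j, e j ≠ 0 := by
    have h1 := hA.det_eq_prod_eigenvalues
    have h2 : (A : Matrix (Fin d) (Fin d) ℝ).det ≠ 0 := (Matrix.GeneralLinearGroup.det A).ne_zero
    rw [h1] at h2
    simpa [Finset.prod_ne_zero_iff] using h2
  refine ⟨h0, ?_⟩
  set V : Matrix (Fin d) (Fin d) ℝ := hA.eigenvectorUnitary.1 with hV
  have hV1 : V * V.transpose = 1 := by
    have := Unitary.mul_star_self_of_mem hA.eigenvectorUnitary.2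
    rwa [Matrix.star_eq_conjTranspose, Matrix.conjTranspose_eq_transpose_of_trivial] at this
  have hV2 : V.transpose * V = 1 := by
    have := Unitary.star_mul_self_of_mem hA.eigenvectorUnitary.2
    rwa [Matrix.star_eq_conjTranspose, Matrix.conjTranspose_eq_transpose_of_trivial] at this
  let U : GL (Fin d) ℝ := ⟨V, V.transpose, hV1, hV2⟩
  have hm : ∀ j, 0 < max 1 |e j| := fun j => lt_max_of_lt_left one_pos
  have hD₁ : ∀ j, max 1 |e j| ≠ 0 := fun j => (hm j).ne'
  have hD₂ : ∀ j, e j / max 1 |e j| ≠ 0 := fun j => div_ne_zero (h0 j) (hD₁ j)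
  have hmin : ∀ j, |e j / (max 1 |e j|)| = min 1 |e j| := fun j => by
    rw [abs_div, abs_of_pos (hm j)]
    rcases le_total 1 |e j| with h | h
    · rw [max_eq_right h, min_eq_left h, div_self (abs_ne_zero.2 (h0 j))]
    · rw [max_eq_left h, min_eq_right h, div_one]
  refine ⟨U, diagonalGL _ hD₁, diagonalGL _ hD₂, ?_, ?_, ?_, ?_, ?_, ?_, ?_, ?_⟩
  · ext i j
    have h1 := hA.spectral_theorem
    rw [Unitary.conjStarAlgAut_apply, Matrix.star_eq_conjTranspose,
      Matrix.conjTranspose_eq_transpose_of_trivial] at h1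
    have h2 : Matrix.diagonal (RCLike.ofReal ∘ hA.eigenvalues) =
        Matrix.diagonal (fun j => max 1 |e j|) * Matrix.diagonal (fun j => e j / max 1 |e j|) := by
      rw [Matrix.diagonal_mul_diagonal]
      congr 1
      ext j
      rw [mul_div_cancel₀ _ (hD₁ j)]
      rfl
    rw [h2, ← mul_assoc] at h1
    exact congrFun (congrFun h1 i) j
  · exact Units.ext hV1
  · exact Units.ext hV2
  · have h1 := absDet_mul U (transposeGL U)
    rw [absDet_transposeGL, show U * transposeGL U = 1 from Units.ext hV1] at h1
    rw [show absDet (1 : GL (Fin d) ℝ) = 1 by simp [absDet]] at h1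
    nlinarith [absDet_pos U]
  · rw [absDet_diagonalGL]
    exact Finset.prod_congr rfl fun j _ => abs_of_pos (hm j)
  · rw [absDet_diagonalGL]
    exact Finset.prod_congr rfl fun j _ => hmin j
  · exact le_norm_diagonalGL _ fun j => (le_max_left 1 |e j|).trans (le_abs_self _)
  · exact norm_diagonalGL_le _ fun j => (hmin j).trans_le (min_le_left _ _)

/-- Dilations by symmetric matrices. The two orthogonal factors in the diagonalization of `A` are
both contracting and expanding and have determinant `± 1`. -/
theorem exists_modNorm_dilation_le_of_isHermitian {p q : ℝ≥0∞} (hp : 1 ≤ p) (hq : 1 ≤ q)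
    {g : 𝓢(𝔼, ℂ)} (hg : g ≠ 0) :
    ∃ C : ℝ, 0 < C ∧ ∀ (A : GL (Fin d) ℝ) (hA : (A : Matrix (Fin d) (Fin d) ℝ).IsHermitian)
      (f : 𝓢'(𝔼, ℂ)), modNorm g p q (dilation A f) ≤
        ENNReal.ofReal (C * ∏ j, (max 1 |hA.eigenvalues j|) ^ mu1 p q *
          (min 1 |hA.eigenvalues j|) ^ mu2 p q) * modNorm g p q f := by
  obtain ⟨C, hC, hcon, hexp⟩ := exists_modNorm_dilation_le hp hq hg
  refine ⟨C * (C * (C * C)), by positivity, fun A hA f => ?_⟩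
  obtain ⟨-, U, D₁, D₂, hAeq, hU, hU', hUdet, h₁, h₂, hD₁, hD₂⟩ := exists_decomposition hA
  conv_lhs => rw [hAeq, dilation_mul, dilation_mul, dilation_mul]
  have hUt : ∀ ω, ‖matrixEquiv (transposeGL (transposeGL U)) ω‖ = ‖ω‖ := fun ω =>
    norm_orthogonal (by rw [transposeGL_transposeGL]; exact hU') ω
  refine (hcon (transposeGL U) (fun ω => (hUt ω).le) _).trans ?_
  refine (mul_le_mul_right (hcon D₂ hD₂ _) _).trans ?_
  refine (mul_le_mul_right (mul_le_mul_right (hexp D₁ hD₁ _) _) _).trans ?_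
  refine (mul_le_mul_right (mul_le_mul_right (mul_le_mul_right
    (hexp U (fun ω => (norm_orthogonal hU ω).ge) f) _) _) _).trans_eq ?_
  have hδ₁ := absDet_pos D₁
  have hδ₂ := absDet_pos D₂
  rw [absDet_transposeGL, hUdet, Real.one_rpow, Real.one_rpow, mul_one,
    ← mul_assoc, ← mul_assoc, ← mul_assoc, ← ENNReal.ofReal_mul (by positivity),
    ← ENNReal.ofReal_mul (by positivity), ← ENNReal.ofReal_mul (by positivity),
    Finset.prod_mul_distrib,
    Real.finsetProd_rpow _ _ fun j _ => zero_le_one.trans (le_max_left _ _),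
    Real.finsetProd_rpow _ _ fun j _ => le_min zero_le_one (abs_nonneg _), ← h₁, ← h₂]
  congr 2
  ring

/-! ### Gaussians -/

theorem one_add_pow_mul_exp_le {r : ℝ} (hr : 0 ≤ r) (m : ℕ) :
    (1 + r) ^ m * Real.exp (-(Real.pi * r ^ 2)) ≤ Real.exp ((m : ℝ) ^ 2) := by
  have h1 : (1 + r) ^ m ≤ Real.exp (m * r) := by
    rw [Real.exp_nat_mul]
    exact pow_le_pow_left₀ (by positivity) (by linarith [Real.add_one_le_exp r]) m
  refine (mul_le_mul_of_nonneg_right h1 (Real.exp_pos _).le).trans ?_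
  rw [← Real.exp_add]
  refine Real.exp_le_exp.2 ?_
  nlinarith [Real.pi_gt_three, sq_nonneg ((m : ℝ) - r), sq_nonneg r]

theorem hasTemperateGrowth_pi_mul_norm_sq :
    (fun x : 𝔼 => -(Real.pi * ‖x‖ ^ 2)).HasTemperateGrowth := by
  have := Function.hasTemperateGrowth_norm_sq (𝔼)
  fun_prop

theorem exists_iteratedFDeriv_gaussian_le (k n : ℕ) :
    ∃ C : ℝ, ∀ x : 𝔼, ‖x‖ ^ k *
      ‖iteratedFDeriv ℝ n (fun x : 𝔼 => Real.exp (-(Real.pi * ‖x‖ ^ 2))) x‖ ≤ C := by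
  obtain ⟨K, C, hC, h⟩ :=
    (hasTemperateGrowth_pi_mul_norm_sq (d := d)).norm_iteratedFDeriv_le_uniform n
  refine ⟨n.factorial * (C + 1) ^ n * Real.exp (((k + K * n : ℕ) : ℝ) ^ 2), fun x => ?_⟩
  have hx := norm_nonneg x
  have h1 := norm_iteratedFDeriv_comp_le (g := Real.exp) (f := fun x : 𝔼 => -(Real.pi * ‖x‖ ^ 2))
    (n := n) (N := n) (C := Real.exp (-(Real.pi * ‖x‖ ^ 2))) (D := (C + 1) * (1 + ‖x‖) ^ K)
    Real.contDiff_exp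
    ((hasTemperateGrowth_pi_mul_norm_sq (d := d)).1.of_le (by exact_mod_cast le_top))
    le_rfl x (fun i _ => by
      rw [norm_iteratedFDeriv_eq_norm_iteratedDeriv, iteratedDeriv_eq_iterate, Real.iter_deriv_exp,
        Real.norm_of_nonneg (Real.exp_pos _).le])
    (fun i hi hin => by
      refine (h i hin x).trans ?_
      have h2 : 1 ≤ (C + 1) * (1 + ‖x‖) ^ K :=
        one_le_mul_of_one_le_of_one_le (by linarith) (one_le_pow₀ (by linarith))
      refine le_trans ?_ (le_self_pow₀ h2 (by omega))
      gcongr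
      linarith)
  have h3 : ‖x‖ ^ k ≤ (1 + ‖x‖) ^ k := pow_le_pow_left₀ hx (by linarith) k
  calc ‖x‖ ^ k * ‖iteratedFDeriv ℝ n (fun x : 𝔼 => Real.exp (-(Real.pi * ‖x‖ ^ 2))) x‖
      ≤ (1 + ‖x‖) ^ k * (n.factorial * Real.exp (-(Real.pi * ‖x‖ ^ 2)) *
        ((C + 1) * (1 + ‖x‖) ^ K) ^ n) := by
        gcongr
        exact h1
    _ = n.factorial * (C + 1) ^ n *
        ((1 + ‖x‖) ^ (k + K * n) * Real.exp (-(Real.pi * ‖x‖ ^ 2))) := by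
        rw [mul_pow, ← pow_mul, pow_add]
        ring
    _ ≤ _ := by
        gcongr
        exact one_add_pow_mul_exp_le hx _

/-- The standard Gaussian `x ↦ e^{-π|x|²}`. -/
def stdGaussian (d : ℕ) : 𝓢(EuclideanSpace ℝ (Fin d), ℂ) :=
  SchwartzMap.postcompCLM Complex.ofRealCLM
    (⟨fun x => Real.exp (-(Real.pi * ‖x‖ ^ 2)),
      Real.contDiff_exp.comp hasTemperateGrowth_pi_mul_norm_sq.1,
      exists_iteratedFDeriv_gaussian_le⟩ : 𝓢(EuclideanSpace ℝ (Fin d), ℝ))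

theorem stdGaussian_apply (x : 𝔼) :
    stdGaussian d x = (Real.exp (-(Real.pi * ‖x‖ ^ 2)) : ℝ) := rfl

theorem enorm_stdGaussian (x : 𝔼) :
    ‖stdGaussian d x‖ₑ = ENNReal.ofReal (Real.exp (-(Real.pi * ∑ j, x j ^ 2))) := by
  rw [stdGaussian_apply, ← ofReal_norm, Complex.norm_real,
    Real.norm_of_nonneg (Real.exp_pos _).le, EuclideanSpace.real_norm_sq_eq]

/-- The diagonal matrix with entries `√a_j`. -/
def sqrtDiag (a : Fin d → ℝ) (ha : ∀ j, 0 < a j) : GL (Fin d) ℝ :=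
  diagonalGL (fun j => √(a j)) fun j => (Real.sqrt_pos.2 (ha j)).ne'

theorem matrixEquiv_diagonalGL (c : Fin d → ℝ) (hc : ∀ j, c j ≠ 0) (x : 𝔼) (j : Fin d) :
    matrixEquiv (diagonalGL c hc) x j = c j * x j := by
  rw [matrixEquiv_apply]
  change (Matrix.mulVec (Matrix.diagonal c) (WithLp.ofLp x)) j = _
  rw [Matrix.mulVec_diagonal]

theorem absDet_sqrtDiag (a : Fin d → ℝ) (ha : ∀ j, 0 < a j) :
    absDet (sqrtDiag a ha) = ∏ j, √(a j) := by
  rw [sqrtDiag, absDet_diagonalGL]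
  exact Finset.prod_congr rfl fun j _ => abs_of_nonneg (Real.sqrt_nonneg _)

/-- The chirp `x ↦ e^{-πi Σ b_j x_j²}`. -/
def chirp (b : Fin d → ℝ) (x : 𝔼) : ℂ :=
  Complex.exp (((-(Real.pi * ∑ j, b j * x j ^ 2) : ℝ) : ℂ) * Complex.I)

theorem hasTemperateGrowth_chirp (b : Fin d → ℝ) : (chirp b).HasTemperateGrowth := by
  have h : (fun x : 𝔼 => -(Real.pi * ∑ j, b j * x j ^ 2)).HasTemperateGrowth := by
    have h1 : ∀ j, (fun x : 𝔼 => x j).HasTemperateGrowth := fun j =>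
      (EuclideanSpace.proj j : 𝔼 →L[ℝ] ℝ).hasTemperateGrowth
    have h2 : (fun x : 𝔼 => ∑ j, b j * x j ^ 2).HasTemperateGrowth :=
      Function.HasTemperateGrowth.sum fun j _ => by
        have := (h1 j).pow 2
        fun_prop
    fun_prop
  exact exp_I_hasTemperateGrowth.comp h

/-- The complex Gaussian `x ↦ e^{-π Σ (a_j + i b_j) x_j²}`. -/
def gaussian (a b : Fin d → ℝ) (ha : ∀ j, 0 < a j) : 𝓢(𝔼, ℂ) :=
  SchwartzMap.smulLeftCLM ℂ (chirp b)
    (SchwartzMap.compCLMOfContinuousLinearEquiv ℂ (matrixEquiv (sqrtDiag a ha)) (stdGaussian d))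

theorem gaussian_apply (a b : Fin d → ℝ) (ha : ∀ j, 0 < a j) (x : 𝔼) :
    gaussian a b ha x =
      Complex.exp (∑ j, -(Real.pi * (a j + b j * Complex.I) * (x j : ℂ) ^ 2)) := by
  rw [gaussian, SchwartzMap.smulLeftCLM_apply_apply (hasTemperateGrowth_chirp b)]
  change chirp b x • stdGaussian d (matrixEquiv (sqrtDiag a ha) x) = _
  rw [stdGaussian_apply, EuclideanSpace.real_norm_sq_eq, chirp, smul_eq_mul, Complex.ofReal_exp,
    ← Complex.exp_add]
  congr 1
  simp only [sqrtDiag, matrixEquiv_diagonalGL, mul_pow, Real.sq_sqrt (ha _).le]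
  push_cast
  rw [Finset.mul_sum, Finset.mul_sum, ← Finset.sum_neg_distrib, ← Finset.sum_neg_distrib,
    Finset.sum_mul, ← Finset.sum_add_distrib]
  exact Finset.sum_congr rfl fun j _ => by ring

/-- The tempered distribution given by a Schwartz function. -/
abbrev toDist (f : 𝓢(𝔼, ℂ)) : 𝓢'(𝔼, ℂ) :=
  SchwartzMap.toTemperedDistributionCLM 𝔼 ℂ volume f

theorem dilation_gaussian (a b c : Fin d → ℝ) (ha : ∀ j, 0 < a j) (hc : ∀ j, c j ≠ 0)
    (hca : ∀ j, 0 < c j ^ 2 * a j) :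
    dilation (diagonalGL c hc) (toDist (gaussian a b ha)) =
      toDist (gaussian (fun j => c j ^ 2 * a j) (fun j => c j ^ 2 * b j) hca) := by
  rw [toDist, dilation_schwartz]
  congr 1
  ext x
  change gaussian a b ha (matrixEquiv (diagonalGL c hc) x) = _
  rw [gaussian_apply, gaussian_apply]
  congr 1
  refine Finset.sum_congr rfl fun j _ => ?_
  rw [matrixEquiv_diagonalGL]
  push_cast
  ring

/-- The squared modulus of `z + 1`, for `z = a + i b`. -/
def gaussD (a b : ℝ) : ℝ := (a + 1) ^ 2 + b ^ 2

/-- The real part of `z̄ (z + 1)`, for `z = a + i b`. -/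
def gaussE (a b : ℝ) : ℝ := a * (a + 1) + b ^ 2

theorem gaussD_pos {a : ℝ} (ha : 0 < a) (b : ℝ) : 0 < gaussD a b := by
  unfold gaussD
  positivity

theorem gaussE_pos {a : ℝ} (ha : 0 < a) (b : ℝ) : 0 < gaussE a b := by
  unfold gaussE
  positivity

/-- The modulus of the one-dimensional short-time Fourier transform of a complex Gaussian, after
completion of the square in `x`. -/
theorem norm_gaussian_factor {a : ℝ} (ha : 0 < a) (b x ξ : ℝ) :
    ‖((Real.pi : ℂ) / (Real.pi * (a + b * Complex.I + 1))) ^ (1 / 2 : ℂ) *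
      Complex.exp ((2 * Real.pi * (x - Complex.I * ξ)) ^ 2 /
        (4 * (Real.pi * (a + b * Complex.I + 1)))) * Complex.exp (-(Real.pi * x ^ 2))‖ =
      gaussD a b ^ (-(1 / 4) : ℝ) *
        Real.exp (-(Real.pi * (gaussE a b / gaussD a b * (x - -b / gaussE a b * ξ) ^ 2))) *
        Real.exp (-(Real.pi * (a / gaussE a b * ξ ^ 2))) := by
  have hD := gaussD_pos ha b
  have hE := gaussE_pos ha b
  set z : ℂ := a + b * Complex.I + 1 with hz
  have hre : z.re = a + 1 := by simp [hz]
  have him : z.im = b := by simp [hz]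
  have hns : Complex.normSq z = gaussD a b := by
    rw [Complex.normSq_apply, hre, him, gaussD]
    ring
  have hz0 : z ≠ 0 := by
    rintro h0
    rw [h0, Complex.zero_re] at hre
    linarith
  have hpi : (Real.pi : ℂ) ≠ 0 := by exact_mod_cast Real.pi_ne_zero
  rw [norm_mul, norm_mul]
  have h1 : ‖((Real.pi : ℂ) / (Real.pi * z)) ^ (1 / 2 : ℂ)‖ = gaussD a b ^ (-(1 / 4) : ℝ) := by
    rw [div_mul_cancel_left₀ hpi, show (1 / 2 : ℂ) = ((1 / 2 : ℝ) : ℂ) by norm_num,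
      Complex.norm_cpow_real, norm_inv, Complex.norm_def, hns, Real.sqrt_eq_rpow,
      ← Real.rpow_neg hD.le, ← Real.rpow_mul hD.le]
    norm_num
  rw [h1]
  refine (mul_assoc _ _ _).trans
    ((congrArg (gaussD a b ^ (-(1 / 4) : ℝ) * ·) ?_).trans (mul_assoc _ _ _).symm)
  rw [← norm_mul, ← Complex.exp_add, Complex.norm_exp, ← Real.exp_add]
  congr 1
  have h2 : (2 * Real.pi * (x - Complex.I * ξ)) ^ 2 / (4 * (Real.pi * z)) =
      (Real.pi : ℂ) * ((x - Complex.I * ξ) ^ 2 * z⁻¹) := by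
    field_simp
    ring
  have h3 : (((x : ℂ) - Complex.I * ξ) ^ 2).re = x ^ 2 - ξ ^ 2 := by
    simp [pow_two]
  have h4 : (((x : ℂ) - Complex.I * ξ) ^ 2).im = -(2 * x * ξ) := by
    simp [pow_two]
    ring
  have h5 : (-((Real.pi : ℂ) * (x : ℂ) ^ 2)).re = -(Real.pi * x ^ 2) := by
    rw [← Complex.ofReal_pow, ← Complex.ofReal_mul, ← Complex.ofReal_neg, Complex.ofReal_re]
  rw [h2, Complex.add_re, Complex.re_ofReal_mul, Complex.mul_re, h3, h4, Complex.inv_re,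
    Complex.inv_im, hns, hre, him, h5]
  field_simp
  simp only [gaussD, gaussE]
  ring

/-- The short-time Fourier transform of a complex Gaussian is a Gaussian integral. -/
theorem stft_gaussian (a b : Fin d → ℝ) (ha : ∀ j, 0 < a j) (x ξ : 𝔼) :
    stft (stdGaussian d) (toDist (gaussian a b ha)) x ξ =
      ∏ j, ((Real.pi : ℂ) / (Real.pi * (a j + b j * Complex.I + 1))) ^ (1 / 2 : ℂ) *
        Complex.exp ((2 * Real.pi * (x j - Complex.I * ξ j)) ^ 2 /
        (4 * (Real.pi * (a j + b j * Complex.I + 1)))) *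
        Complex.exp (-(Real.pi * (x j : ℂ) ^ 2)) := by
  have hre : ∀ j, 0 < ((Real.pi : ℂ) * (a j + b j * Complex.I + 1)).re := fun j => by
    rw [Complex.re_ofReal_mul]
    simp only [Complex.add_re, Complex.ofReal_re, Complex.mul_re, Complex.I_re, Complex.I_im,
      Complex.ofReal_im, Complex.one_re]
    have := ha j
    have := Real.pi_pos
    nlinarith
  have h := GaussianFourier.integral_cexp_neg_sum_mul_add hre
    (fun j => 2 * Real.pi * (x j - Complex.I * ξ j))
  have h' : stft (stdGaussian d) (toDist (gaussian a b ha)) x ξ =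
      ∫ y, shiftedWindow (stdGaussian d) x ξ y * gaussian a b ha y := by
    simp only [stft, toDist, SchwartzMap.toTemperedDistributionCLM_apply_apply, smul_eq_mul]
  rw [Finset.prod_mul_distrib, ← Complex.exp_sum, ← h, ← integral_mul_const, h',
    ← (PiLp.volume_preserving_toLp (Fin d)).integral_comp
      (MeasurableEquiv.toLp 2 _).measurableEmbedding]
  refine integral_congr_ae (.of_forall fun y => ?_)
  beta_reduce
  rw [shiftedWindow_apply, stdGaussian_apply, gaussian_apply, conjChar, Complex.ofReal_exp,
    ← Complex.exp_add, ← Complex.exp_add, ← Complex.exp_add, EuclideanSpace.real_norm_sq_eq,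
    PiLp.inner_apply]
  congr 1
  simp only [PiLp.sub_apply, RCLike.inner_apply, conj_trivial]
  push_cast
  simp only [Finset.mul_sum, Finset.sum_mul, ← Finset.sum_neg_distrib, ← Finset.sum_add_distrib]
  refine Finset.sum_congr rfl fun j _ => ?_
  ring

theorem eLpNorm_stdGaussian_ne {p : ℝ≥0∞} (hp : 1 ≤ p) :
    eLpNorm (stdGaussian d) p volume ≠ 0 ∧ eLpNorm (stdGaussian d) p volume ≠ ∞ := by
  refine ⟨fun h => ?_, ((stdGaussian d).memLp p volume).2.ne⟩
  rw [eLpNorm_eq_zero_iff (stdGaussian d).continuous.aestronglyMeasurable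
    (zero_lt_one.trans_le hp).ne'] at h
  have h2 := congrFun
    ((Continuous.ae_eq_iff_eq volume (stdGaussian d).continuous continuous_zero).1 h) 0
  simp [stdGaussian_apply] at h2

theorem enorm_stdGaussian_sqrtDiag (a : Fin d → ℝ) (ha : ∀ j, 0 < a j) (x : 𝔼) :
    ‖stdGaussian d (matrixEquiv (sqrtDiag a ha) x)‖ₑ =
      ENNReal.ofReal (∏ j, Real.exp (-(Real.pi * (a j * x j ^ 2)))) := by
  have h : -(Real.pi * ∑ j, matrixEquiv (sqrtDiag a ha) x j ^ 2) =
      ∑ j, -(Real.pi * (a j * x j ^ 2)) := by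
    rw [Finset.mul_sum, ← Finset.sum_neg_distrib]
    refine Finset.sum_congr rfl fun j _ => ?_
    rw [sqrtDiag, matrixEquiv_diagonalGL, mul_pow, Real.sq_sqrt (ha j).le]
  rw [enorm_stdGaussian, ← Real.exp_sum, h]

theorem eLpNorm_stdGaussian_sqrtDiag (a : Fin d → ℝ) (ha : ∀ j, 0 < a j) (c : 𝔼) (p : ℝ≥0∞) :
    eLpNorm (fun x => ‖stdGaussian d (matrixEquiv (sqrtDiag a ha) (x - c))‖ₑ) p volume =
      ENNReal.ofReal ((∏ j, √(a j)) ^ (-recip p)) * eLpNorm (stdGaussian d) p volume := by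
  rw [eLpNorm_enorm' fun x => stdGaussian d (matrixEquiv (sqrtDiag a ha) (x - c))]
  have h := eLpNorm_comp_measurePreserving (p := p)
    ((stdGaussian d).continuous.comp
      (matrixEquiv (sqrtDiag a ha)).continuous).aestronglyMeasurable
    (measurePreserving_sub_right (volume : Measure 𝔼) c)
  have h2 := eLpNorm_comp_equiv (matrixEquiv (sqrtDiag a ha)) (stdGaussian d) p
  rw [abs_det_matrixEquiv, absDet_sqrtDiag] at h2
  rw [← h2]
  exact h

/-- The one-dimensional factor of the modulation norm, with a Gaussian window, of the Gaussian with
parameter `a + i b`, up to a constant that depends on `p` and `q` only. -/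
def gaussNorm (p q : ℝ≥0∞) (a b : ℝ) : ℝ :=
  gaussD a b ^ (-(1 / 4) : ℝ) * √(gaussE a b / gaussD a b) ^ (-recip p) *
    √(a / gaussE a b) ^ (-recip q)

theorem modNorm_gaussian {p q : ℝ≥0∞} (hp : 1 ≤ p) (a b : Fin d → ℝ) (ha : ∀ j, 0 < a j) :
    modNorm (stdGaussian d) p q (toDist (gaussian a b ha)) =
      ENNReal.ofReal (∏ j, gaussNorm p q (a j) (b j)) *
        (eLpNorm (stdGaussian d) p volume * eLpNorm (stdGaussian d) q volume) := by
  have hD := fun j => gaussD_pos (ha j) (b j)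
  have hE := fun j => gaussE_pos (ha j) (b j)
  have hs : ∀ j, 0 < gaussE (a j) (b j) / gaussD (a j) (b j) := fun j => div_pos (hE j) (hD j)
  have hk : ∀ j, 0 < a j / gaussE (a j) (b j) := fun j => div_pos (ha j) (hE j)
  set P : ℝ := ∏ j, gaussD (a j) (b j) ^ (-(1 / 4) : ℝ) with hP
  have hP0 : 0 < P := Finset.prod_pos fun j _ => Real.rpow_pos_of_pos (hD j) _
  have hV : ∀ x ξ, ‖stft (stdGaussian d) (toDist (gaussian a b ha)) x ξ‖ₑ =
      (ENNReal.ofReal P * ‖stdGaussian d (matrixEquiv (sqrtDiag _ hk) ξ)‖ₑ) *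
        ‖stdGaussian d (matrixEquiv (sqrtDiag _ hs)
          (x - WithLp.toLp 2 fun j => -b j / gaussE (a j) (b j) * ξ j))‖ₑ := fun x ξ => by
    rw [stft_gaussian, ← ofReal_norm, norm_prod, enorm_stdGaussian_sqrtDiag,
      enorm_stdGaussian_sqrtDiag, ← ENNReal.ofReal_mul hP0.le, ← ENNReal.ofReal_mul (by positivity),
      hP, ← Finset.prod_mul_distrib, ← Finset.prod_mul_distrib]
    congr 1
    refine Finset.prod_congr rfl fun j _ => ?_
    rw [norm_gaussian_factor (ha j)]
    simp only [PiLp.sub_apply]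
    ring
  have hS : sliceNorm (stdGaussian d) p (toDist (gaussian a b ha)) = fun ξ =>
      (ENNReal.ofReal P * (ENNReal.ofReal ((∏ j, √(gaussE (a j) (b j) / gaussD (a j) (b j))) ^
        (-recip p)) * eLpNorm (stdGaussian d) p volume)) *
        ‖stdGaussian d (matrixEquiv (sqrtDiag _ hk) (ξ - 0))‖ₑ := by
    ext ξ
    rw [sliceNorm, ← eLpNorm_enorm' fun x => stft (stdGaussian d) (toDist (gaussian a b ha)) x ξ]
    simp_rw [hV]
    rw [eLpNorm_ennreal_const_mul, eLpNorm_stdGaussian_sqrtDiag, sub_zero]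
    · ring
    · refine mul_ne_zero (by simpa using hP0) ?_
      simp [stdGaussian_apply]
    · finiteness
  have hsq : ∀ {r : Fin d → ℝ} (e : ℝ), (∏ j, √(r j)) ^ e = ∏ j, √(r j) ^ e := fun {r} e =>
    (Real.finsetProd_rpow _ _ (fun j _ => Real.sqrt_nonneg _) _).symm
  have hs0 : ∀ {r : Fin d → ℝ} (e : ℝ), 0 ≤ (∏ j, √(r j)) ^ e := fun {r} e =>
    Real.rpow_nonneg (Finset.prod_nonneg fun j _ => Real.sqrt_nonneg _) _
  rw [modNorm_eq, hS, eLpNorm_ennreal_const_mul, eLpNorm_stdGaussian_sqrtDiag]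
  · simp only [gaussNorm]
    rw [Finset.prod_mul_distrib, Finset.prod_mul_distrib, ← hP, ← hsq, ← hsq,
      ENNReal.ofReal_mul (mul_nonneg hP0.le (hs0 _)), ENNReal.ofReal_mul hP0.le]
    ring
  · refine mul_ne_zero (by simpa using hP0) (mul_ne_zero ?_ (eLpNorm_stdGaussian_ne hp).1)
    simp only [ne_eq, ENNReal.ofReal_eq_zero, not_le]
    exact Real.rpow_pos_of_pos (Finset.prod_pos fun j _ => Real.sqrt_pos.2 (hs j)) _
  · exact ENNReal.mul_ne_top ENNReal.ofReal_ne_top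
      (ENNReal.mul_ne_top ENNReal.ofReal_ne_top (eLpNorm_stdGaussian_ne hp).2)

/-! ### Necessity of the exponents -/

theorem gaussNorm_pos (p q : ℝ≥0∞) {a : ℝ} (ha : 0 < a) (b : ℝ) : 0 < gaussNorm p q a b := by
  have hD := gaussD_pos ha b
  have hE := gaussE_pos ha b
  unfold gaussNorm
  positivity

/-- Testing the dilation estimate on Gaussians that are standard in all but one variable reduces it
to an estimate in one variable. -/
theorem exists_gaussNorm_le {p q : ℝ≥0∞} (hp : 1 ≤ p) (hq : 1 ≤ q) {g : 𝓢(𝔼, ℂ)} (hg : g ≠ 0)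
    {α β : Fin d → ℝ} {C : ℝ} (hC : 0 < C)
    (h : ∀ lam : Fin d → ℝ, (∀ j, lam j ≠ 0) →
      ∀ A : GL (Fin d) ℝ, (A : Matrix (Fin d) (Fin d) ℝ) = Matrix.diagonal lam →
        ∀ f ∈ modSpace g p q, modNorm g p q (dilation A f) ≤
          ENNReal.ofReal (C * ∏ j : Fin d, (max 1 |lam j|) ^ α j * (min 1 |lam j|) ^ β j) *
            modNorm g p q f) (j₀ : Fin d) :
    ∃ C' : ℝ, 0 < C' ∧ ∀ L a b : ℝ, 0 < L → 0 < a →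
      gaussNorm p q (L ^ 2 * a) (L ^ 2 * b) ≤
        C' * ((max 1 L) ^ α j₀ * (min 1 L) ^ β j₀) * gaussNorm p q a b := by
  have hφ : stdGaussian d ≠ 0 := fun h0 => by
    have := congrArg (fun φ : 𝓢(𝔼, ℂ) => φ 0) h0
    simp [stdGaussian_apply] at this
  obtain ⟨C₁, hC₁, h₁⟩ := exists_modNorm_le_modNorm hp hq g hφ
  obtain ⟨C₂, hC₂, h₂⟩ := exists_modNorm_le_modNorm hp hq (stdGaussian d) hg
  refine ⟨C₂ * (C * C₁), by positivity, fun L a b hL ha => ?_⟩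
  set lam : Fin d → ℝ := Function.update 1 j₀ L with hlam
  set a' : Fin d → ℝ := Function.update 1 j₀ a with ha'
  set b' : Fin d → ℝ := Function.update 0 j₀ b with hb'
  have hlam0 : ∀ j, 0 < lam j := fun j => by
    rcases eq_or_ne j j₀ with rfl | hj
    · simpa [hlam] using hL
    · simp [hlam, hj]
  have ha'0 : ∀ j, 0 < a' j := fun j => by
    rcases eq_or_ne j j₀ with rfl | hj
    · simpa [ha'] using ha
    · simp [ha', hj]
  have hla : ∀ j, 0 < lam j ^ 2 * a' j := fun j => mul_pos (pow_pos (hlam0 j) 2) (ha'0 j)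
  set K := eLpNorm (stdGaussian d) p volume * eLpNorm (stdGaussian d) q volume with hK
  have hK0 : K ≠ 0 := mul_ne_zero (eLpNorm_stdGaussian_ne hp).1 (eLpNorm_stdGaussian_ne hq).1
  have hKt : K ≠ ∞ := ENNReal.mul_ne_top (eLpNorm_stdGaussian_ne hp).2 (eLpNorm_stdGaussian_ne hq).2
  set f := toDist (gaussian a' b' ha'0) with hf
  have hf1 : modNorm (stdGaussian d) p q f =
      ENNReal.ofReal (∏ j, gaussNorm p q (a' j) (b' j)) * K := modNorm_gaussian hp a' b' ha'0
  have hfm : f ∈ modSpace g p q := by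
    change modNorm g p q f < ∞
    refine (h₁ f).trans_lt ?_
    rw [hf1]
    exact ENNReal.mul_lt_top ENNReal.ofReal_lt_top
      (ENNReal.mul_lt_top ENNReal.ofReal_lt_top hKt.lt_top)
  have h3 := h lam (fun j => (hlam0 j).ne') (diagonalGL lam fun j => (hlam0 j).ne') rfl f hfm
  have hprod : ∏ j : Fin d, (max 1 |lam j|) ^ α j * (min 1 |lam j|) ^ β j =
      (max 1 L) ^ α j₀ * (min 1 L) ^ β j₀ := by
    rw [Finset.prod_eq_single j₀]
    · simp [hlam, abs_of_pos hL]
    · intro j _ hj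
      simp [hlam, hj]
    · simp
  set w := (max 1 L) ^ α j₀ * (min 1 L) ^ β j₀ with hw
  have hw0 : 0 ≤ w := mul_nonneg (Real.rpow_nonneg (zero_le_one.trans (le_max_left _ _)) _)
    (Real.rpow_nonneg (le_min zero_le_one hL.le) _)
  set R : ℝ := ∏ j ∈ Finset.univ.erase j₀, gaussNorm p q 1 0 with hR
  have hR0 : 0 < R := Finset.prod_pos fun _ _ => gaussNorm_pos p q one_pos 0
  have hsplit : ∏ j, gaussNorm p q (a' j) (b' j) = gaussNorm p q a b * R := by
    rw [← Finset.mul_prod_erase _ _ (Finset.mem_univ j₀)]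
    congr 1
    · simp [ha', hb']
    · refine Finset.prod_congr rfl fun j hj => ?_
      simp [ha', hb', Finset.ne_of_mem_erase hj]
  have hsplit' : ∏ j, gaussNorm p q (lam j ^ 2 * a' j) (lam j ^ 2 * b' j) =
      gaussNorm p q (L ^ 2 * a) (L ^ 2 * b) * R := by
    rw [← Finset.mul_prod_erase _ _ (Finset.mem_univ j₀)]
    congr 1
    · simp [hlam, ha', hb']
    · refine Finset.prod_congr rfl fun j hj => ?_
      simp [hlam, ha', hb', Finset.ne_of_mem_erase hj]
  have h4 := (h₂ _).trans (mul_le_mul_right (h3.trans (mul_le_mul_right (h₁ f) _)) _)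
  rw [hf1, hprod, hsplit, hf, dilation_gaussian a' b' lam ha'0 (fun j => (hlam0 j).ne') hla,
    modNorm_gaussian hp _ _ hla, hsplit', ← hK] at h4
  clear_value K
  rw [← mul_assoc, ← mul_assoc, ← mul_assoc,
    ENNReal.mul_le_mul_iff_left hK0 hKt, ← ENNReal.ofReal_mul (by positivity),
    ← ENNReal.ofReal_mul (by positivity), ← ENNReal.ofReal_mul (by positivity)] at h4
  have hν := gaussNorm_pos p q ha b
  rw [ENNReal.ofReal_le_ofReal_iff (by positivity)] at h4
  refine le_of_mul_le_mul_right (h4.trans_eq ?_) hR0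
  ring

/-- The logarithm of `gaussNorm`, along curves on which `gaussD`, `gaussE` and `a` behave like
exponentials. -/
theorem abs_log_gaussNorm_sub_le {p q : ℝ≥0∞} (hp : 1 ≤ p) (hq : 1 ≤ q) {a b t δ ε σ : ℝ}
    (ha : a = Real.exp (σ * t)) (hD : Real.exp (δ * t) ≤ gaussD a b)
    (hD' : gaussD a b ≤ 5 * Real.exp (δ * t)) (hE : Real.exp (ε * t) ≤ gaussE a b)
    (hE' : gaussE a b ≤ 5 * Real.exp (ε * t)) :
    |Real.log (gaussNorm p q a b) - ((-(1 / 4) + recip p / 2) * δ +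
      (-(recip p / 2) + recip q / 2) * ε - recip q / 2 * σ) * t| ≤ 6 := by
  have ha0 : 0 < a := ha ▸ Real.exp_pos _
  have hD0 := gaussD_pos ha0 b
  have hE0 := gaussE_pos ha0 b
  have hlog : ∀ {X m : ℝ}, 0 < X → Real.exp (m * t) ≤ X → X ≤ 5 * Real.exp (m * t) →
      |Real.log X - m * t| ≤ 4 := fun {X m} hX h h' => by
    have h1 := Real.log_le_log (Real.exp_pos _) h
    have h2 := Real.log_le_log hX h'
    rw [Real.log_mul (by norm_num) (Real.exp_pos _).ne'] at h2
    rw [Real.log_exp] at h1 h2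
    have h3 := Real.log_le_sub_one_of_pos (x := 5) (by norm_num)
    rw [abs_le]
    constructor <;> linarith
  have eD := hlog hD0 hD hD'
  have eE := hlog hE0 hE hE'
  have hl : Real.log (gaussNorm p q a b) = (-(1 / 4) + recip p / 2) * Real.log (gaussD a b) +
      (-(recip p / 2) + recip q / 2) * Real.log (gaussE a b) - recip q / 2 * (σ * t) := by
    rw [gaussNorm, Real.log_mul (by positivity) (by positivity),
      Real.log_mul (by positivity) (by positivity), Real.log_rpow hD0,
      Real.log_rpow (by positivity), Real.log_rpow (by positivity), Real.log_sqrt (by positivity),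
      Real.log_sqrt (by positivity), Real.log_div hE0.ne' hD0.ne', Real.log_div ha0.ne' hE0.ne',
      ha, Real.log_exp]
    ring
  have hp0 := recip_nonneg p
  have hp1 := recip_le_one hp
  have hq0 := recip_nonneg q
  have hq1 := recip_le_one hq
  have c1 : |-(1 / 4) + recip p / 2| ≤ 1 / 4 := by rw [abs_le]; constructor <;> linarith
  have c2 : |-(recip p / 2) + recip q / 2| ≤ 1 / 2 := by rw [abs_le]; constructor <;> linarith
  rw [hl, show (-(1 / 4) + recip p / 2) * Real.log (gaussD a b) +
      (-(recip p / 2) + recip q / 2) * Real.log (gaussE a b) - recip q / 2 * (σ * t) -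
      ((-(1 / 4) + recip p / 2) * δ + (-(recip p / 2) + recip q / 2) * ε - recip q / 2 * σ) * t =
      (-(1 / 4) + recip p / 2) * (Real.log (gaussD a b) - δ * t) +
      (-(recip p / 2) + recip q / 2) * (Real.log (gaussE a b) - ε * t) by ring]
  refine (abs_add_le _ _).trans ?_
  rw [abs_mul, abs_mul]
  have := mul_le_mul c1 eD (abs_nonneg _) (by norm_num)
  have := mul_le_mul c2 eE (abs_nonneg _) (by norm_num)
  linarith

theorem le_of_forall_mul_le {e α M : ℝ} (h : ∀ t, 0 ≤ t → e * t ≤ α * t + M) : e ≤ α := by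
  by_contra! hlt
  have hpos : 0 < e - α := by linarith
  have hM : 0 ≤ M := by simpa using h 0 le_rfl
  have h1 := h ((M + 1) / (e - α)) (by positivity)
  have h2 : (e - α) * ((M + 1) / (e - α)) = M + 1 := by field_simp
  linarith

/-- Comparing the norms of the Gaussians at the two ends of a dilation by `e^t` bounds the exponents
of a one-variable dilation estimate from both sides. -/
theorem exponent_bounds {p q : ℝ≥0∞} {α β C m m' : ℝ} (hC : 0 < C)
    (h : ∀ L a b : ℝ, 0 < L → 0 < a → gaussNorm p q (L ^ 2 * a) (L ^ 2 * b) ≤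
      C * ((max 1 L) ^ α * (min 1 L) ^ β) * gaussNorm p q a b)
    {a b a' b' : ℝ → ℝ} (ha : ∀ t, 0 < a t) (haa : ∀ t, a' t = Real.exp t ^ 2 * a t)
    (hbb : ∀ t, b' t = Real.exp t ^ 2 * b t)
    (h1 : ∀ t, 0 ≤ t → |Real.log (gaussNorm p q (a t) (b t)) - m * t| ≤ 6)
    (h2 : ∀ t, 0 ≤ t → |Real.log (gaussNorm p q (a' t) (b' t)) - m' * t| ≤ 6) :
    m' - m ≤ α ∧ β ≤ m' - m := by
  have ha' : ∀ t, 0 < a' t := fun t => by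
    rw [haa]
    exact mul_pos (pow_pos (Real.exp_pos t) 2) (ha t)
  constructor
  · refine le_of_forall_mul_le (M := Real.log C + 12) fun t ht => ?_
    have h3 := h (Real.exp t) (a t) (b t) (Real.exp_pos t) (ha t)
    rw [← haa, ← hbb, max_eq_right (Real.one_le_exp ht), min_eq_left (Real.one_le_exp ht),
      Real.one_rpow, mul_one] at h3
    have h4 := Real.log_le_log (gaussNorm_pos p q (ha' t) _) h3
    rw [Real.log_mul (by positivity) (gaussNorm_pos p q (ha t) _).ne',
      Real.log_mul hC.ne' (by positivity), Real.log_rpow (Real.exp_pos t), Real.log_exp] at h4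
    have h5 := abs_le.1 (h1 t ht)
    have h6 := abs_le.1 (h2 t ht)
    linarith
  · refine le_of_forall_mul_le (M := Real.log C + 12) fun t ht => ?_
    have h3 := h (Real.exp (-t)) (a' t) (b' t) (Real.exp_pos _) (ha' t)
    have hinv : Real.exp (-t) ^ 2 * Real.exp t ^ 2 = 1 := by
      rw [← mul_pow, ← Real.exp_add, neg_add_cancel, Real.exp_zero, one_pow]
    have hle : Real.exp (-t) ≤ 1 := Real.exp_le_one_iff.2 (by linarith)
    have e1 : Real.exp (-t) ^ 2 * a' t = a t := by rw [haa, ← mul_assoc, hinv, one_mul]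
    have e2 : Real.exp (-t) ^ 2 * b' t = b t := by rw [hbb, ← mul_assoc, hinv, one_mul]
    rw [e1, e2, max_eq_left hle, min_eq_right hle, Real.one_rpow, one_mul] at h3
    have h4 := Real.log_le_log (gaussNorm_pos p q (ha t) _) h3
    rw [Real.log_mul (by positivity) (gaussNorm_pos p q (ha' t) _).ne',
      Real.log_mul hC.ne' (by positivity), Real.log_rpow (Real.exp_pos _), Real.log_exp] at h4
    have h5 := abs_le.1 (h1 t ht)
    have h6 := abs_le.1 (h2 t ht)
    linarith

/-- Dilating by `e^t` the Gaussians with parameters `1`, `e^{-2t}` and `e^{-4t} + i e^{-2t}` shows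
that `α` is at least, and `β` at most, each of `1/q - 1`, `-1/p` and `1/q - 2/p`. The value of `μ₁`,
and that of `μ₂`, is always one of the three. -/
theorem mu_bounds {p q : ℝ≥0∞} (hp : 1 ≤ p) (hq : 1 ≤ q) {α β C : ℝ} (hC : 0 < C)
    (h : ∀ L a b : ℝ, 0 < L → 0 < a → gaussNorm p q (L ^ 2 * a) (L ^ 2 * b) ≤
      C * ((max 1 L) ^ α * (min 1 L) ^ β) * gaussNorm p q a b) :
    mu1 p q ≤ α ∧ β ≤ mu2 p q := by
  have hle : ∀ {s t : ℝ}, s ≤ 0 → 0 ≤ t → Real.exp (s * t) ≤ 1 := fun hs ht =>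
    Real.exp_le_one_iff.2 (mul_nonpos_of_nonpos_of_nonneg hs ht)
  have hmul : ∀ t s : ℝ, Real.exp t ^ 2 * Real.exp (s * t) = Real.exp ((s + 2) * t) := fun t s => by
    rw [← Real.exp_nat_mul, ← Real.exp_add]
    congr 1
    push_cast
    ring
  -- the standard Gaussian, written with `e^{0 t}` so that all the curves have the same form, and
  -- its dilates by `e^t` and `e^{-t}`
  have b1 : ∀ t, 0 ≤ t →
      |Real.log (gaussNorm p q (Real.exp (0 * t)) 0) - 0 * t| ≤ 6 := fun t _ => by
    have := abs_log_gaussNorm_sub_le hp hq (b := 0) (t := t) (δ := 0) (ε := 0) (σ := 0) rfl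
      (by norm_num [gaussD]) (by norm_num [gaussD]) (by norm_num [gaussE])
      (by norm_num [gaussE])
    simpa using this
  have b2 : ∀ t, 0 ≤ t →
      |Real.log (gaussNorm p q (Real.exp (2 * t)) 0) - (recip q - 1) * t| ≤ 6 := fun t ht => by
    have hsq : Real.exp (4 * t) = Real.exp (2 * t) ^ 2 := by
      rw [← Real.exp_nat_mul]; congr 1; push_cast; ring
    have h1 : 1 ≤ Real.exp (2 * t) := Real.one_le_exp (by positivity)
    have := abs_log_gaussNorm_sub_le hp hq (b := 0) (t := t) (δ := 4) (ε := 4) (σ := 2) rfl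
      (by rw [hsq, gaussD]; nlinarith) (by rw [hsq, gaussD]; nlinarith)
      (by rw [hsq, gaussE]; nlinarith) (by rw [hsq, gaussE]; nlinarith)
    convert this using 4
    ring
  have b3 : ∀ t, 0 ≤ t →
      |Real.log (gaussNorm p q (Real.exp (-2 * t)) 0) - recip p * t| ≤ 6 := fun t ht => by
    have h1 : Real.exp (-2 * t) ≤ 1 := hle (by norm_num) ht
    have h0 := Real.exp_pos (-2 * t)
    have := abs_log_gaussNorm_sub_le hp hq (b := 0) (t := t) (δ := 0) (ε := -2) (σ := -2) rfl
      (by rw [zero_mul, Real.exp_zero, gaussD]; nlinarith)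
      (by rw [zero_mul, Real.exp_zero, gaussD]; nlinarith)
      (by rw [gaussE]; nlinarith) (by rw [gaussE]; nlinarith)
    convert this using 4
    ring
  -- the Gaussians with parameters `e^{-2t} + i` and `e^{-4t} + i e^{-2t}`
  have b4 : ∀ t, 0 ≤ t →
      |Real.log (gaussNorm p q (Real.exp (-2 * t)) (Real.exp (0 * t))) - recip q * t| ≤ 6 :=
    fun t ht => by
    have h1 : Real.exp (-2 * t) ≤ 1 := hle (by norm_num) ht
    have h0 := Real.exp_pos (-2 * t)
    have := abs_log_gaussNorm_sub_le hp hq (b := Real.exp (0 * t)) (t := t) (δ := 0) (ε := 0)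
      (σ := -2) rfl
      (by rw [zero_mul, Real.exp_zero, gaussD]; nlinarith)
      (by rw [zero_mul, Real.exp_zero, gaussD]; nlinarith)
      (by rw [zero_mul, Real.exp_zero, gaussE]; nlinarith)
      (by rw [zero_mul, Real.exp_zero, gaussE]; nlinarith)
    convert this using 4
    ring
  have b5 : ∀ t, 0 ≤ t →
      |Real.log (gaussNorm p q (Real.exp (-4 * t)) (Real.exp (-2 * t))) - 2 * recip p * t| ≤ 6 :=
    fun t ht => by
    have hsq : Real.exp (-2 * t) ^ 2 = Real.exp (-4 * t) := by
      rw [← Real.exp_nat_mul]; congr 1; push_cast; ring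
    have h1 : Real.exp (-4 * t) ≤ 1 := hle (by norm_num) ht
    have h0 := Real.exp_pos (-4 * t)
    have := abs_log_gaussNorm_sub_le hp hq (b := Real.exp (-2 * t)) (t := t) (δ := 0) (ε := -4)
      (σ := -4) rfl
      (by rw [zero_mul, Real.exp_zero, gaussD]; nlinarith)
      (by rw [zero_mul, Real.exp_zero, gaussD, hsq]; nlinarith)
      (by rw [gaussE, hsq]; nlinarith) (by rw [gaussE, hsq]; nlinarith)
    convert this using 4
    ring
  have c1 := exponent_bounds hC h (fun t => Real.exp_pos (0 * t))
    (a' := fun t => Real.exp (2 * t)) (b := fun _ => 0) (b' := fun _ => 0)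
    (fun t => by rw [hmul t 0]; norm_num) (fun t => by simp) b1 b2
  have c2 := exponent_bounds hC h (fun t => Real.exp_pos (-2 * t))
    (a' := fun t => Real.exp (0 * t)) (b := fun _ => 0) (b' := fun _ => 0)
    (fun t => by rw [hmul t (-2)]; norm_num) (fun t => by simp) b3 b1
  have c3 := exponent_bounds hC h (fun t => Real.exp_pos (-4 * t))
    (a' := fun t => Real.exp (-2 * t)) (b := fun t => Real.exp (-2 * t))
    (b' := fun t => Real.exp (0 * t))
    (fun t => by rw [hmul t (-4)]; norm_num) (fun t => by rw [hmul t (-2)]; norm_num) b5 b4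
  obtain ⟨d1, d2, d3, d4⟩ := mu1_cases p q
  obtain ⟨e1, e2, e3, e4⟩ := mu2_cases p q
  constructor
  · rcases d4 with hd | hd | hd
    · rw [d1 hd]; linarith
    · rw [d2 hd]; linarith
    · rw [d3 hd]; linarith
  · rcases e4 with hd | hd | hd
    · rw [e1 hd]; linarith
    · rw [e2 hd]; linarith
    · rw [e3 hd]; linarith

end ModulationDilation

end

theorem theorem3p6 (d : ℕ) (p q : ℝ≥0∞) (hp : 1 ≤ p) (hq : 1 ≤ q)
    (g : 𝓢(EuclideanSpace ℝ (Fin d), ℂ)) (hg : g ≠ 0) :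
    (∃ C : ℝ, 0 < C ∧
      ∀ (A : GL (Fin d) ℝ) (hA : (A : Matrix (Fin d) (Fin d) ℝ).IsSymm),
        ∀ f ∈ ModulationDilation.modSpace g p q,
          ModulationDilation.modNorm g p q (ModulationDilation.dilation A f) ≤
            ENNReal.ofReal (C * ∏ j : Fin d,
              (max 1 |(ModulationDilation.isHermitian_of_isSymm hA).eigenvalues j|) ^
                  ModulationDilation.mu1 p q *
                (min 1 |(ModulationDilation.isHermitian_of_isSymm hA).eigenvalues j|) ^
                  ModulationDilation.mu2 p q) *
            ModulationDilation.modNorm g p q f) ∧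
    (∀ α β : Fin d → ℝ,
      (∃ C : ℝ, 0 < C ∧
        ∀ lam : Fin d → ℝ, (∀ j, lam j ≠ 0) →
          ∀ A : GL (Fin d) ℝ, (A : Matrix (Fin d) (Fin d) ℝ) = Matrix.diagonal lam →
            ∀ f ∈ ModulationDilation.modSpace g p q,
              ModulationDilation.modNorm g p q (ModulationDilation.dilation A f) ≤
                ENNReal.ofReal (C * ∏ j : Fin d,
                  (max 1 |lam j|) ^ α j * (min 1 |lam j|) ^ β j) *
                ModulationDilation.modNorm g p q f) →
      ∀ j, ModulationDilation.mu1 p q ≤ α j ∧ β j ≤ ModulationDilation.mu2 p q) := by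
  refine ⟨?_, ?_⟩
  · obtain ⟨C, hC, h⟩ :=
      ModulationDilation.exists_modNorm_dilation_le_of_isHermitian hp hq hg
    exact ⟨C, hC, fun A hA f _ => h A _ f⟩
  · rintro α β ⟨C, hC, h⟩ j
    obtain ⟨C', hC', h'⟩ := ModulationDilation.exists_gaussNorm_le hp hq hg hC h j
    exact ModulationDilation.mu_bounds hp hq hC' h'
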